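/- **Conventions.** Bicategories and 2-categories are small (in a fixed universe). A *functor* of bicategories is a pseudofunctor; a *2-functor* between 2-categories is one whose constraints are identities. An *icon* $\alpha:F\Rightarrow G$ exists only if $F,G$ agree on objects; it consists of 2-cells $\alpha_f:Ff\Rightarrow Gf$, natural in the 1-cell $f$ and compatible with the unit and composition constraints of $F$ and $G$. $\mathbf{Icon}$ is the 2-category of bicategories, functors and icons, with its cartesian monoidal structure $(\times,1)$. $\mathbf{Gray}_{icon}$ is the 2-category of 2-categories, 2-functors and icons, with the monoidal structure given by the Gray tensor product $\otimes$, with unit $1$; $i:\mathbf{Gray}_{icon}\to\mathbf{Icon}$ is the inclusion. The 1-cells of $A\otimes B$ are generated by $f\otimes 1$ and $1\otimes g$, functorially in $f\in A$ and in $g\in B$; its 2-cells $p\Rightarrow q$ are the 2-cells $\pi p\Rightarrow\pi q$ of $A\times B$, where $\pi$ sends $f\otimes1$ to $(f,1)$ and $1\otimes g$ to $(1,g)$; and it is equipped with a functor $c_{A,B}:A\times B\to A\otimes B$ sending $(f,g)$ to $(1\otimes g)*(f\otimes 1)$, such that $\pi c_{A,B}=1$. A functor $H:A\times B\to C$ is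 *cubical* if it strictly preserves identities and the comparison $H(f_1,f_2)*H(g_1,g_2)\Rightarrow H(f_1*g_1,f_2*g_2)$ is an identity whenever $g_2$ or $f_1$ is an identity. For a bicategory $B$, the *strictification* $\mathrm{st}B$ is the 2-category with the objects of $B$, whose 1-cells are (possibly empty) strings $\{f_n,\dots,f_1\}$ of composable 1-cells of $B$, composed by concatenation, and whose 2-cells $s\Rightarrow t$ are the 2-cells $e(s)\Rightarrow e(t)$ of $B$, where $e(\{f_n,\dots,f_1\})=(\cdots(f_nf_{n-1})\cdots)f_1$ and $e(\varnothing)=1$. A functor $F$ is sent to the 2-functor $\mathrm{st}F$ given by $\{f_n,\dots,f_1\}\mapsto\{Ff_n,\dots,Ff_1\}$, acting on 2-cells by $F$ conjugated with its constraints. An icon $\alpha$ is sent to the icon $\mathrm{st}\alpha$ whose component at a string is the horizontal composite of the $\alpha_{f_j}$, conjugated with coherence isomorphisms. The unit $\eta_B:B\to \mathrm{st}B$ sends $f$ to $\{f\}$, and, for a 2-category $A$, the counit $\varepsilon_A:\mathrm{st}A\to A$ is the 2-functor given by $e$ on 1-cells and the identity on 2-cells. A *$\mathbf{Cat}$-lax*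 (respectively *$\mathbf{Cat}$-oplax*) *monoidal functor* $F$ between strongly monoidal 2-categories (that is, $\mathbf{Cat}$-enriched monoidal categories) is a 2-functor with 1-cells $Fx\otimes Fy\to F(x\otimes y)$ (respectively $F(x\otimes y)\to Fx\otimes Fy$), 2-natural in $x,y$, and a 1-cell $I\to FI$ (respectively $FI\to I$), satisfying the usual associativity and unit axioms of a lax (respectively oplax) monoidal functor strictly. **Corollary 5.5.** $\mathbf{Icon}$ and $\mathbf{Gray}_{icon}$ are strongly monoidal 2-categories, and $\mathrm{st}:\mathbf{Icon}\to\mathbf{Gray}_{icon}$ is a 2-functor, left 2-adjoint to $i$ with unit $\eta$ and counit $\varepsilon$. The functor $c_{A,B}$ is the universal cubical functor: it is cubical, and every cubical functor $A\times B\to C$ to a 2-category $C$ is $K\circ c_{A,B}$ for a unique 2-functor $K:A\otimes B\to C$. The functors $c_{A,B}$ and the identity $1\to i1$ make $i$ a $\mathbf{Cat}$-lax monoidal functor. Moreover, $\mathrm{st}$ is a $\mathbf{Cat}$-oplax monoidal functor, with structure 1-cells the mates of these, $$\mathrm{st}(X\times Y)\xrightarrow{\ \mathrm{st}(\eta_X\times\eta_Y)\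 }\mathrm{st}(\mathrm{st}X\times\mathrm{st}Y)\xrightarrow{\ \mathrm{st}(c)\ }\mathrm{st}(\mathrm{st}X\otimes\mathrm{st}Y)\xrightarrow{\ \varepsilon\ }\mathrm{st}X\otimes\mathrm{st}Y,$$ $$\mathrm{st}1\xrightarrow{\ \mathrm{st}(\mathrm{id})\ }\mathrm{st}1\xrightarrow{\ \varepsilon\ }1 .$$ -/

import Mathlib

open CategoryTheory Bicategory
open scoped CategoryTheory.Prod

universe w v u w' v' u'

namespace IconGray

section

/-! ### 2-cells between 1-cells whose end points are only propositionally equal -/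

/-- For 1-cells `f : a ⟶ b` and `g : a' ⟶ b'` of a bicategory, a 2-cell `f ⇒ g` in the situation
where `a = a'` and `b = b'`. -/
structure HCell {C : Type u} [Bicategory.{w, v} C] {a b a' b' : C} (f : a ⟶ b) (g : a' ⟶ b') where
  src : a = a'
  tgt : b = b'
  cell : f ⟶ g.cast src.symm tgt.symm

namespace HCell

section

variable {C : Type*} [Bicategory C] {D : Type*} [Bicategory D]

/-- An ordinary 2-cell. -/
def of {a b : C} {f g : a ⟶ b} (η : f ⟶ g) : HCell f g := ⟨rfl, rfl, η⟩

/-- The ordinary 2-cell underlying an `HCell` between parallel 1-cells. -/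
def toHom {a b : C} {f g : a ⟶ b} (x : HCell f g) : f ⟶ g := x.cell

/-- The identity 2-cell of an identity 1-cell. -/
def unit {a a' : C} (h : a = a') : HCell (𝟙 a) (𝟙 a') :=
  match a', h with
  | _, rfl => of (𝟙 (𝟙 a))

/-- Vertical composition. -/
def vcomp {a b a' b' a'' b'' : C} {f : a ⟶ b} {g : a' ⟶ b'} {h : a'' ⟶ b''}
    (x : HCell f g) (y : HCell g h) : HCell f h :=
  match a', b', g, x, y with
  | _, _, _, ⟨rfl, rfl, η⟩, ⟨hs, ht, θ⟩ => ⟨hs, ht, η ≫ θ⟩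

/-- Horizontal composition. -/
def hcomp {a b c a' b' c' : C} {f : a ⟶ b} {f' : a' ⟶ b'} {g : b ⟶ c} {g' : b' ⟶ c'}
    (x : HCell f f') (y : HCell g g') : HCell (f ≫ g) (f' ≫ g') :=
  match a', b', c', f', g', x, y with
  | _, _, _, _, g', ⟨rfl, rfl, η⟩, ⟨_, rfl, θ⟩ => of (η ▷ g ≫ (_ ◁ (θ : g ⟶ g')))

/-- The image of a 2-cell under a pseudofunctor. -/
def map (F : C ⥤ᵖ D) {a b a' b' : C} {f : a ⟶ b} {g : a' ⟶ b'} (x : HCell f g) :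
    HCell (F.map f) (F.map g) :=
  match a', b', g, x with
  | _, _, _, ⟨rfl, rfl, η⟩ => of (F.map₂ η)

@[simp] theorem toHom_of {a b : C} {f g : a ⟶ b} (η : f ⟶ g) : (of η).toHom = η := rfl
@[simp] theorem of_toHom {a b : C} {f g : a ⟶ b} (x : HCell f g) : of x.toHom = x := rfl
theorem of_inj {a b : C} {f g : a ⟶ b} {η θ : f ⟶ g} (h : of η = of θ) : η = θ :=
  congrArg toHom h
@[simp] theorem unit_rfl (a : C) : unit (rfl : a = a) = of (𝟙 (𝟙 a)) := rfl
@[simp] theorem vcomp_of {a b : C} {f g h : a ⟶ b} (η : f ⟶ g) (θ : g ⟶ h) :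
    vcomp (of η) (of θ) = of (η ≫ θ) := rfl
@[simp] theorem hcomp_of {a b c : C} {f f' : a ⟶ b} {g g' : b ⟶ c} (η : f ⟶ f') (θ : g ⟶ g') :
    hcomp (of η) (of θ) = of (η ▷ g ≫ f' ◁ θ) := rfl
@[simp] theorem map_of (F : C ⥤ᵖ D) {a b : C} {f g : a ⟶ b} (η : f ⟶ g) :
    map F (of η) = of (F.map₂ η) := rfl

theorem exists_of {a b : C} {f g : a ⟶ b} (x : HCell f g) : ∃ η, x = of η := ⟨x.toHom, rfl⟩

theorem id_vcomp {a b a' b' : C} {f : a ⟶ b} {g : a' ⟶ b'} (x : HCell f g) :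
    vcomp (of (𝟙 f)) x = x := by
  obtain rfl := x.src; obtain rfl := x.tgt
  obtain ⟨η, rfl⟩ := exists_of x
  simp

theorem vcomp_id {a b a' b' : C} {f : a ⟶ b} {g : a' ⟶ b'} (x : HCell f g) :
    vcomp x (of (𝟙 g)) = x := by
  obtain rfl := x.src; obtain rfl := x.tgt
  obtain ⟨η, rfl⟩ := exists_of x
  simp

theorem vcomp_assoc {a b a' b' a'' b'' a₃ b₃ : C} {f : a ⟶ b} {g : a' ⟶ b'} {h : a'' ⟶ b''}
    {k : a₃ ⟶ b₃} (x : HCell f g) (y : HCell g h) (z : HCell h k) :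
    vcomp (vcomp x y) z = vcomp x (vcomp y z) := by
  obtain rfl := x.src; obtain rfl := x.tgt
  obtain rfl := y.src; obtain rfl := y.tgt
  obtain rfl := z.src; obtain rfl := z.tgt
  obtain ⟨η, rfl⟩ := exists_of x
  obtain ⟨θ, rfl⟩ := exists_of y
  obtain ⟨κ, rfl⟩ := exists_of z
  simp

theorem interchange {a b c a' b' c' a'' b'' c'' : C} {f : a ⟶ b} {f' : a' ⟶ b'} {f'' : a'' ⟶ b''}
    {g : b ⟶ c} {g' : b' ⟶ c'} {g'' : b'' ⟶ c''}
    (x : HCell f f') (x' : HCell f' f'') (y : HCell g g') (y' : HCell g' g'') :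
    hcomp (vcomp x x') (vcomp y y') = vcomp (hcomp x y) (hcomp x' y') := by
  obtain rfl := x.src; obtain rfl := x.tgt; obtain rfl := y.tgt
  obtain rfl := x'.src; obtain rfl := x'.tgt; obtain rfl := y'.tgt
  obtain ⟨η, rfl⟩ := exists_of x
  obtain ⟨η', rfl⟩ := exists_of x'
  obtain ⟨θ, rfl⟩ := exists_of y
  obtain ⟨θ', rfl⟩ := exists_of y'
  simp only [vcomp_of, hcomp_of, comp_whiskerRight, whiskerLeft_comp, Category.assoc]
  rw [← whisker_exchange_assoc]

theorem map_vcomp (F : C ⥤ᵖ D) {a b a' b' a'' b'' : C} {f : a ⟶ b} {g : a' ⟶ b'} {h : a'' ⟶ b''}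
    (x : HCell f g) (y : HCell g h) : map F (vcomp x y) = vcomp (map F x) (map F y) := by
  obtain rfl := x.src; obtain rfl := x.tgt
  obtain rfl := y.src; obtain rfl := y.tgt
  obtain ⟨η, rfl⟩ := exists_of x
  obtain ⟨θ, rfl⟩ := exists_of y
  simp

theorem map_unit (F : C ⥤ᵖ D) {a a' : C} (h : a = a') :
    vcomp (of (F.mapId a).inv) (map F (unit h)) =
      vcomp (unit (congrArg F.obj h)) (of (F.mapId a').inv) := by
  subst h
  simp

theorem map_hcomp (F : C ⥤ᵖ D) {a b c a' b' c' : C} {f : a ⟶ b} {f' : a' ⟶ b'} {g : b ⟶ c}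
    {g' : b' ⟶ c'} (x : HCell f f') (y : HCell g g') :
    vcomp (of (F.mapComp f g).inv) (map F (hcomp x y)) =
      vcomp (hcomp (map F x) (map F y)) (of (F.mapComp f' g').inv) := by
  obtain rfl := x.src; obtain rfl := x.tgt; obtain rfl := y.tgt
  obtain ⟨η, rfl⟩ := exists_of x
  obtain ⟨θ, rfl⟩ := exists_of y
  simp

theorem map_comp_functor {E : Type*} [Bicategory E] (F : C ⥤ᵖ D) (G : D ⥤ᵖ E) {a b a' b' : C}
    {f : a ⟶ b} {g : a' ⟶ b'} (x : HCell f g) : map (F.comp G) x = map G (map F x) := by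
  obtain rfl := x.src; obtain rfl := x.tgt
  obtain ⟨η, rfl⟩ := exists_of x
  rfl

theorem map_id_functor {a b a' b' : C} {f : a ⟶ b} {g : a' ⟶ b'} (x : HCell f g) :
    map (Pseudofunctor.id C) x = x := by
  obtain rfl := x.src; obtain rfl := x.tgt
  obtain ⟨η, rfl⟩ := exists_of x
  rfl

end

end HCell

open HCell

variable {B : Type*} [Bicategory B] {C : Type*} [Bicategory C] {D : Type*} [Bicategory D]

/-- An icon `F ⇒ G` between pseudofunctors which agree on objects. -/
structure Icon (F G : B ⥤ᵖ C) where
  obj_eq (a : B) : F.obj a = G.obj a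
  app {a b : B} (f : a ⟶ b) : HCell (F.map f) (G.map f)
  naturality {a b : B} {f g : a ⟶ b} (η : f ⟶ g) :
    vcomp (of (F.map₂ η)) (app g) = vcomp (app f) (of (G.map₂ η))
  app_id (a : B) : vcomp (of (F.mapId a).inv) (app (𝟙 a)) =
    vcomp (unit (obj_eq a)) (of (G.mapId a).inv)
  app_comp {a b c : B} (f : a ⟶ b) (g : b ⟶ c) :
    vcomp (of (F.mapComp f g).inv) (app (f ≫ g)) =
      vcomp (hcomp (app f) (app g)) (of (G.mapComp f g).inv)

@[ext]
theorem Icon.ext {F G : B ⥤ᵖ C} {α β : Icon F G} 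
    (h : @Icon.app _ _ _ _ _ _ α = @Icon.app _ _ _ _ _ _ β) : α = β := by
  cases α; cases β; congr

end

section
open HCell
section
variable {B : Type*} [Bicategory B] {C : Type*} [Bicategory C] {D : Type*} [Bicategory D]

namespace HCell
theorem of_comp {a b : C} {f g h : a ⟶ b} (η : f ⟶ g) (θ : g ⟶ h) :
    of (η ≫ θ) = vcomp (of η) (of θ) := rfl

theorem hcomp_id_id {a b c : C} (f : a ⟶ b) (g : b ⟶ c) :
    hcomp (of (𝟙 f)) (of (𝟙 g)) = of (𝟙 (f ≫ g)) := by simp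

theorem of_vcomp_of_vcomp {a b a' b' : C} {f g h : a ⟶ b} {k : a' ⟶ b'} (η : f ⟶ g) (θ : g ⟶ h)
    (x : HCell h k) : vcomp (of η) (vcomp (of θ) x) = vcomp (of (η ≫ θ)) x := by
  rw [of_comp, vcomp_assoc]

theorem unit_vcomp_unit {a b c : C} (h : a = b) (h' : b = c) :
    vcomp (unit h) (unit h') = unit (h.trans h') := by
  subst h; subst h'; simp

theorem map_of_functor (F : B ⥤ᵖ C) {a b a' b' : B} {f : a ⟶ b} {g : a' ⟶ b'}
    (x : HCell f g) {F' : B ⥤ᵖ C} (α : Icon F F') :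
    vcomp (map F x) (α.app g) = vcomp (α.app f) (map F' x) := by
  obtain rfl := x.src; obtain rfl := x.tgt
  obtain ⟨η, rfl⟩ := exists_of x
  exact α.naturality η
end HCell

namespace Icon

/-- The identity icon. -/
def id (F : B ⥤ᵖ C) : Icon F F where
  obj_eq _ := rfl
  app f := of (𝟙 (F.map f))
  naturality η := by simp
  app_id a := by simp
  app_comp f g := by simp

/-- Vertical composition of icons. -/
def vcomp {F G H : B ⥤ᵖ C} (α : Icon F G) (β : Icon G H) : Icon F H where
  obj_eq a := (α.obj_eq a).trans (β.obj_eq a)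
  app f := HCell.vcomp (α.app f) (β.app f)
  naturality η := by
    rw [← HCell.vcomp_assoc, α.naturality, HCell.vcomp_assoc, β.naturality, HCell.vcomp_assoc]
  app_id a := by
    rw [← HCell.vcomp_assoc, α.app_id, HCell.vcomp_assoc, β.app_id, ← HCell.vcomp_assoc,
      unit_vcomp_unit]
  app_comp f g := by
    rw [← HCell.vcomp_assoc, α.app_comp, HCell.vcomp_assoc, β.app_comp, ← HCell.vcomp_assoc,
      interchange]

/-- Precomposition of an icon with a pseudofunctor. -/
def whiskerLeft (F : B ⥤ᵖ C) {G H : C ⥤ᵖ D} (α : Icon G H) : Icon (F.comp G) (F.comp H) where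
  obj_eq a := α.obj_eq (F.obj a)
  app f := α.app (F.map f)
  naturality η := α.naturality (F.map₂ η)
  app_id a := by
    change HCell.vcomp (of ((G.mapId _).inv ≫ G.map₂ (F.mapId a).inv)) _ =
      HCell.vcomp _ (of ((H.mapId _).inv ≫ H.map₂ (F.mapId a).inv))
    rw [of_comp, of_comp, HCell.vcomp_assoc, α.naturality, ← HCell.vcomp_assoc, α.app_id,
      HCell.vcomp_assoc]
    rfl
  app_comp f g := by
    change HCell.vcomp (of ((G.mapComp _ _).inv ≫ G.map₂ (F.mapComp f g).inv)) _ =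
      HCell.vcomp _ (of ((H.mapComp _ _).inv ≫ H.map₂ (F.mapComp f g).inv))
    rw [of_comp, of_comp, HCell.vcomp_assoc, α.naturality, ← HCell.vcomp_assoc, α.app_comp,
      HCell.vcomp_assoc]
    rfl

/-- Postcomposition of an icon with a pseudofunctor. -/
def whiskerRight {F G : B ⥤ᵖ C} (α : Icon F G) (H : C ⥤ᵖ D) : Icon (F.comp H) (G.comp H) where
  obj_eq a := congrArg H.obj (α.obj_eq a)
  app f := map H (α.app f)
  naturality {_ _ f g} η := by
    have := congrArg (map H) (α.naturality η)
    rw [map_vcomp, map_vcomp] at this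
    exact this
  app_id a := by
    change HCell.vcomp (of ((H.mapId _).inv ≫ H.map₂ (F.mapId a).inv)) _ =
      HCell.vcomp _ (of ((H.mapId _).inv ≫ H.map₂ (G.mapId a).inv))
    rw [of_comp, of_comp, HCell.vcomp_assoc, ← map_of, ← map_vcomp, α.app_id, map_vcomp,
      ← HCell.vcomp_assoc, map_unit, HCell.vcomp_assoc, map_of]
    rfl
  app_comp f g := by
    change HCell.vcomp (of ((H.mapComp _ _).inv ≫ H.map₂ (F.mapComp f g).inv)) _ =
      HCell.vcomp _ (of ((H.mapComp _ _).inv ≫ H.map₂ (G.mapComp f g).inv))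
    rw [of_comp, of_comp, HCell.vcomp_assoc, ← map_of, ← map_vcomp, α.app_comp, map_vcomp,
      ← HCell.vcomp_assoc, map_hcomp, HCell.vcomp_assoc, map_of]
    rfl

end Icon
end

theorem pseudofunctor_ext {B : Type*} [Bicategory B] {C : Type*} [Bicategory C] {F G : B ⥤ᵖ C}
    (h : F.toPrelaxFunctor = G.toPrelaxFunctor)
    (hid : ∀ a, HEq (F.mapId a).inv (G.mapId a).inv)
    (hcomp : ∀ {a b c} (f : a ⟶ b) (g : b ⟶ c), HEq (F.mapComp f g).inv (G.mapComp f g).inv) : F = G := by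
  cases F with | mk F i1 c1 _ _ _ _ _ =>
  cases G with | mk G i2 c2 _ _ _ _ _ =>
  obtain rfl : F = G := h
  obtain rfl : i1 = i2 := by
    funext a
    exact Iso.ext_inv (eq_of_heq (hid a))
  obtain rfl : @c1 = @c2 := by
    funext a b c f g
    exact Iso.ext_inv (eq_of_heq (hcomp f g))
  rfl

theorem comp_assoc {B C D E : Type*} [Bicategory B] [Bicategory C] [Bicategory D] [Bicategory E]
    (F : B ⥤ᵖ C) (G : C ⥤ᵖ D) (H : D ⥤ᵖ E) : (F.comp G).comp H = F.comp (G.comp H) := by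
  refine pseudofunctor_ext rfl (fun a => heq_of_eq ?_) (fun f g => heq_of_eq ?_)
  · change (H.mapId _).inv ≫ H.map₂ ((G.mapId _).inv ≫ G.map₂ (F.mapId a).inv) =
      ((H.mapId _).inv ≫ H.map₂ (G.mapId _).inv) ≫ H.map₂ (G.map₂ (F.mapId a).inv)
    simp
  · change (H.mapComp _ _).inv ≫ H.map₂ ((G.mapComp _ _).inv ≫ G.map₂ (F.mapComp f g).inv) =
      ((H.mapComp _ _).inv ≫ H.map₂ (G.mapComp _ _).inv) ≫ H.map₂ (G.map₂ (F.mapComp f g).inv)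
    simp

theorem id_comp {B C : Type*} [Bicategory B] [Bicategory C] (F : B ⥤ᵖ C) :
    (Pseudofunctor.id B).comp F = F := by
  refine pseudofunctor_ext rfl (fun a => heq_of_eq ?_) (fun f g => heq_of_eq ?_)
  · change (F.mapId a).inv ≫ F.map₂ (𝟙 _) = _
    simp
  · change (F.mapComp f g).inv ≫ F.map₂ (𝟙 _) = _
    simp

theorem comp_id {B C : Type*} [Bicategory B] [Bicategory C] (F : B ⥤ᵖ C) :
    F.comp (Pseudofunctor.id C) = F := by
  refine pseudofunctor_ext rfl (fun a => heq_of_eq ?_) (fun f g => heq_of_eq ?_)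
  · exact Category.id_comp _
  · exact Category.id_comp _

end

section
open HCell

/-- Objects of the 2-category of (small) bicategories, pseudofunctors and icons. -/
structure IconCat : Type (u + 1) where
  carrier : Type u
  [str : Bicategory.{u, u} carrier]

attribute [instance] IconCat.str

namespace IconCat

instance : CoeSort IconCat.{u} (Type u) := ⟨carrier⟩

instance : CategoryStruct IconCat.{u} where
  Hom B C := B ⥤ᵖ C
  id B := Pseudofunctor.id B
  comp F G := F.comp G

instance homCat (B C : IconCat.{u}) : Category.{u} (B ⟶ C) where
  Hom F G := Icon F G
  id F := Icon.id F
  comp α β := α.vcomp β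
  id_comp α := Icon.ext (by funext a b f; exact id_vcomp _)
  comp_id α := Icon.ext (by funext a b f; exact vcomp_id _)
  assoc α β γ := Icon.ext (by funext a b f; exact vcomp_assoc _ _ _)

@[ext]
theorem hom₂_ext {B C : IconCat.{u}} {F G : B ⟶ C} {α β : F ⟶ G}
    (h : ∀ {a b : B} (f : a ⟶ b), Icon.app α f = Icon.app β f) : α = β :=
  Icon.ext (by funext a b f; exact h f)

theorem comp_app {B C : IconCat.{u}} {F G H : B ⟶ C} (α : F ⟶ G) (β : G ⟶ H) {a b : B} (f : a ⟶ b) :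
    Icon.app (α ≫ β) f = HCell.vcomp (Icon.app α f) (Icon.app β f) := rfl

theorem id_app {B C : IconCat.{u}} (F : B ⟶ C) {a b : B} (f : a ⟶ b) :
    Icon.app (𝟙 F) f = of (𝟙 (Pseudofunctor.toPrelaxFunctor F |>.map f)) := rfl

theorem eqToHom_app {B C : IconCat.{u}} {F G : B ⟶ C} (h : F = G) {a b : B} (f : a ⟶ b) :
    HEq (Icon.app (eqToHom h) f) (of (𝟙 (Pseudofunctor.toPrelaxFunctor F |>.map f))) := by
  subst h; rfl

theorem assoc_app {B C D E : IconCat.{u}} (F : B ⟶ C) (G : C ⟶ D) (H : D ⟶ E)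
    (h : (F ≫ G) ≫ H = F ≫ G ≫ H) {a b : B} (f : a ⟶ b) :
    Icon.app (eqToHom h) f =
      of (𝟙 (Pseudofunctor.toPrelaxFunctor (F ≫ G ≫ H) |>.map f)) := eq_of_heq (eqToHom_app _ f)

theorem assoc_app' {B C D E : IconCat.{u}} (F : B ⟶ C) (G : C ⟶ D) (H : D ⟶ E)
    (h : F ≫ G ≫ H = (F ≫ G) ≫ H) {a b : B} (f : a ⟶ b) :
    Icon.app (eqToHom h) f =
      of (𝟙 (Pseudofunctor.toPrelaxFunctor (F ≫ G ≫ H) |>.map f)) := eq_of_heq (eqToHom_app _ f)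

theorem id_comp_app {B C : IconCat.{u}} (F : B ⟶ C) (h : 𝟙 B ≫ F = F) {a b : B} (f : a ⟶ b) :
    Icon.app (eqToHom h) f =
      of (𝟙 (Pseudofunctor.toPrelaxFunctor F |>.map f)) := eq_of_heq (eqToHom_app _ f)

theorem id_comp_app' {B C : IconCat.{u}} (F : B ⟶ C) (h : F = 𝟙 B ≫ F) {a b : B} (f : a ⟶ b) :
    Icon.app (eqToHom h) f =
      of (𝟙 (Pseudofunctor.toPrelaxFunctor F |>.map f)) := eq_of_heq (eqToHom_app _ f)

theorem comp_id_app {B C : IconCat.{u}} (F : B ⟶ C) (h : F ≫ 𝟙 C = F) {a b : B} (f : a ⟶ b) :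
    Icon.app (eqToHom h) f =
      of (𝟙 (Pseudofunctor.toPrelaxFunctor F |>.map f)) := eq_of_heq (eqToHom_app _ f)

theorem comp_id_app' {B C : IconCat.{u}} (F : B ⟶ C) (h : F = F ≫ 𝟙 C) {a b : B} (f : a ⟶ b) :
    Icon.app (eqToHom h) f =
      of (𝟙 (Pseudofunctor.toPrelaxFunctor F |>.map f)) := eq_of_heq (eqToHom_app _ f)

theorem whiskerLeft_eqToHom' {B C D : IconCat.{u}} (F : B ⟶ C) {G H : C ⟶ D} (h : G = H) :
    (Icon.whiskerLeft F (eqToHom h) : F ≫ G ⟶ F ≫ H) = eqToHom (congrArg (F ≫ ·) h) := by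
  subst h; rfl

theorem whiskerRight_eqToHom' {B C D : IconCat.{u}} {F G : B ⟶ C} (h : F = G) (H : C ⟶ D) :
    (Icon.whiskerRight (eqToHom h) H : F ≫ H ⟶ G ≫ H) = eqToHom (congrArg (· ≫ H) h) := by
  subst h
  ext a b f
  exact congrArg of (Pseudofunctor.toPrelaxFunctor H |>.map₂_id _)

instance : Bicategory IconCat.{u} where
  homCategory := homCat
  whiskerLeft F _ _ α := Icon.whiskerLeft F α
  whiskerRight α H := Icon.whiskerRight α H
  associator F G H := eqToIso (comp_assoc F G H)
  leftUnitor F := eqToIso (id_comp F)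
  rightUnitor F := eqToIso (comp_id F)
  whiskerLeft_id _ _ := rfl
  whiskerLeft_comp _ _ _ _ _ _ := rfl
  id_whiskerLeft {_ _ F G} α := by
    ext a b f
    rw [comp_app, comp_app, eqToIso.hom, eqToIso.inv]
    erw [id_comp_app, id_comp_app', vcomp_id, id_vcomp]
    rfl
  comp_whiskerLeft F G H K α := by
    ext a b f
    rw [comp_app, comp_app, eqToIso.hom, eqToIso.inv]
    erw [assoc_app, assoc_app', vcomp_id, id_vcomp]
    rfl
  id_whiskerRight F G := by
    ext a b f
    exact congrArg of (Pseudofunctor.toPrelaxFunctor G |>.map₂_id _)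
  comp_whiskerRight α β H := by
    ext a b f
    exact map_vcomp H _ _
  whiskerRight_id {_ _ F G} α := by
    ext a b f
    rw [comp_app, comp_app, eqToIso.hom, eqToIso.inv]
    erw [comp_id_app, comp_id_app', vcomp_id, id_vcomp]
    exact map_id_functor _
  whiskerRight_comp α G H := by
    ext a b f
    rw [comp_app, comp_app, eqToIso.hom, eqToIso.inv]
    erw [assoc_app, assoc_app', vcomp_id, id_vcomp]
    exact map_comp_functor _ _ _
  whisker_assoc F G H α K := by
    ext a b f
    rw [comp_app, comp_app, eqToIso.hom, eqToIso.inv]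
    erw [assoc_app, assoc_app', vcomp_id, id_vcomp]
    rfl
  whisker_exchange {_ _ _ F G H K} α β := by
    ext a b f
    exact (map_of_functor _ _ β).symm
  pentagon F G H K := by
    rw [eqToIso.hom, eqToIso.hom, eqToIso.hom, eqToIso.hom, eqToIso.hom]
    erw [whiskerRight_eqToHom', whiskerLeft_eqToHom', eqToHom_trans, eqToHom_trans, eqToHom_trans]
  triangle F G := by
    rw [eqToIso.hom, eqToIso.hom, eqToIso.hom]
    erw [whiskerRight_eqToHom', whiskerLeft_eqToHom', eqToHom_trans]

instance : Bicategory.Strict IconCat.{u} where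
  id_comp := id_comp
  comp_id := comp_id
  assoc := comp_assoc

end IconCat

end

section
open HCell

/-- Objects of the 2-category of (small) 2-categories, 2-functors and icons. -/
structure GrayCat : Type (u + 1) where
  carrier : Type u
  [str : Bicategory.{u, u} carrier]
  [strict : Bicategory.Strict carrier]

attribute [instance] GrayCat.str GrayCat.strict

theorem strictPseudofunctor_ext {B : Type*} [Bicategory B] {C : Type*} [Bicategory C]
    {F G : StrictPseudofunctor B C} (h : F.toPseudofunctor = G.toPseudofunctor) : F = G := by
  cases F with | mk F _ _ =>
  cases G with | mk G _ _ =>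
  cases F with | mk F _ _ =>
  cases G with | mk G _ _ =>
  obtain rfl : F = G := h
  rfl

namespace GrayCat

instance : CoeSort GrayCat.{u} (Type u) := ⟨carrier⟩

/-- A 2-category is a bicategory. -/
def toIcon (A : GrayCat.{u}) : IconCat.{u} := ⟨A⟩

instance : CategoryStruct GrayCat.{u} where
  Hom B C := StrictPseudofunctor B C
  id B := StrictPseudofunctor.id B
  comp F G := F.comp G

/-- A 2-functor is a pseudofunctor. -/
def toPs {B C : GrayCat.{u}} (F : B ⟶ C) : B.toIcon ⟶ C.toIcon :=
  StrictlyUnitaryPseudofunctor.toPseudofunctor (StrictPseudofunctor.toStrictlyUnitaryPseudofunctor F)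

theorem toPs_injective {B C : GrayCat.{u}} {F G : B ⟶ C} (h : toPs F = toPs G) : F = G :=
  strictPseudofunctor_ext h

theorem toPs_comp {B C D : GrayCat.{u}} (F : B ⟶ C) (G : C ⟶ D) :
    toPs (F ≫ G) = toPs F ≫ toPs G := rfl

theorem toPs_id (B : GrayCat.{u}) : toPs (𝟙 B) = 𝟙 B.toIcon := rfl

instance homCat (B C : GrayCat.{u}) : Category.{u} (B ⟶ C) where
  Hom F G := toPs F ⟶ toPs G
  id F := 𝟙 (toPs F)
  comp α β := α ≫ β
  id_comp α := Category.id_comp (obj := B.toIcon ⟶ C.toIcon) α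
  comp_id α := Category.comp_id (obj := B.toIcon ⟶ C.toIcon) α
  assoc α β γ := Category.assoc (obj := B.toIcon ⟶ C.toIcon) α β γ

/-- Icons between 2-functors are icons between the underlying pseudofunctors. -/
def isoOfPs {B C : GrayCat.{u}} {F G : B ⟶ C} (i : toPs F ≅ toPs G) : F ≅ G :=
  ⟨i.hom, i.inv, i.hom_inv_id, i.inv_hom_id⟩

theorem isoOfPs_eqToIso {B C : GrayCat.{u}} {F G : B ⟶ C} (h : toPs F = toPs G) :
    isoOfPs (eqToIso h) = eqToIso (toPs_injective h) := by
  obtain rfl := toPs_injective h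
  rfl

instance : Bicategory GrayCat.{u} where
  homCategory := homCat
  whiskerLeft F _ _ α := toPs F ◁ (show toPs _ ⟶ toPs _ from α)
  whiskerRight α H := (show toPs _ ⟶ toPs _ from α) ▷ toPs H
  associator F G H := isoOfPs (α_ (toPs F) (toPs G) (toPs H))
  leftUnitor F := isoOfPs (λ_ (toPs F))
  rightUnitor F := isoOfPs (ρ_ (toPs F))
  whiskerLeft_id F G := Bicategory.whiskerLeft_id (toPs F) (toPs G)
  whiskerLeft_comp F _ _ _ α β := Bicategory.whiskerLeft_comp (B := IconCat) (toPs F) α β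
  id_whiskerLeft α := Bicategory.id_whiskerLeft (B := IconCat) α
  comp_whiskerLeft F G _ _ α := Bicategory.comp_whiskerLeft (B := IconCat) (toPs F) (toPs G) α
  id_whiskerRight F G := Bicategory.id_whiskerRight (toPs F) (toPs G)
  comp_whiskerRight α β H := Bicategory.comp_whiskerRight (B := IconCat) α β (toPs H)
  whiskerRight_id α := Bicategory.whiskerRight_id (B := IconCat) α
  whiskerRight_comp α G H := Bicategory.whiskerRight_comp (B := IconCat) α (toPs G) (toPs H)
  whisker_assoc F _ _ α H := Bicategory.whisker_assoc (B := IconCat) (toPs F) α (toPs H)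
  whisker_exchange α β := Bicategory.whisker_exchange (B := IconCat) α β
  pentagon F G H K := Bicategory.pentagon (toPs F) (toPs G) (toPs H) (toPs K)
  triangle F G := Bicategory.triangle (toPs F) (toPs G)

instance : Bicategory.Strict GrayCat.{u} where
  id_comp F := toPs_injective (Bicategory.Strict.id_comp (toPs F))
  comp_id F := toPs_injective (Bicategory.Strict.comp_id (toPs F))
  assoc F G H := toPs_injective (Bicategory.Strict.assoc (toPs F) (toPs G) (toPs H))
  leftUnitor_eqToIso F := isoOfPs_eqToIso (F := 𝟙 _ ≫ F) (G := F)
    (Bicategory.Strict.id_comp (toPs F))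
  rightUnitor_eqToIso F := isoOfPs_eqToIso (F := F ≫ 𝟙 _) (G := F)
    (Bicategory.Strict.comp_id (toPs F))
  associator_eqToIso F G H := isoOfPs_eqToIso (F := (F ≫ G) ≫ H) (G := F ≫ G ≫ H)
    (Bicategory.Strict.assoc (toPs F) (toPs G) (toPs H))

end GrayCat

/-- The inclusion 2-functor, on objects, 1-cells and 2-cells. -/
def incl : PrelaxFunctorStruct GrayCat.{u} IconCat.{u} where
  obj A := A.toIcon
  map F := GrayCat.toPs F
  map₂ α := α

end

section
open HCell

section
variable {A : Type*} [Bicategory A] {A' : Type*} [Bicategory A']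
  {B : Type*} [Bicategory B] {B' : Type*} [Bicategory B'] {C : Type*} [Bicategory C]

/-- The product of two pseudofunctors. -/
def prodMap (F : A ⥤ᵖ A') (G : B ⥤ᵖ B') : (A × B) ⥤ᵖ (A' × B') where
  obj x := (F.obj x.1, G.obj x.2)
  map f := F.map f.1 ×ₘ G.map f.2
  map₂ η := F.map₂ η.1 ×ₘ G.map₂ η.2
  map₂_id f := Prod.ext (F.map₂_id f.1) (G.map₂_id f.2)
  map₂_comp η θ := Prod.ext (F.map₂_comp η.1 θ.1) (G.map₂_comp η.2 θ.2)
  mapId x := Iso.prod (F.mapId x.1) (G.mapId x.2)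
  mapComp f g := Iso.prod (F.mapComp f.1 g.1) (G.mapComp f.2 g.2)
  map₂_whisker_left f _ _ η := Prod.ext (F.map₂_whisker_left f.1 η.1) (G.map₂_whisker_left f.2 η.2)
  map₂_whisker_right η f := Prod.ext (F.map₂_whisker_right η.1 f.1) (G.map₂_whisker_right η.2 f.2)
  map₂_associator f g h :=
    Prod.ext (F.map₂_associator f.1 g.1 h.1) (G.map₂_associator f.2 g.2 h.2)
  map₂_left_unitor f := Prod.ext (F.map₂_left_unitor f.1) (G.map₂_left_unitor f.2)
  map₂_right_unitor f := Prod.ext (F.map₂_right_unitor f.1) (G.map₂_right_unitor f.2)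

/-- A pair of 2-cells, as a 2-cell of the product bicategory. -/
def HCell.prod {a b a' b' : A} {f : a ⟶ b} {f' : a' ⟶ b'} {c d c' d' : B} {g : c ⟶ d}
    {g' : c' ⟶ d'} (x : HCell f f') (y : HCell g g') : HCell (f ×ₘ g) (f' ×ₘ g') :=
  match a', b', c', d', f', g', x, y with
  | _, _, _, _, _, _, ⟨rfl, rfl, η⟩, ⟨rfl, rfl, θ⟩ => of (η ×ₘ θ)

namespace HCell

theorem prod_vcomp {a b a' b' a'' b'' : A} {f : a ⟶ b} {f' : a' ⟶ b'} {f'' : a'' ⟶ b''}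
    {c d c' d' c'' d'' : B} {g : c ⟶ d} {g' : c' ⟶ d'} {g'' : c'' ⟶ d''}
    (x : HCell f f') (x' : HCell f' f'') (y : HCell g g') (y' : HCell g' g'') :
    prod (vcomp x x') (vcomp y y') = vcomp (prod x y) (prod x' y') := by
  obtain rfl := x.src; obtain rfl := x.tgt; obtain rfl := y.src; obtain rfl := y.tgt
  obtain rfl := x'.src; obtain rfl := x'.tgt; obtain rfl := y'.src; obtain rfl := y'.tgt
  rfl

theorem prod_hcomp {a b a' b' e e' : A} {f : a ⟶ b} {f' : a' ⟶ b'} {h : b ⟶ e} {h' : b' ⟶ e'}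
    {c d c' d' k k' : B} {g : c ⟶ d} {g' : c' ⟶ d'} {l : d ⟶ k} {l' : d' ⟶ k'}
    (x : HCell f f') (x' : HCell h h') (y : HCell g g') (y' : HCell l l') :
    prod (hcomp x x') (hcomp y y') = hcomp (prod x y) (prod x' y') := by
  obtain rfl := x.src; obtain rfl := x.tgt; obtain rfl := y.src; obtain rfl := y.tgt
  obtain rfl := x'.tgt; obtain rfl := y'.tgt
  rfl

theorem prod_unit {a a' : A} {b b' : B} (h : a = a') (h' : b = b') :
    prod (unit h) (unit h') = unit (a := (a, b)) (a' := (a', b')) (Prod.ext h h') := by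
  subst h; subst h'; rfl

end HCell

/-- The product of two icons. -/
def Icon.prod {F F' : A ⥤ᵖ A'} {G G' : B ⥤ᵖ B'} (α : Icon F F') (β : Icon G G') :
    Icon (prodMap F G) (prodMap F' G') where
  obj_eq x := Prod.ext (α.obj_eq x.1) (β.obj_eq x.2)
  app f := HCell.prod (α.app f.1) (β.app f.2)
  naturality {_ _ f g} η := by
    refine (HCell.prod_vcomp (of (F.map₂ η.1)) _ (of (G.map₂ η.2)) _).symm.trans ?_
    rw [α.naturality, β.naturality, HCell.prod_vcomp]
    rfl
  app_id x := by
    refine (HCell.prod_vcomp (of (F.mapId x.1).inv) _ (of (G.mapId x.2).inv) _).symm.trans ?_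
    erw [α.app_id, β.app_id, HCell.prod_vcomp, HCell.prod_unit]
    rfl
  app_comp f g := by
    refine (HCell.prod_vcomp (of (F.mapComp f.1 g.1).inv) _
      (of (G.mapComp f.2 g.2).inv) _).symm.trans ?_
    erw [α.app_comp, β.app_comp, HCell.prod_vcomp, HCell.prod_hcomp]
    rfl

variable (A B C) in
/-- The associativity isomorphism of the product of bicategories. -/
def prodAssoc : ((A × B) × C) ⥤ᵖ (A × (B × C)) where
  obj x := (x.1.1, (x.1.2, x.2))
  map f := f.1.1 ×ₘ (f.1.2 ×ₘ f.2)
  map₂ η := η.1.1 ×ₘ (η.1.2 ×ₘ η.2)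
  mapId _ := Iso.refl _
  mapComp _ _ := Iso.refl _

/-- The terminal bicategory: one object, one 1-cell, one 2-cell. -/
abbrev One : Type u := LocallyDiscrete (Discrete PUnit.{u + 1})

variable (A B) in
/-- The projection to the first factor. -/
def prodFst : (A × B) ⥤ᵖ A := (Bicategory.Prod.fst A B).toPseudofunctor

variable (A B) in
/-- The projection to the second factor. -/
def prodSnd : (A × B) ⥤ᵖ B := (Bicategory.Prod.snd A B).toPseudofunctor

end

end

section
open HCell

section Generic

variable {A : Type u} [Bicategory.{w, v} A] {B : Type u'} [Bicategory.{w', v'} B]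

/-- The given action on objects, 1-cells and 2-cells is a 2-functor. -/
def IsTwoFunctor (F : PrelaxFunctorStruct A B) : Prop :=
  ∃ P : StrictPseudofunctor A B, P.toPrelaxFunctorStruct = F

/-- The 1-cells `η a : F a ⟶ G a` form a 2-natural transformation. -/
structure IsTwoNatural (F G : PrelaxFunctorStruct A B) (η : ∀ a, F.obj a ⟶ G.obj a) : Prop where
  naturality {a b : A} (f : a ⟶ b) : F.map f ≫ η b = η a ≫ G.map f
  naturality₂ {a b : A} {f g : a ⟶ b} (α : f ⟶ g) :
    F.map₂ α ▷ η b = eqToHom (naturality f) ≫ η a ◁ G.map₂ α ≫ eqToHom (naturality g).symm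

/-- A 1-cell of a 2-category is an isomorphism. -/
def IsInvertible {a b : A} (f : a ⟶ b) : Prop :=
  ∃ g : b ⟶ a, f ≫ g = 𝟙 a ∧ g ≫ f = 𝟙 b

/-- The product of two actions on objects, 1-cells and 2-cells. -/
def prodStruct {A' : Type*} [Bicategory A'] {B' : Type*} [Bicategory B']
    (F : PrelaxFunctorStruct A A') (G : PrelaxFunctorStruct B B') :
    PrelaxFunctorStruct (A × B) (A' × B') where
  obj x := (F.obj x.1, G.obj x.2)
  map f := F.map f.1 ×ₘ G.map f.2
  map₂ η := F.map₂ η.1 ×ₘ G.map₂ η.2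

variable (A) in
/-- The data of a monoidal structure on a 2-category. -/
structure MonoidalData where
  tensor : PrelaxFunctorStruct (A × A) A
  unit : A
  assoc (a b c : A) : tensor.obj (tensor.obj (a, b), c) ⟶ tensor.obj (a, tensor.obj (b, c))
  leftUnitor (a : A) : tensor.obj (unit, a) ⟶ a
  rightUnitor (a : A) : tensor.obj (a, unit) ⟶ a

/-- The tensor product of two 1-cells. -/
abbrev MonoidalData.hom (M : MonoidalData A) {a a' b b' : A} (f : a ⟶ a') (g : b ⟶ b') :
    M.tensor.obj (a, b) ⟶ M.tensor.obj (a', b') :=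
  M.tensor.map (f ×ₘ g)

/-- The given data form a strongly monoidal 2-category. -/
structure IsStronglyMonoidal [Strict A] (M : MonoidalData A) : Prop where
  tensor_functor : IsTwoFunctor M.tensor
  assoc_natural : IsTwoNatural
    ((prodStruct M.tensor (.id A)).comp M.tensor)
    ((prodAssoc A A A).toPrelaxFunctorStruct.comp ((prodStruct (.id A) M.tensor).comp M.tensor))
    (fun x => M.assoc x.1.1 x.1.2 x.2)
  assoc_invertible (a b c : A) : IsInvertible (M.assoc a b c)
  leftUnitor_natural : IsTwoNatural
    { obj a := M.tensor.obj (M.unit, a)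
      map f := M.hom (𝟙 M.unit) f
      map₂ η := M.tensor.map₂ (𝟙 (𝟙 M.unit) ×ₘ η) } (.id A) M.leftUnitor
  leftUnitor_invertible (a : A) : IsInvertible (M.leftUnitor a)
  rightUnitor_natural : IsTwoNatural
    { obj a := M.tensor.obj (a, M.unit)
      map f := M.hom f (𝟙 M.unit)
      map₂ η := M.tensor.map₂ (η ×ₘ 𝟙 (𝟙 M.unit)) } (.id A) M.rightUnitor
  rightUnitor_invertible (a : A) : IsInvertible (M.rightUnitor a)
  pentagon (a b c d : A) :
    M.hom (M.assoc a b c) (𝟙 d) ≫ M.assoc a (M.tensor.obj (b, c)) d ≫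
      M.hom (𝟙 a) (M.assoc b c d) =
    M.assoc (M.tensor.obj (a, b)) c d ≫ M.assoc a b (M.tensor.obj (c, d))
  triangle (a b : A) :
    M.assoc a M.unit b ≫ M.hom (𝟙 a) (M.leftUnitor b) = M.hom (M.rightUnitor a) (𝟙 b)

/-- A **Cat**-lax monoidal functor between strongly monoidal 2-categories. -/
structure IsCatLaxMonoidal [Strict A] [Strict B] (M : MonoidalData A) (N : MonoidalData B)
    (F : PrelaxFunctorStruct A B)
    (χ : ∀ x y : A, N.tensor.obj (F.obj x, F.obj y) ⟶ F.obj (M.tensor.obj (x, y)))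
    (ι : N.unit ⟶ F.obj M.unit) : Prop where
  source : IsStronglyMonoidal M
  target : IsStronglyMonoidal N
  functor : IsTwoFunctor F
  natural : IsTwoNatural ((prodStruct F F).comp N.tensor) (M.tensor.comp F) (fun x => χ x.1 x.2)
  associativity (x y z : A) :
    N.hom (χ x y) (𝟙 (F.obj z)) ≫ χ (M.tensor.obj (x, y)) z ≫ F.map (M.assoc x y z) =
      N.assoc (F.obj x) (F.obj y) (F.obj z) ≫ N.hom (𝟙 (F.obj x)) (χ y z) ≫
        χ x (M.tensor.obj (y, z))
  left_unitality (x : A) :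
    N.hom ι (𝟙 (F.obj x)) ≫ χ M.unit x ≫ F.map (M.leftUnitor x) = N.leftUnitor (F.obj x)
  right_unitality (x : A) :
    N.hom (𝟙 (F.obj x)) ι ≫ χ x M.unit ≫ F.map (M.rightUnitor x) = N.rightUnitor (F.obj x)

/-- A **Cat**-oplax monoidal functor between strongly monoidal 2-categories. -/
structure IsCatOplaxMonoidal [Strict A] [Strict B] (M : MonoidalData A) (N : MonoidalData B)
    (F : PrelaxFunctorStruct A B)
    (χ : ∀ x y : A, F.obj (M.tensor.obj (x, y)) ⟶ N.tensor.obj (F.obj x, F.obj y))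
    (ι : F.obj M.unit ⟶ N.unit) : Prop where
  source : IsStronglyMonoidal M
  target : IsStronglyMonoidal N
  functor : IsTwoFunctor F
  natural : IsTwoNatural (M.tensor.comp F) ((prodStruct F F).comp N.tensor) (fun x => χ x.1 x.2)
  associativity (x y z : A) :
    F.map (M.assoc x y z) ≫ χ x (M.tensor.obj (y, z)) ≫ N.hom (𝟙 (F.obj x)) (χ y z) =
      χ (M.tensor.obj (x, y)) z ≫ N.hom (χ x y) (𝟙 (F.obj z)) ≫
        N.assoc (F.obj x) (F.obj y) (F.obj z)
  left_unitality (x : A) :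
    χ M.unit x ≫ N.hom ι (𝟙 (F.obj x)) ≫ N.leftUnitor (F.obj x) = F.map (M.leftUnitor x)
  right_unitality (x : A) :
    χ x M.unit ≫ N.hom (𝟙 (F.obj x)) ι ≫ N.rightUnitor (F.obj x) = F.map (M.rightUnitor x)

/-- A 2-adjunction `F ⊣ U` with unit `η` and counit `θ`. -/
structure IsTwoAdjunction [Strict A] [Strict B] (F : PrelaxFunctorStruct A B)
    (U : PrelaxFunctorStruct B A) (η : ∀ x : A, x ⟶ U.obj (F.obj x))
    (θ : ∀ y : B, F.obj (U.obj y) ⟶ y) : Prop where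
  left_functor : IsTwoFunctor F
  right_functor : IsTwoFunctor U
  unit_natural : IsTwoNatural (.id A) (F.comp U) η
  counit_natural : IsTwoNatural (U.comp F) (.id B) θ
  left_triangle (x : A) : F.map (η x) ≫ θ (F.obj x) = 𝟙 (F.obj x)
  right_triangle (y : B) : η (U.obj y) ≫ U.map (θ y) = 𝟙 (U.obj y)

section Mates

variable (M : MonoidalData A) (N : MonoidalData B) (F : PrelaxFunctorStruct A B)
  (U : PrelaxFunctorStruct B A) (η : ∀ x : A, x ⟶ U.obj (F.obj x))
  (θ : ∀ y : B, F.obj (U.obj y) ⟶ y)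

/-- The mate, under `F ⊣ U`, of a comparison map `φ : U x ⊗ U y ⟶ U (x ⊗ y)`. -/
def mateTensor (φ : ∀ x y : B, M.tensor.obj (U.obj x, U.obj y) ⟶ U.obj (N.tensor.obj (x, y)))
    (x y : A) : F.obj (M.tensor.obj (x, y)) ⟶ N.tensor.obj (F.obj x, F.obj y) :=
  F.map (M.hom (η x) (η y)) ≫ F.map (φ (F.obj x) (F.obj y)) ≫ θ _

/-- The mate, under `F ⊣ U`, of a comparison map `φ₀ : I ⟶ U I`. -/
def mateUnit (φ₀ : M.unit ⟶ U.obj N.unit) : F.obj M.unit ⟶ N.unit :=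
  F.map φ₀ ≫ θ _

end Mates

end Generic

/-- The cartesian monoidal structure on the 2-category of bicategories, pseudofunctors, icons. -/
def iconMonoidal : MonoidalData IconCat.{u} where
  tensor :=
    { obj x := ⟨x.1 × x.2⟩
      map f := prodMap f.1 f.2
      map₂ α := Icon.prod α.1 α.2 }
  unit := ⟨One.{u}⟩
  assoc A B C := prodAssoc A B C
  leftUnitor A := prodSnd One A
  rightUnitor A := prodFst A One

end

section
open HCell

/-! ### 2-categories with given 1-cells, and 2-cells taken from a bicategory -/

/-- A (pseudo)functor from the category `K` to the bicategory `B`. -/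
structure Realization (K : Type*) [Category K] (B : Type*) [Bicategory B] where
  obj : K → B
  map {x y : K} (p : x ⟶ y) : obj x ⟶ obj y
  idIso (x : K) : 𝟙 (obj x) ≅ map (𝟙 x)
  compIso {x y z : K} (p : x ⟶ y) (q : y ⟶ z) : map p ≫ map q ≅ map (p ≫ q)
  assoc {x y z t : K} (p : x ⟶ y) (q : y ⟶ z) (r : z ⟶ t) :
    (compIso p q).hom ▷ map r ≫ (compIso (p ≫ q) r).hom ≫
        eqToHom (congrArg map (Category.assoc p q r)) =
      (α_ (map p) (map q) (map r)).hom ≫ map p ◁ (compIso q r).hom ≫ (compIso p (q ≫ r)).hom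
  id_left {x y : K} (p : x ⟶ y) :
    (idIso x).hom ▷ map p ≫ (compIso (𝟙 x) p).hom ≫ eqToHom (congrArg map (Category.id_comp p)) =
      (λ_ (map p)).hom
  id_right {x y : K} (p : x ⟶ y) :
    map p ◁ (idIso y).hom ≫ (compIso p (𝟙 y)).hom ≫ eqToHom (congrArg map (Category.comp_id p)) =
      (ρ_ (map p)).hom

namespace Realization

variable {K : Type*} [Category K] {B : Type*} [Bicategory B] (R : Realization K B)

/-- Left whiskering of a 2-cell between realizations. -/
def wl {x y z : K} (p : x ⟶ y) {q q' : y ⟶ z} (η : R.map q ⟶ R.map q') :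
    R.map (p ≫ q) ⟶ R.map (p ≫ q') :=
  (R.compIso p q).inv ≫ R.map p ◁ η ≫ (R.compIso p q').hom

/-- Right whiskering of a 2-cell between realizations. -/
def wr {x y z : K} {p p' : x ⟶ y} (η : R.map p ⟶ R.map p') (q : y ⟶ z) :
    R.map (p ≫ q) ⟶ R.map (p' ≫ q) :=
  (R.compIso p q).inv ≫ η ▷ R.map q ≫ (R.compIso p' q).hom

section
variable {a b c d : K}

theorem comp_hom (p : a ⟶ b) (q : b ⟶ c) (r : c ⟶ d) :
    (R.compIso (p ≫ q) r).hom = (R.compIso p q).inv ▷ R.map r ≫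
      (α_ (R.map p) (R.map q) (R.map r)).hom ≫ R.map p ◁ (R.compIso q r).hom ≫
        (R.compIso p (q ≫ r)).hom ≫ eqToHom (congrArg R.map (Category.assoc p q r).symm) := by
  rw [← reassoc_of% (R.assoc p q r)]
  simp

theorem comp_inv (p : a ⟶ b) (q : b ⟶ c) (r : c ⟶ d) :
    (R.compIso (p ≫ q) r).inv = eqToHom (congrArg R.map (Category.assoc p q r)) ≫
      (R.compIso p (q ≫ r)).inv ≫ R.map p ◁ (R.compIso q r).inv ≫
      (α_ (R.map p) (R.map q) (R.map r)).inv ≫ (R.compIso p q).hom ▷ R.map r := by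
  rw [← Category.comp_id (R.compIso (p ≫ q) r).inv, Iso.inv_comp_eq, comp_hom]
  simp

theorem id_left_hom (p : a ⟶ b) : (R.compIso (𝟙 a) p).hom =
    (R.idIso a).inv ▷ R.map p ≫ (λ_ (R.map p)).hom ≫
      eqToHom (congrArg R.map (Category.id_comp p).symm) := by
  rw [← R.id_left]
  simp

theorem id_left_inv (p : a ⟶ b) : (R.compIso (𝟙 a) p).inv =
    eqToHom (congrArg R.map (Category.id_comp p)) ≫ (λ_ (R.map p)).inv ≫
      (R.idIso a).hom ▷ R.map p := by
  rw [← Category.comp_id (R.compIso (𝟙 a) p).inv, Iso.inv_comp_eq, id_left_hom]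
  simp

theorem id_right_hom (p : a ⟶ b) : (R.compIso p (𝟙 b)).hom =
    R.map p ◁ (R.idIso b).inv ≫ (ρ_ (R.map p)).hom ≫
      eqToHom (congrArg R.map (Category.comp_id p).symm) := by
  rw [← R.id_right]
  simp

theorem id_right_inv (p : a ⟶ b) : (R.compIso p (𝟙 b)).inv =
    eqToHom (congrArg R.map (Category.comp_id p)) ≫ (ρ_ (R.map p)).inv ≫
      R.map p ◁ (R.idIso b).hom := by
  rw [← Category.comp_id (R.compIso p (𝟙 b)).inv, Iso.inv_comp_eq, id_right_hom]
  simp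

theorem wl_id (p : a ⟶ b) (q : b ⟶ c) : R.wl p (𝟙 (R.map q)) = 𝟙 _ := by simp [wl]

theorem wl_comp (p : a ⟶ b) {q r s : b ⟶ c} (η : R.map q ⟶ R.map r) (θ : R.map r ⟶ R.map s) :
    R.wl p (η ≫ θ) = R.wl p η ≫ R.wl p θ := by simp [wl]

theorem wr_id (p : a ⟶ b) (q : b ⟶ c) : R.wr (𝟙 (R.map p)) q = 𝟙 _ := by simp [wr]

theorem wr_comp {p q r : a ⟶ b} (η : R.map p ⟶ R.map q) (θ : R.map q ⟶ R.map r) (s : b ⟶ c) :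
    R.wr (η ≫ θ) s = R.wr η s ≫ R.wr θ s := by simp [wr]

theorem id_wl {p q : a ⟶ b} (η : R.map p ⟶ R.map q) : R.wl (𝟙 a) η =
    eqToHom (congrArg R.map (Category.id_comp p)) ≫ η ≫
      eqToHom (congrArg R.map (Category.id_comp q).symm) := by
  simp only [wl, id_left_hom, id_left_inv, Category.assoc]
  rw [← whisker_exchange_assoc]
  simp

theorem comp_wl (p : a ⟶ b) (q : b ⟶ c) {r r' : c ⟶ d} (η : R.map r ⟶ R.map r') :
    R.wl (p ≫ q) η = eqToHom (congrArg R.map (Category.assoc p q r)) ≫ R.wl p (R.wl q η) ≫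
      eqToHom (congrArg R.map (Category.assoc p q r').symm) := by
  simp only [wl, comp_inv, comp_hom, Category.assoc]
  rw [← whisker_exchange_assoc]
  simp

theorem wr_idm {p q : a ⟶ b} (η : R.map p ⟶ R.map q) : R.wr η (𝟙 b) =
    eqToHom (congrArg R.map (Category.comp_id p)) ≫ η ≫
      eqToHom (congrArg R.map (Category.comp_id q).symm) := by
  simp only [wr, id_right_hom, id_right_inv, Category.assoc]
  rw [whisker_exchange_assoc]
  simp

theorem wr_compm {p p' : a ⟶ b} (η : R.map p ⟶ R.map p') (q : b ⟶ c) (r : c ⟶ d) :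
    R.wr η (q ≫ r) = eqToHom (congrArg R.map (Category.assoc p q r).symm) ≫ R.wr (R.wr η q) r ≫
      eqToHom (congrArg R.map (Category.assoc p' q r)) := by
  simp only [wr, comp_inv, comp_hom, Category.assoc, comp_whiskerRight]
  simp only [eqToHom_trans_assoc, eqToHom_trans, eqToHom_refl, Category.id_comp, Category.comp_id,
    hom_inv_whiskerRight_assoc, associator_naturality_left_assoc, Iso.inv_hom_id_assoc]
  rw [whisker_exchange_assoc]
  simp

theorem wl_wr (p : a ⟶ b) {q q' : b ⟶ c} (η : R.map q ⟶ R.map q') (r : c ⟶ d) :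
    R.wr (R.wl p η) r = eqToHom (congrArg R.map (Category.assoc p q r)) ≫ R.wl p (R.wr η r) ≫
      eqToHom (congrArg R.map (Category.assoc p q' r).symm) := by
  simp only [wr, wl, comp_inv, comp_hom, Category.assoc, comp_whiskerRight]
  simp

theorem wl_wr_exchange {p p' : a ⟶ b} {q q' : b ⟶ c} (η : R.map p ⟶ R.map p')
    (θ : R.map q ⟶ R.map q') : R.wl p θ ≫ R.wr η q' = R.wr η q ≫ R.wl p' θ := by
  simp [wl, wr, whisker_exchange_assoc]

theorem wl_eqToHom (p : a ⟶ b) {q q' : b ⟶ c} (h : q = q') :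
    R.wl p (eqToHom (congrArg R.map h)) = eqToHom (congrArg (fun t => R.map (p ≫ t)) h) := by
  subst h; simp [wl]

theorem wr_eqToHom {p p' : a ⟶ b} (h : p = p') (q : b ⟶ c) :
    R.wr (eqToHom (congrArg R.map h)) q = eqToHom (congrArg (fun t => R.map (t ≫ q)) h) := by
  subst h; simp [wr]

end

end Realization

/-- The 2-category with the objects and 1-cells of `K`, whose 2-cells `p ⇒ q` are the 2-cells
`R p ⇒ R q` of `B`. -/
structure Full {K : Type*} [Category K] {B : Type*} [Bicategory B] (R : Realization K B) where
  as : K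

namespace Full

variable {K : Type u} [Category.{v} K] {B : Type*} [Bicategory.{w} B] {R : Realization K B}

instance : CategoryStruct (Full R) where
  Hom x y := x.as ⟶ y.as
  id x := 𝟙 x.as
  comp p q := Category.toCategoryStruct.comp (obj := K) p q

/-- The 1-cell of `B` underlying a 1-cell. -/
def real {x y : Full R} (p : x ⟶ y) : R.obj x.as ⟶ R.obj y.as := R.map (x := x.as) (y := y.as) p

instance homCat (x y : Full R) : Category.{w} (x ⟶ y) where
  Hom p q := real p ⟶ real q
  id p := 𝟙 (real p)
  comp η θ := η ≫ θ
  id_comp η := Category.id_comp (obj := R.obj x.as ⟶ R.obj y.as) η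
  comp_id η := Category.comp_id (obj := R.obj x.as ⟶ R.obj y.as) η
  assoc η θ κ := Category.assoc (obj := R.obj x.as ⟶ R.obj y.as) η θ κ

/-- The 2-cell of `B` underlying a 2-cell. -/
def under {x y : Full R} {p q : x ⟶ y} (η : p ⟶ q) : real p ⟶ real q := η

theorem under_eqToHom {x y : Full R} {p q : x ⟶ y} (h : p = q) :
    under (eqToHom h) = eqToHom (congrArg real h) := by
  subst h; rfl

theorem under_comp {x y : Full R} {p q r : x ⟶ y} (η : p ⟶ q) (θ : q ⟶ r) :
    under (η ≫ θ) = under η ≫ under θ := rfl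

theorem under_ext {x y : Full R} {p q : x ⟶ y} {η θ : p ⟶ q} (h : under η = under θ) : η = θ := h

theorem assoc' {x y z t : Full R} (p : x ⟶ y) (q : y ⟶ z) (r : z ⟶ t) :
    (p ≫ q) ≫ r = p ≫ q ≫ r := Category.assoc (obj := K) p q r

theorem id_comp' {x y : Full R} (p : x ⟶ y) : 𝟙 x ≫ p = p := Category.id_comp (obj := K) p

theorem comp_id' {x y : Full R} (p : x ⟶ y) : p ≫ 𝟙 y = p := Category.comp_id (obj := K) p

/-- Left whiskering. -/
def wl {x y z : Full R} (p : x ⟶ y) {q q' : y ⟶ z} (η : q ⟶ q') : p ≫ q ⟶ p ≫ q' :=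
  R.wl (x := x.as) (y := y.as) (z := z.as) p (under η)

/-- Right whiskering. -/
def wr {x y z : Full R} {p p' : x ⟶ y} (η : p ⟶ p') (q : y ⟶ z) : p ≫ q ⟶ p' ≫ q :=
  R.wr (x := x.as) (y := y.as) (z := z.as) (under η) q

theorem wl_eqToHom {x y z : Full R} (p : x ⟶ y) {q q' : y ⟶ z} (h : q = q') :
    wl p (eqToHom h) = eqToHom (congrArg (p ≫ ·) h) := by
  subst h; exact R.wl_id _ _

theorem wr_eqToHom {x y z : Full R} {p p' : x ⟶ y} (h : p = p') (q : y ⟶ z) :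
    wr (eqToHom h) q = eqToHom (congrArg (· ≫ q) h) := by
  subst h; exact R.wr_id _ _

/-- Horizontal composition of 2-cells is that of `B`, conjugated by the constraints of `R`. -/
instance : Bicategory (Full R) where
  homCategory := homCat
  whiskerLeft {_ _ _} p {_ _} η := wl p η
  whiskerRight η q := wr η q
  associator p q r := eqToIso (assoc' p q r)
  leftUnitor p := eqToIso (id_comp' p)
  rightUnitor p := eqToIso (comp_id' p)
  whiskerLeft_id p q := R.wl_id _ _
  whiskerLeft_comp p _ _ _ η θ := R.wl_comp _ _ _
  id_whiskerLeft {_ _ p q} η := under_ext (by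
    simp only [eqToIso.hom, eqToIso.inv]
    erw [under_comp, under_comp, under_eqToHom, under_eqToHom]
    exact R.id_wl _)
  comp_whiskerLeft p q _ _ η := under_ext (by
    simp only [eqToIso.hom, eqToIso.inv]
    erw [under_comp, under_comp, under_eqToHom, under_eqToHom]
    exact R.comp_wl _ _ _)
  id_whiskerRight p q := R.wr_id _ _
  comp_whiskerRight η θ r := R.wr_comp _ _ _
  whiskerRight_id η := under_ext (by
    simp only [eqToIso.hom, eqToIso.inv]
    erw [under_comp, under_comp, under_eqToHom, under_eqToHom]
    exact R.wr_idm _)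
  whiskerRight_comp η p q := under_ext (by
    simp only [eqToIso.hom, eqToIso.inv]
    erw [under_comp, under_comp, under_eqToHom, under_eqToHom]
    exact R.wr_compm _ _ _)
  whisker_assoc p _ _ η q := under_ext (by
    simp only [eqToIso.hom, eqToIso.inv]
    erw [under_comp, under_comp, under_eqToHom, under_eqToHom]
    exact R.wl_wr _ _ _)
  whisker_exchange η θ := R.wl_wr_exchange _ _
  pentagon p q r s := by
    simp only [eqToIso.hom]
    rw [wl_eqToHom, wr_eqToHom]
    simp only [eqToHom_trans]
  triangle p q := by
    simp only [eqToIso.hom]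
    rw [wl_eqToHom, wr_eqToHom]
    simp only [eqToHom_trans]

instance : Strict (Full R) where
  id_comp := id_comp'
  comp_id := comp_id'
  assoc := assoc'

theorem whiskerLeft_def {x y z : Full R} (p : x ⟶ y) {q q' : y ⟶ z} (η : q ⟶ q') :
    p ◁ η = wl p η := rfl

theorem whiskerRight_def {x y z : Full R} {p p' : x ⟶ y} (η : p ⟶ p') (q : y ⟶ z) :
    η ▷ q = wr η q := rfl

variable (R) in
/-- The canonical pseudofunctor to `B`: it is `R` on objects and 1-cells, the identity on
2-cells, and its constraints are those of `R`. -/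
def ev : Full R ⥤ᵖ B where
  obj x := R.obj x.as
  map p := real p
  map₂ η := under η
  mapId x := (R.idIso x.as).symm
  mapComp {x y z} p q := (R.compIso (x := x.as) (y := y.as) (z := z.as) p q).symm
  map₂_whisker_left {_ _ _} p _ _ η := rfl
  map₂_whisker_right {_ _ _} _ _ η q := rfl
  map₂_associator {x y z t} p q r := by
    erw [under_eqToHom (assoc' p q r)]
    have := R.assoc (x := x.as) (y := y.as) (z := z.as) (t := t.as) p q r
    change eqToHom _ = (R.compIso _ _).inv ≫ (R.compIso _ _).inv ▷ _ ≫ _ ≫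
      _ ◁ (R.compIso _ _).hom ≫ (R.compIso _ _).hom
    erw [← this]
    simp
  map₂_left_unitor {x y} p := by
    erw [under_eqToHom (id_comp' p)]
    have := R.id_left (x := x.as) (y := y.as) p
    change eqToHom _ = (R.compIso _ _).inv ≫ (R.idIso _).inv ▷ _ ≫ _
    erw [← this]
    simp
    rfl
  map₂_right_unitor {x y} p := by
    erw [under_eqToHom (comp_id' p)]
    have := R.id_right (x := x.as) (y := y.as) p
    change eqToHom _ = (R.compIso _ _).inv ≫ _ ◁ (R.idIso _).inv ≫ _
    erw [← this]
    simp
    rfl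

end Full

end

section
open HCell

section St
variable {B : Type u} [Bicategory.{w, v} B] 

/-- Strings of composable 1-cells, first 1-cell first. -/
inductive Str : B → B → Type (max u v)
  | nil (a : B) : Str a a
  | cons {a b c : B} (f : a ⟶ b) (p : Str b c) : Str a c

namespace Str

/-- Concatenation of strings. -/
def append : ∀ {a b c : B}, Str a b → Str b c → Str a c
  | _, _, _, nil _, q => q
  | _, _, _, cons f p, q => cons f (append p q)

theorem append_nil : ∀ {a b : B} (p : Str a b), append p (nil b) = p
  | _, _, nil _ => rfl
  | _, _, cons f p => congrArg (cons f) (append_nil p)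

theorem append_assoc : ∀ {a b c d : B} (p : Str a b) (q : Str b c) (r : Str c d),
    append (append p q) r = append p (append q r)
  | _, _, _, _, nil _, _, _ => rfl
  | _, _, _, _, cons f p, q, r => congrArg (cons f) (append_assoc p q r)

/-- The composite of a string of 1-cells, bracketed as
`f₁ ≫ (f₂ ≫ ( ⋯ (fₙ₋₁ ≫ fₙ)))`; the empty string is sent to the identity. -/
def eval : ∀ {a b : B}, Str a b → (a ⟶ b)
  | _, _, nil a => 𝟙 a
  | _, _, cons f (nil _) => f
  | _, _, cons f (cons g p) => f ≫ eval (cons g p)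

/-- The composite of the empty string is the identity. -/
def nilIso (b : B) : 𝟙 b ≅ eval (nil b) := Iso.refl _

/-- The coherence isomorphism for adding a 1-cell at the front of a string. -/
def consIso {a b : B} (f : a ⟶ b) : ∀ {c : B} (p : Str b c), f ≫ eval p ≅ eval (cons f p)
  | _, nil _ => ρ_ f
  | _, cons _ _ => Iso.refl _

/-- The coherence isomorphism `e(p) * e(q) ≅ e(pq)`. -/
def appendIso : ∀ {a b c : B} (p : Str a b) (q : Str b c), eval p ≫ eval q ≅ eval (append p q)
  | _, _, _, nil _, q => λ_ (eval q)
  | _, _, _, cons f p, q =>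
    whiskerRightIso (consIso f p).symm (eval q) ≪≫ α_ f (eval p) (eval q) ≪≫
      whiskerLeftIso f (appendIso p q) ≪≫ consIso f (append p q)

theorem appendIso_cons {a b c d : B} (f : a ⟶ b) (p : Str b c) (q : Str c d) :
    (appendIso (cons f p) q).hom = (consIso f p).inv ▷ eval q ≫ (α_ f (eval p) (eval q)).hom ≫
      f ◁ (appendIso p q).hom ≫ (consIso f (append p q)).hom := rfl

theorem consIso_eqToHom {a b c : B} (f : a ⟶ b) {p q : Str b c} (h : p = q) :
    (consIso f p).hom ≫ eqToHom (congrArg (fun r => eval (cons f r)) h) =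
    f ◁ eqToHom (congrArg eval h) ≫ (consIso f q).hom := by
  subst h; simp

theorem appendIso_assoc : ∀ {a b c d : B} (p : Str a b) (q : Str b c) (r : Str c d),
    (appendIso p q).hom ▷ eval r ≫ (appendIso (append p q) r).hom ≫
        eqToHom (congrArg eval (append_assoc p q r)) =
      (α_ (eval p) (eval q) (eval r)).hom ≫ eval p ◁ (appendIso q r).hom ≫
        (appendIso p (append q r)).hom
  | _, _, _, _, nil _, q, r => by simp [appendIso, append, eval]
  | _, _, _, _, cons f p, q, r => by
    have ih := appendIso_assoc p q r
    have ih2 := congrArg (fun t => f ◁ t) ih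
    simp only [whiskerLeft_comp] at ih2
    change ((consIso f p).inv ▷ eval q ≫ (α_ f (eval p) (eval q)).hom ≫ f ◁ (appendIso p q).hom ≫
        (consIso f (append p q)).hom) ▷ eval r ≫
      ((consIso f (append p q)).inv ▷ eval r ≫ (α_ f (eval (append p q)) (eval r)).hom ≫
        f ◁ (appendIso (append p q) r).hom ≫ (consIso f (append (append p q) r)).hom) ≫
      eqToHom (congrArg (fun t => eval (cons f t)) (append_assoc p q r)) =
      (α_ (eval (cons f p)) (eval q) (eval r)).hom ≫ eval (cons f p) ◁ (appendIso q r).hom ≫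
        (consIso f p).inv ▷ eval (append q r) ≫ (α_ f (eval p) (eval (append q r))).hom ≫
        f ◁ (appendIso p (append q r)).hom ≫ (consIso f (append p (append q r))).hom
    simp only [Category.assoc, comp_whiskerRight, hom_inv_whiskerRight_assoc]
    rw [consIso_eqToHom f (append_assoc p q r), whisker_exchange_assoc]
    simp only [whisker_assoc, Category.assoc, Iso.inv_hom_id_assoc]
    rw [reassoc_of% ih2]
    simp

theorem appendIso_nil : ∀ {a b : B} (p : Str a b),
    eval p ◁ (nilIso b).hom ≫ (appendIso p (nil b)).hom ≫
      eqToHom (congrArg eval (append_nil p)) = (ρ_ (eval p)).hom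
  | _, _, nil a => by
    change 𝟙 a ◁ 𝟙 (𝟙 a) ≫ (λ_ (𝟙 a)).hom ≫ 𝟙 (𝟙 a) = (ρ_ (𝟙 a)).hom
    simp [unitors_equal]
  | _, _, @cons _ _ _ _ b f p => by
    have ih := appendIso_nil p
    have ih2 := congrArg (fun t => f ◁ t) ih
    simp only [whiskerLeft_comp] at ih2
    change eval (cons f p) ◁ (nilIso b).hom ≫ ((consIso f p).inv ▷ eval (nil b) ≫
      (α_ f (eval p) (eval (nil b))).hom ≫ f ◁ (appendIso p (nil _)).hom ≫
        (consIso f (append p (nil _))).hom) ≫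
      eqToHom (congrArg (fun t => eval (cons f t)) (append_nil p)) = (ρ_ (eval (cons f p))).hom
    simp only [Category.assoc]
    rw [consIso_eqToHom f (append_nil p), whisker_exchange_assoc, comp_whiskerLeft_assoc]
    simp only [Iso.inv_hom_id_assoc]
    rw [reassoc_of% ih2]
    simp

end Str

variable (B) in
/-- The category with the objects of `B` and strings of 1-cells of `B`. -/
structure Strings where
  as : B

instance : Category (Strings B) where
  Hom x y := Str x.as y.as
  id x := .nil x.as
  comp p q := Str.append p q
  id_comp _ := rfl
  comp_id p := Str.append_nil p
  assoc p q r := Str.append_assoc p q r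

variable (B) in
/-- Strings of 1-cells are realized by composition. -/
def strReal : Realization (Strings B) B where
  obj x := x.as
  map p := Str.eval p
  idIso x := Str.nilIso x.as
  compIso p q := Str.appendIso p q
  assoc p q r := Str.appendIso_assoc p q r
  id_left {x y} p := by
    change 𝟙 _ ▷ Str.eval p ≫ (λ_ (Str.eval p)).hom ≫ 𝟙 _ = _
    simp
  id_right p := Str.appendIso_nil p

variable (B) in
/-- The strictification of the bicategory `B`. -/
abbrev St := Full (strReal B)

end St

end

section
open HCell

section Counit

/-- `Full.ev`, as a 2-functor, when the constraints of `R` are identities. -/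
def Full.evStrict {K : Type u} [Category.{v} K] {B : Type*} [Bicategory.{w} B]
    (R : Realization K B) (hid : ∀ x, ∃ h, R.idIso x = eqToIso h)
    (hcomp : ∀ {x y z : K} (p : x ⟶ y) (q : y ⟶ z), ∃ h, R.compIso p q = eqToIso h) :
    StrictPseudofunctor (Full R) B where
  toPseudofunctor := Full.ev R
  map_id x := (hid x.as).1.symm
  mapId_eq_eqToIso x := by
    obtain ⟨h, e⟩ := hid x.as
    exact (congrArg Iso.symm e).trans rfl
  map_comp {x y z} p q := (hcomp (x := x.as) (y := y.as) (z := z.as) p q).1.symm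
  mapComp_eq_eqToIso {x y z} p q := by
    obtain ⟨h, e⟩ := hcomp (x := x.as) (y := y.as) (z := z.as) p q
    exact (congrArg Iso.symm e).trans rfl

theorem appendIso_eqToIso {B : Type*} [Bicategory B] [Strict B] : ∀ {a b c : B} (p : Str a b)
    (q : Str b c), ∃ h, Str.appendIso p q = eqToIso h
  | _, _, _, .nil _, q => ⟨Strict.id_comp _, Strict.leftUnitor_eqToIso _⟩
  | _, _, _, .cons f p, q => by
    obtain ⟨h, e⟩ := appendIso_eqToIso p q
    have hc {c d e : B} (f : c ⟶ d) : ∀ (q : Str d e), ∃ h, Str.consIso f q = eqToIso h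
      | .nil _ => ⟨Strict.comp_id _, Strict.rightUnitor_eqToIso _⟩
      | .cons _ _ => ⟨rfl, rfl⟩
    obtain ⟨h₁, e₁⟩ := hc f p
    obtain ⟨h₂, e₂⟩ := hc f (p.append q)
    refine ⟨?_, ?_⟩
    · change Str.eval (.cons f p) ≫ q.eval = Str.eval (.cons f (p.append q))
      rw [← h₂, ← h, ← Strict.assoc, h₁]
    · refine Iso.ext ((Str.appendIso_cons f p q).trans ?_)
      rw [e, e₁, e₂, Strict.associator_eqToIso]
      simp
      rfl

/-- The 2-functor from the strictification of a 2-category which composes strings. -/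
def stEval (A : Type u) [Bicategory.{w, v} A] [Strict A] : StrictPseudofunctor (St A) A :=
  Full.evStrict (strReal A) (fun _ => ⟨rfl, rfl⟩) (fun p q => appendIso_eqToIso p q)

end Counit

section Unit

theorem appendIso_single {B : Type*} [Bicategory B] {a b c : B} (f : a ⟶ b) (g : b ⟶ c) :
    Str.appendIso (.cons f (.nil b)) (.cons g (.nil c)) = Iso.refl (f ≫ g) := by
  ext
  change (ρ_ f).inv ▷ g ≫ (α_ f (𝟙 b) g).hom ≫ f ◁ (λ_ g).hom ≫ 𝟙 _ = 𝟙 _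
  simp

theorem appendIso_single' {B : Type*} [Bicategory B] {a b c d : B} (f : a ⟶ b) (g : b ⟶ c)
    (h : c ⟶ d) :
    Str.appendIso (.cons f (.nil b)) (.cons g (.cons h (.nil d))) = Iso.refl (f ≫ g ≫ h) := by
  ext
  change (ρ_ f).inv ▷ (g ≫ h) ≫ (α_ f (𝟙 b) (g ≫ h)).hom ≫ f ◁ (λ_ (g ≫ h)).hom ≫ 𝟙 _ = 𝟙 _
  simp

theorem appendIso_pair {B : Type*} [Bicategory B] {a b c d : B} (f : a ⟶ b) (g : b ⟶ c)
    (h : c ⟶ d) :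
    Str.appendIso (.cons f (.cons g (.nil c))) (.cons h (.nil d)) = α_ f g h := by
  ext
  change 𝟙 (f ≫ g) ▷ h ≫ (α_ f g h).hom ≫
    f ◁ (Str.appendIso (.cons g (.nil c)) (.cons h (.nil d))).hom ≫ 𝟙 (f ≫ g ≫ h) = _
  rw [appendIso_single]
  exact show 𝟙 (f ≫ g) ▷ h ≫ (α_ f g h).hom ≫ f ◁ 𝟙 (g ≫ h) ≫ 𝟙 (f ≫ g ≫ h) = (α_ f g h).hom by
    simp

theorem sandwich₂ {C : Type*} [Category C] {X Y : C} (g : X ⟶ Y) (e : X ⟶ X) (e' : Y ⟶ Y)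
    (he : e = 𝟙 X) (he' : e' = 𝟙 Y) :
    g = 𝟙 X ≫ (𝟙 X ≫ e ≫ g) ≫ 𝟙 Y ≫ (𝟙 Y ≫ e' ≫ 𝟙 Y) ≫ 𝟙 Y := by simp [he, he']

theorem sandwich₃ {C : Type*} [Category C] {X Y : C} (g : X ⟶ Y) (e : X ⟶ X)
    (he : e = 𝟙 X) : g = 𝟙 X ≫ (𝟙 X ≫ e ≫ g) ≫ 𝟙 Y := by simp [he]

theorem sandwich {C : Type*} [Category C] {X Y : C} (g : X ⟶ Y) :
    g = 𝟙 X ≫ (𝟙 X ≫ g ≫ 𝟙 Y) ≫ 𝟙 Y := by simp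

/-- The inclusion of `B` in its strictification, as strings of length one. -/
def stIncl (B : Type u) [Bicategory.{w, v} B] : B ⥤ᵖ St B where
  obj b := ⟨⟨b⟩⟩
  map {a b} f := (Str.cons f (.nil b) : Str a b)
  map₂ {_ _ f g} η := (η : f ⟶ g)
  mapId a := ⟨𝟙 (𝟙 a), 𝟙 (𝟙 a), Category.id_comp (𝟙 (𝟙 a)), Category.id_comp (𝟙 (𝟙 a))⟩
  mapComp f g := ⟨𝟙 (f ≫ g), 𝟙 (f ≫ g), Category.id_comp (𝟙 (f ≫ g)), Category.id_comp (𝟙 (f ≫ g))⟩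
  map₂_whisker_left {_ _ _} f g h η := by
    change f ◁ η = 𝟙 (f ≫ g) ≫ ((Str.appendIso (.cons f (.nil _)) (.cons g (.nil _))).inv ≫
      f ◁ η ≫ (Str.appendIso (.cons f (.nil _)) (.cons h (.nil _))).hom) ≫ 𝟙 (f ≫ h)
    rw [appendIso_single, appendIso_single]
    exact sandwich (f ◁ η)
  map₂_whisker_right {_ _ _ f g} η h := by
    change η ▷ h = 𝟙 (f ≫ h) ≫ ((Str.appendIso (.cons f (.nil _)) (.cons h (.nil _))).inv ≫
      η ▷ h ≫ (Str.appendIso (.cons g (.nil _)) (.cons h (.nil _))).hom) ≫ 𝟙 (g ≫ h)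
    rw [appendIso_single, appendIso_single]
    exact sandwich (η ▷ h)
  map₂_associator f g h := by
    change (α_ f g h).hom = 𝟙 ((f ≫ g) ≫ h) ≫ ((Str.appendIso (.cons (f ≫ g) (.nil _)) (.cons h (.nil _))).inv ≫
      𝟙 (f ≫ g) ▷ h ≫ (Str.appendIso (.cons f (.cons g (.nil _))) (.cons h (.nil _))).hom) ≫
      𝟙 _ ≫ ((Str.appendIso (.cons f (.nil _)) (.cons g (.cons h (.nil _)))).inv ≫ f ◁ 𝟙 (g ≫ h) ≫
      (Str.appendIso (.cons f (.nil _)) (.cons (g ≫ h) (.nil _))).hom) ≫ 𝟙 (f ≫ g ≫ h)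
    rw [appendIso_single, appendIso_single, appendIso_pair, appendIso_single']
    exact sandwich₂ _ _ _ (id_whiskerRight _ _) (whiskerLeft_id _ _)
  map₂_left_unitor f := by
    change (λ_ f).hom = 𝟙 (𝟙 _ ≫ f) ≫ ((Str.appendIso (.cons (𝟙 _) (.nil _)) (.cons f (.nil _))).inv ≫
      𝟙 (𝟙 _) ▷ f ≫ (λ_ f).hom) ≫ 𝟙 f
    rw [appendIso_single]
    exact sandwich₃ _ _ (id_whiskerRight _ _)
  map₂_right_unitor {a b} f := by
    have e : (Str.appendIso (.cons f (.nil b)) (.nil b)).hom = (ρ_ f).hom := by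
      change (ρ_ f).inv ▷ 𝟙 b ≫ (α_ f (𝟙 b) (𝟙 b)).hom ≫ f ◁ (λ_ (𝟙 b)).hom ≫ (ρ_ f).hom = _
      simp
    change (ρ_ f).hom = 𝟙 (f ≫ 𝟙 _) ≫ ((Str.appendIso (.cons f (.nil _)) (.cons (𝟙 _) (.nil _))).inv ≫
      f ◁ 𝟙 (𝟙 _) ≫ (Str.appendIso (.cons f (.nil _)) (.nil _)).hom) ≫ 𝟙 f
    rw [appendIso_single, e]
    exact sandwich₃ _ _ (whiskerLeft_id _ _)

end Unit

section Map

variable {B : Type u} [Bicategory.{w, v} B] {C : Type u'} [Bicategory.{w', v'} C] (F : B ⥤ᵖ C)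

namespace Str

/-- The image of a string. -/
def map : ∀ {a b : B}, Str a b → Str (F.obj a) (F.obj b)
  | _, _, nil a => nil (F.obj a)
  | _, _, cons f p => cons (F.map f) (map p)

theorem map_append : ∀ {a b c : B} (p : Str a b) (q : Str b c),
    map F (append p q) = append (map F p) (map F q)
  | _, _, _, nil _, _ => rfl
  | _, _, _, cons f p, q => congrArg (cons (F.map f)) (map_append p q)

/-- The coherence isomorphism comparing the composite of the images of a string of 1-cells
with the image of the composite. -/
def evalMap : ∀ {a b : B} (p : Str a b), eval (map F p) ≅ F.map (eval p)
  | _, _, nil a => (F.mapId a).symm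
  | _, _, cons f p => (consIso (F.map f) (map F p)).symm ≪≫ whiskerLeftIso (F.map f) (evalMap p) ≪≫
      (F.mapComp f (eval p)).symm ≪≫ F.map₂Iso (consIso f p)

theorem evalMap_cons {a b c : B} (f : a ⟶ b) (p : Str b c) : (evalMap F (cons f p)).hom =
    (consIso (F.map f) (map F p)).inv ≫ F.map f ◁ (evalMap F p).hom ≫
      (F.mapComp f (eval p)).inv ≫ F.map₂ (consIso f p).hom := rfl

theorem evalMap_append : ∀ {a b c : B} (p : Str a b) (q : Str b c),
    (appendIso (map F p) (map F q)).hom ≫ eqToHom (congrArg eval (map_append F p q).symm) ≫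
      (evalMap F (append p q)).hom =
    (evalMap F p).hom ▷ eval (map F q) ≫ F.map (eval p) ◁ (evalMap F q).hom ≫
      (F.mapComp (eval p) (eval q)).inv ≫ F.map₂ (appendIso p q).hom
  | _, _, _, nil a, q => by
    change (λ_ (eval (map F q))).hom ≫ 𝟙 _ ≫ (evalMap F q).hom =
      (F.mapId a).inv ▷ eval (map F q) ≫ F.map (𝟙 a) ◁ (evalMap F q).hom ≫
      (F.mapComp (𝟙 a) (eval q)).inv ≫ F.map₂ (λ_ (eval q)).hom
    rw [← whisker_exchange_assoc]
    simp
  | _, _, _, cons f p, q => by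
    have ih := evalMap_append p q
    have ih2 := congrArg (fun t => F.map f ◁ t) ih
    simp only [whiskerLeft_comp] at ih2
    have hc := consIso_eqToHom (F.map f) (map_append F p q).symm
    change ((consIso (F.map f) (map F p)).inv ▷ eval (map F q) ≫
        (α_ (F.map f) (eval (map F p)) (eval (map F q))).hom ≫
        F.map f ◁ (appendIso (map F p) (map F q)).hom ≫
          (consIso (F.map f) (append (map F p) (map F q))).hom) ≫
      eqToHom (congrArg (fun r => eval (cons (F.map f) r)) (map_append F p q).symm) ≫
      (consIso (F.map f) (map F (append p q))).inv ≫ F.map f ◁ (evalMap F (append p q)).hom ≫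
      (F.mapComp f (eval (append p q))).inv ≫ F.map₂ (consIso f (append p q)).hom =
      ((consIso (F.map f) (map F p)).inv ≫ F.map f ◁ (evalMap F p).hom ≫
      (F.mapComp f (eval p)).inv ≫ F.map₂ (consIso f p).hom) ▷ eval (map F q) ≫
      F.map (eval (cons f p)) ◁ (evalMap F q).hom ≫ (F.mapComp (eval (cons f p)) (eval q)).inv ≫
      F.map₂ ((consIso f p).inv ▷ eval q ≫ (α_ f (eval p) (eval q)).hom ≫
      f ◁ (appendIso p q).hom ≫ (consIso f (append p q)).hom)
    simp only [Category.assoc]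
    rw [reassoc_of% hc]
    simp only [Iso.hom_inv_id_assoc]
    rw [reassoc_of% ih2]
    simp only [comp_whiskerRight, Category.assoc, PrelaxFunctor.map₂_comp]
    simp only [Pseudofunctor.map₂_whisker_right, Pseudofunctor.map₂_whisker_left,
      Pseudofunctor.map₂_associator, Category.assoc, Iso.inv_hom_id_assoc, whisker_assoc]
    rw [← whisker_exchange_assoc (F.map₂ (consIso f p).hom) (evalMap F q).hom,
      ← comp_whiskerRight_assoc (F.map₂ (consIso f p).hom), ← PrelaxFunctor.map₂_comp,
      ← whisker_exchange_assoc (F.mapComp f (eval p)).inv (evalMap F q).hom]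
    simp

end Str
end Map

end

section
open HCell

theorem Full.under_conj {K : Type u} [Category.{v} K] {B : Type*} [Bicategory.{w} B]
    {R : Realization K B} {x y : Full R} {p p' q q' : x ⟶ y} (h : p = p') (η : p' ⟶ q')
    (h' : q' = q) : under (eqToHom h ≫ η ≫ eqToHom h') =
      eqToHom (congrArg real h) ≫ under η ≫ eqToHom (congrArg real h') := by
  subst h; subst h'
  exact (congrArg under (by simp)).trans (by simp : under η = 𝟙 _ ≫ under η ≫ 𝟙 _)

theorem cancel_mid {C : Type*} [Category C] {X Y Z Z' W V : C} (a : X ⟶ Y) (b : Y ⟶ Z)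
    (i : Z ≅ Z') (c : Z ⟶ W) (d : W ⟶ V) :
    (a ≫ b ≫ i.hom) ≫ i.inv ≫ c ≫ d = a ≫ (b ≫ c) ≫ d := by simp

section Map

variable {B : Type u} [Bicategory.{w, v} B] {C : Type u'} [Bicategory.{w', v'} C] (F : B ⥤ᵖ C)

namespace Str

theorem evalMap_append_hom {a b c : B} (p : Str a b) (q : Str b c) :
    (evalMap F (append p q)).hom = eqToHom (congrArg eval (map_append F p q)) ≫
      (appendIso (map F p) (map F q)).inv ≫ (evalMap F p).hom ▷ eval (map F q) ≫
      F.map (eval p) ◁ (evalMap F q).hom ≫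
      (F.mapComp (eval p) (eval q)).inv ≫ F.map₂ (appendIso p q).hom := by
  rw [← evalMap_append]
  simp

theorem evalMap_append_inv {a b c : B} (p : Str a b) (q : Str b c) :
    (evalMap F (append p q)).inv = F.map₂ (appendIso p q).inv ≫
      (F.mapComp (eval p) (eval q)).hom ≫ F.map (eval p) ◁ (evalMap F q).inv ≫
      (evalMap F p).inv ▷ eval (map F q) ≫ (appendIso (map F p) (map F q)).hom ≫
      eqToHom (congrArg eval (map_append F p q).symm) := by
  rw [← Category.comp_id (evalMap F (append p q)).inv, Iso.inv_comp_eq, evalMap_append_hom]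
  simp [← PrelaxFunctor.map₂_comp_assoc]

/-- The image of a 2-cell between composites of strings: the image under `F`, conjugated by
coherence isomorphisms. -/
def map₂ {a b : B} {p q : Str a b} (η : eval p ⟶ eval q) : eval (map F p) ⟶ eval (map F q) :=
  (evalMap F p).hom ≫ F.map₂ η ≫ (evalMap F q).inv

theorem map₂_id {a b : B} (p : Str a b) : map₂ F (𝟙 (eval p)) = 𝟙 _ := by simp [map₂]

theorem map₂_comp {a b : B} {p q r : Str a b} (η : eval p ⟶ eval q) (θ : eval q ⟶ eval r) :
    map₂ F (η ≫ θ) = map₂ F η ≫ map₂ F θ := by simp [map₂]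

theorem evalMap_wl {a b c : B} (p : Str a b) {q q' : Str b c} (η : eval q ⟶ eval q') :
    map₂ F ((appendIso p q).inv ≫ eval p ◁ η ≫ (appendIso p q').hom) =
    eqToHom (congrArg eval (map_append F p q)) ≫ ((appendIso (map F p) (map F q)).inv ≫
      eval (map F p) ◁ map₂ F η ≫
      (appendIso (map F p) (map F q')).hom) ≫
      eqToHom (congrArg eval (map_append F p q').symm) := by
  rw [map₂, map₂, evalMap_append_hom, evalMap_append_inv]
  simp only [← PrelaxFunctor.map₂_comp_assoc, Category.assoc, Iso.hom_inv_id, Category.comp_id,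
    Iso.hom_inv_id_assoc]
  simp only [Pseudofunctor.map₂_whisker_left, Category.assoc, Iso.inv_hom_id_assoc,
    whiskerLeft_comp]
  rw [whisker_exchange_assoc, whisker_exchange_assoc, whisker_exchange_assoc]
  simp

theorem evalMap_wr {a b c : B} {p p' : Str a b} (η : eval p ⟶ eval p') (q : Str b c) :
    map₂ F ((appendIso p q).inv ≫ η ▷ eval q ≫ (appendIso p' q).hom) =
    eqToHom (congrArg eval (map_append F p q)) ≫ ((appendIso (map F p) (map F q)).inv ≫
      map₂ F η ▷ eval (map F q) ≫
      (appendIso (map F p') (map F q)).hom) ≫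
      eqToHom (congrArg eval (map_append F p' q).symm) := by
  rw [map₂, map₂, evalMap_append_hom, evalMap_append_inv]
  simp only [← PrelaxFunctor.map₂_comp_assoc, Category.assoc, Iso.hom_inv_id, Category.comp_id,
    Iso.hom_inv_id_assoc]
  simp only [Pseudofunctor.map₂_whisker_right, Category.assoc, Iso.inv_hom_id_assoc,
    comp_whiskerRight]
  rw [← whisker_exchange_assoc (F.map₂ η) (evalMap F q).inv]
  simp

end Str

/-- The action of strictification on pseudofunctors. On 2-cells, it is the action of `F`,
conjugated by coherence isomorphisms. -/
def stMap : StrictPseudofunctor (St B) (St C) := .mk''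
  { obj x := ⟨⟨F.obj x.as.as⟩⟩
    map {x y} p := Str.map F (a := x.as.as) (b := y.as.as) p
    map₂ {x y p q} η := Str.map₂ F (a := x.as.as) (b := y.as.as) (p := p) (q := q) η
    map₂_id {x y} p := Str.map₂_id F (a := x.as.as) (b := y.as.as) p
    map₂_comp {x y p q r} η θ :=
      Str.map₂_comp F (a := x.as.as) (b := y.as.as) (p := p) (q := q) (r := r) η θ
    map_id _ := rfl
    map_comp {x y z} p q :=
      Str.map_append F (a := x.as.as) (b := y.as.as) (c := z.as.as) p q
    map₂_whisker_left {x y z} p {q q'} η := by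
      refine Full.under_ext (R := strReal C) (x := ⟨⟨F.obj x.as.as⟩⟩) (y := ⟨⟨F.obj z.as.as⟩⟩) ?_
      refine Eq.trans ?_ (Full.under_conj (R := strReal C) _ _ _).symm
      exact Str.evalMap_wl F (a := x.as.as) (b := y.as.as) (c := z.as.as) p (q := q) (q' := q') η
    map₂_whisker_right {x y z p p'} η q := by
      refine Full.under_ext (R := strReal C) (x := ⟨⟨F.obj x.as.as⟩⟩) (y := ⟨⟨F.obj z.as.as⟩⟩) ?_
      refine Eq.trans ?_ (Full.under_conj (R := strReal C) _ _ _).symm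
      exact Str.evalMap_wr F (a := x.as.as) (b := y.as.as) (c := z.as.as) (p := p) (p' := p') η q }

end Map

namespace Full

variable {K : Type u} [Category.{v} K] {B : Type*} [Bicategory.{w} B] {R : Realization K B}

/-- A 2-cell of `B` between realizations, regarded as a 2-cell of `Full R`. -/
def hcell {x y x' y' : Full R} {p : x ⟶ y} {p' : x' ⟶ y'} (hx : x = x') (hy : y = y')
    (c : HCell (real p) (real p')) : HCell p p' :=
  match x', y', p', hx, hy, c with
  | _, _, _, rfl, rfl, c => of (show p ⟶ _ from c.toHom)

theorem hcell_vcomp {x y x' y' x'' y'' : Full R} {p : x ⟶ y} {p' : x' ⟶ y'} {p'' : x'' ⟶ y''}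
    (hx : x = x') (hy : y = y') (hx' : x' = x'') (hy' : y' = y'')
    (c : HCell (real p) (real p')) (d : HCell (real p') (real p'')) :
    vcomp (hcell hx hy c) (hcell hx' hy' d) =
      hcell (hx.trans hx') (hy.trans hy') (vcomp c d) := by
  subst hx; subst hy; subst hx'; subst hy'
  obtain ⟨η, rfl⟩ := exists_of c
  obtain ⟨θ, rfl⟩ := exists_of d
  rfl

theorem hcell_of {x y : Full R} {p p' : x ⟶ y} (η : p ⟶ p') :
    hcell rfl rfl (of (under η)) = of η := rfl

theorem hcell_pre {x y x' y' : Full R} {p₀ p : x ⟶ y} {p' : x' ⟶ y'} (h : p₀ = p)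
    (hx : x = x') (hy : y = y') (c : HCell (real p) (real p')) :
    vcomp (of (eqToHom h)) (hcell hx hy c) =
      hcell hx hy (vcomp (of (eqToHom (congrArg real h))) c) := by
  subst h
  exact (HCell.id_vcomp _).trans (congrArg _ (HCell.id_vcomp _).symm)

theorem hcell_post {x y x' y' : Full R} {p : x ⟶ y} {p' p'' : x' ⟶ y'} (h : p' = p'')
    (hx : x = x') (hy : y = y') (c : HCell (real p) (real p')) :
    vcomp (hcell hx hy c) (of (eqToHom h)) =
      hcell hx hy (vcomp c (of (eqToHom (congrArg real h)))) := by
  subst h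
  exact (HCell.vcomp_id _).trans (congrArg _ (HCell.vcomp_id _).symm)

theorem hcell_unit {x x' : Full R} (h : x = x') : unit h =
    hcell (p := 𝟙 x) (p' := 𝟙 x') h h (vcomp (of (R.idIso x.as).inv)
      (vcomp (unit (congrArg (fun t => R.obj t.as) h)) (of (R.idIso x'.as).hom))) := by
  subst h
  refine congrArg of (show 𝟙 (R.map (𝟙 x.as)) = (R.idIso x.as).inv ≫ 𝟙 _ ≫ (R.idIso x.as).hom from ?_)
  simp

theorem hcell_hcomp {x y z x' y' z' : Full R} {p : x ⟶ y} {p' : x' ⟶ y'} {q : y ⟶ z}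
    {q' : y' ⟶ z'} (hx : x = x') (hy : y = y') (hz : z = z')
    (c : HCell (real p) (real p')) (d : HCell (real q) (real q')) :
    hcomp (hcell hx hy c) (hcell hy hz d) = hcell (p := p ≫ q) (p' := p' ≫ q') hx hz
      (vcomp (of (R.compIso (x := x.as) (y := y.as) (z := z.as) p q).inv)
        (vcomp (hcomp c d) (of (R.compIso (x := x'.as) (y := y'.as) (z := z'.as) p' q').hom))) := by
  subst hx; subst hy; subst hz
  obtain ⟨η, rfl⟩ := exists_of c
  obtain ⟨θ, rfl⟩ := exists_of d
  refine congrArg of (show ((R.compIso (x := x.as) (y := y.as) (z := z.as) p q).inv ≫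
    η ▷ real q ≫ (R.compIso (x := x.as) (y := y.as) (z := z.as) p' q).hom) ≫
    (R.compIso (x := x.as) (y := y.as) (z := z.as) p' q).inv ≫
    real p' ◁ θ ≫ (R.compIso (x := x.as) (y := y.as) (z := z.as) p' q').hom =
    (R.compIso (x := x.as) (y := y.as) (z := z.as) p q).inv ≫ (η ▷ real q ≫ real p' ◁ θ) ≫
    (R.compIso (x := x.as) (y := y.as) (z := z.as) p' q').hom from ?_)
  exact cancel_mid _ _ _ _ _

end Full

theorem HCell.of_vcomp_of_vcomp_of {C : Type*} [Bicategory C] {a b : C} {f g h k : a ⟶ b}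
    (η : f ⟶ g) (θ : g ⟶ h) (κ : h ⟶ k) :
    vcomp (of η) (vcomp (of θ) (of κ)) = of ((η ≫ θ) ≫ κ) := by simp

section Icon

variable {B : Type u} [Bicategory.{w, v} B] {C : Type u'} [Bicategory.{w', v'} C] {F G : B ⥤ᵖ C}

namespace Str

/-- The horizontal composite of the components of an icon at a string of 1-cells. -/
def icon (α : Icon F G) : ∀ {a b : B} (p : Str a b), HCell (eval (map F p)) (eval (map G p))
  | _, _, nil a => unit (α.obj_eq a)
  | _, _, cons f (nil _) => α.app f
  | _, _, cons f (cons g p) => hcomp (α.app f) (icon α (cons g p))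

theorem icon_eq (α : Icon F G) : ∀ {a b : B} (p : Str a b), icon α p =
    vcomp (of (evalMap F p).hom) (vcomp (α.app (eval p)) (of (evalMap G p).inv))
  | _, _, nil a => by
    change unit _ = vcomp (of (F.mapId a).inv) (vcomp (α.app (𝟙 a)) (of (G.mapId a).hom))
    rw [← HCell.vcomp_assoc, α.app_id, HCell.vcomp_assoc, vcomp_of, Iso.inv_hom_id, HCell.vcomp_id]
  | _, b, cons f (nil _) => by
    have h (F : B ⥤ᵖ C) : (evalMap F (cons f (nil b))).hom = 𝟙 (F.map f) := by
      change (ρ_ _).inv ≫ F.map f ◁ (F.mapId b).inv ≫ (F.mapComp f (𝟙 b)).inv ≫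
        F.map₂ (ρ_ f).hom = _
      simp
    have h' : (evalMap G (cons f (nil b))).inv = 𝟙 (G.map f) :=
      congrArg Iso.inv (Iso.ext (h G) : evalMap G (cons f (nil b)) = Iso.refl (G.map f))
    rw [h, h']
    exact ((HCell.id_vcomp _).trans (HCell.vcomp_id _)).symm
  | _, _, cons f (cons g p) => by
    have ih := icon_eq α (cons g p)
    change hcomp (α.app f) (icon α (cons g p)) =
      vcomp (of (𝟙 _ ≫ F.map f ◁ (evalMap F (cons g p)).hom ≫
        (F.mapComp f (eval (cons g p))).inv ≫ F.map₂ (𝟙 _))) (vcomp (α.app (f ≫ eval (cons g p)))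
        (of (((G.map₂ (𝟙 _) ≫ (G.mapComp f (eval (cons g p))).hom) ≫
          G.map f ◁ (evalMap G (cons g p)).inv) ≫ 𝟙 _)))
    have e : hcomp (α.app f) (vcomp (of (evalMap F (cons g p)).hom)
        (vcomp (α.app (eval (cons g p))) (of (evalMap G (cons g p)).inv))) =
        vcomp (of (F.map f ◁ (evalMap F (cons g p)).hom)) (vcomp (hcomp (α.app f)
          (α.app (eval (cons g p)))) (of (G.map f ◁ (evalMap G (cons g p)).inv))) := by
      conv_lhs => rw [← HCell.id_vcomp (α.app f), ← HCell.vcomp_id (α.app f)]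
      rw [interchange, interchange]
      simp
    rw [ih, e]
    simp only [PrelaxFunctor.map₂_id, Category.comp_id, Category.id_comp, of_comp,
      HCell.vcomp_assoc]
    rw [← HCell.vcomp_assoc (of (F.mapComp _ _).inv), α.app_comp, HCell.vcomp_assoc,
      of_vcomp_of_vcomp_of, Iso.inv_hom_id, Category.id_comp]

end Str

theorem Str.icon_naturality (α : Icon F G) {a b : B} {p q : Str a b} (η : eval p ⟶ eval q) :
    vcomp (of (map₂ F η)) (icon α q) = vcomp (icon α p) (of (map₂ G η)) := by
  rw [icon_eq, icon_eq, map₂, map₂]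
  simp only [of_comp, HCell.vcomp_assoc]
  congr 1
  simp only [HCell.vcomp_assoc, of_vcomp_of_vcomp, vcomp_of, Category.assoc, Iso.inv_hom_id,
    Iso.inv_hom_id_assoc, Category.comp_id]
  rw [← HCell.vcomp_assoc, α.naturality, HCell.vcomp_assoc, vcomp_of]

theorem Str.icon_append (α : Icon F G) {a b c : B} (p : Str a b) (q : Str b c) :
    vcomp (of (eqToHom (congrArg eval (map_append F p q).symm))) (icon α (append p q)) =
      vcomp (vcomp (of (appendIso (map F p) (map F q)).inv) (vcomp (hcomp (icon α p) (icon α q))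
        (of (appendIso (map G p) (map G q)).hom)))
          (of (eqToHom (congrArg eval (map_append G p q).symm))) := by
  have h (F : B ⥤ᵖ C) : eqToHom (congrArg eval (map_append F p q).symm) ≫
      (evalMap F (append p q)).hom = (appendIso (map F p) (map F q)).inv ≫
        (evalMap F p).hom ▷ eval (map F q) ≫ F.map (eval p) ◁ (evalMap F q).hom ≫
      (F.mapComp (eval p) (eval q)).inv ≫ F.map₂ (appendIso p q).hom := by
    rw [← evalMap_append]; simp
  have h' (F : B ⥤ᵖ C) : F.map₂ (appendIso p q).hom ≫ (evalMap F (append p q)).inv =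
      (F.mapComp (eval p) (eval q)).hom ≫ F.map (eval p) ◁ (evalMap F q).inv ≫
      (evalMap F p).inv ▷ eval (map F q) ≫ (appendIso (map F p) (map F q)).hom ≫
      eqToHom (congrArg eval (map_append F p q).symm) := by
    rw [evalMap_append_inv]; simp [← PrelaxFunctor.map₂_comp_assoc]
  rw [icon_eq, icon_eq, icon_eq, interchange, interchange, ← HCell.vcomp_assoc, vcomp_of, h]
  simp only [of_comp, HCell.vcomp_assoc]
  rw [← HCell.vcomp_assoc (of (F.map₂ _)), α.naturality, HCell.vcomp_assoc, vcomp_of, h',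
    ← HCell.vcomp_assoc (of (F.mapComp _ _).inv), α.app_comp, HCell.vcomp_assoc, hcomp_of, hcomp_of]
  simp only [HCell.vcomp_assoc, of_vcomp_of_vcomp, vcomp_of, Category.assoc,
    Iso.inv_hom_id_assoc]
  rw [whisker_exchange_assoc (evalMap G p).inv]

theorem stIcon_unit {c c' : C} (h : c = c') :
    Full.hcell (p := 𝟙 (⟨⟨c⟩⟩ : St C)) (p' := 𝟙 (⟨⟨c'⟩⟩ : St C)) (congrArg (fun c => (⟨⟨c⟩⟩ : St C)) h)
      (congrArg (fun c => (⟨⟨c⟩⟩ : St C)) h) (unit h) =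
    unit (congrArg (fun c => (⟨⟨c⟩⟩ : St C)) h) := by
  subst h; rfl

/-- The action of strictification on icons. -/
def stIcon (α : Icon F G) :
    Icon (stMap F).toStrictlyUnitaryPseudofunctor.toPseudofunctor
      (stMap G).toStrictlyUnitaryPseudofunctor.toPseudofunctor where
  obj_eq x := congrArg (fun c => (⟨⟨c⟩⟩ : St C)) (α.obj_eq x.as.as)
  app {x y} p := Full.hcell (congrArg (fun c => (⟨⟨c⟩⟩ : St C)) (α.obj_eq x.as.as))
    (congrArg (fun c => (⟨⟨c⟩⟩ : St C)) (α.obj_eq y.as.as)) (Str.icon α p)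
  naturality {x y p q} η := by
    refine (Full.hcell_vcomp (R := strReal C) (x := ⟨⟨F.obj x.as.as⟩⟩) (y := ⟨⟨F.obj y.as.as⟩⟩)
      (x' := ⟨⟨F.obj x.as.as⟩⟩) (y' := ⟨⟨F.obj y.as.as⟩⟩) (x'' := ⟨⟨G.obj x.as.as⟩⟩)
      (y'' := ⟨⟨G.obj y.as.as⟩⟩) (p := Str.map F p) (p' := Str.map F q) (p'' := Str.map G q) rfl rfl _ _ (of (Str.map₂ F η)) (Str.icon α q)).trans ?_
    refine Eq.trans ?_ (Full.hcell_vcomp (R := strReal C) (x := ⟨⟨F.obj x.as.as⟩⟩)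
      (y := ⟨⟨F.obj y.as.as⟩⟩) (x' := ⟨⟨G.obj x.as.as⟩⟩) (y' := ⟨⟨G.obj y.as.as⟩⟩)
      (x'' := ⟨⟨G.obj x.as.as⟩⟩) (y'' := ⟨⟨G.obj y.as.as⟩⟩)
      (p := Str.map F p) (p' := Str.map G p) (p'' := Str.map G q)
      _ _ rfl rfl (Str.icon α p) (of (Str.map₂ G η))).symm
    exact congrArg _ (Str.icon_naturality α η)
  app_id x := by
    refine (HCell.id_vcomp _).trans (Eq.trans ?_ (HCell.vcomp_id _).symm)
    exact stIcon_unit (α.obj_eq x.as.as)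
  app_comp {x y z} p q := by
    have e := Full.hcell_hcomp (R := strReal C) (x := ⟨⟨F.obj x.as.as⟩⟩) (y := ⟨⟨F.obj y.as.as⟩⟩)
      (z := ⟨⟨F.obj z.as.as⟩⟩) (x' := ⟨⟨G.obj x.as.as⟩⟩) (y' := ⟨⟨G.obj y.as.as⟩⟩)
      (z' := ⟨⟨G.obj z.as.as⟩⟩) (p := Str.map F p) (p' := Str.map G p) (q := Str.map F q)
      (q' := Str.map G q) (congrArg (fun c => (⟨⟨c⟩⟩ : St C)) (α.obj_eq x.as.as))
      (congrArg (fun c => (⟨⟨c⟩⟩ : St C)) (α.obj_eq y.as.as))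
      (congrArg (fun c => (⟨⟨c⟩⟩ : St C)) (α.obj_eq z.as.as)) (Str.icon α p) (Str.icon α q)
    refine (Full.hcell_pre (R := strReal C) (x := ⟨⟨F.obj x.as.as⟩⟩) (y := ⟨⟨F.obj z.as.as⟩⟩)
      (x' := ⟨⟨G.obj x.as.as⟩⟩) (y' := ⟨⟨G.obj z.as.as⟩⟩) (p := Str.map F (Str.append p q))
      (p' := Str.map G (Str.append p q)) (Str.map_append F p q).symm _ _ _).trans ?_
    refine (congrArg _ (Str.icon_append α p q)).trans ?_
    refine (Full.hcell_post (R := strReal C) (x := ⟨⟨F.obj x.as.as⟩⟩) (y := ⟨⟨F.obj z.as.as⟩⟩)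
      (x' := ⟨⟨G.obj x.as.as⟩⟩) (y' := ⟨⟨G.obj z.as.as⟩⟩)
      (p := Str.append (Str.map F p) (Str.map F q))
      (p' := Str.append (Str.map G p) (Str.map G q)) (Str.map_append G p q).symm _ _ _).symm.trans ?_
    exact congrArg (fun t => vcomp t (of (eqToHom _))) e.symm

end Icon

end

section
open HCell

/-- Strictification, on objects, 1-cells and 2-cells. -/
def st : PrelaxFunctorStruct IconCat.{u} GrayCat.{u} where
  obj B := ⟨St B⟩
  map F := stMap F
  map₂ α := stIcon α

/-- The unit of the adjunction between strictification and the inclusion. -/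
def stUnit (B : IconCat.{u}) : B ⟶ incl.obj (st.obj B) := stIncl B

/-- The counit of the adjunction between strictification and the inclusion. -/
def stCounit (A : GrayCat.{u}) : st.obj (incl.obj A) ⟶ A := stEval A

end

section
open HCell

section Lift

variable {S : Type*} [Bicategory S]

theorem hom₂_congr {a b a' b' : S} (ha : a = a') (hb : b = b') {p q : a ⟶ b} {p' q' : a' ⟶ b'}
    (hp : HEq p p') (hq : HEq q q') : (p ⟶ q) = (p' ⟶ q') := by
  subst ha hb; cases hp; cases hq; rfl

theorem comp₁_heq {a b c a' b' c' : S} (ha : a = a') (hb : b = b') (hc : c = c')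
    {p : a ⟶ b} {q : b ⟶ c} {p' : a' ⟶ b'} {q' : b' ⟶ c'} (hp : HEq p p') (hq : HEq q q') :
    HEq (p ≫ q) (p' ≫ q') := by
  subst ha hb hc; cases hp; cases hq; rfl

theorem id₁_heq {a a' : S} (ha : a = a') : HEq (𝟙 a) (𝟙 a') := by
  subst ha; rfl

theorem id₂_heq {a b a' b' : S} (ha : a = a') (hb : b = b') {p : a ⟶ b} {p' : a' ⟶ b'}
    (hp : HEq p p') : HEq (𝟙 p) (𝟙 p') := by
  subst ha hb; cases hp; rfl

theorem comp₂_heq {a b a' b' : S} (ha : a = a') (hb : b = b') {p q r : a ⟶ b} {p' q' r' : a' ⟶ b'}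
    (hp : HEq p p') (hq : HEq q q') (hr : HEq r r') {η : p ⟶ q} {θ : q ⟶ r} {η' : p' ⟶ q'}
    {θ' : q' ⟶ r'} (hη : HEq η η') (hθ : HEq θ θ') : HEq (η ≫ θ) (η' ≫ θ') := by
  subst ha hb; cases hp; cases hq; cases hr; cases hη; cases hθ; rfl

theorem wl_heq {a b c a' b' c' : S} (ha : a = a') (hb : b = b') (hc : c = c') {f : a ⟶ b}
    {f' : a' ⟶ b'} {p q : b ⟶ c} {p' q' : b' ⟶ c'} (hf : HEq f f') (hp : HEq p p')
    (hq : HEq q q') {η : p ⟶ q} {η' : p' ⟶ q'} (hη : HEq η η') : HEq (f ◁ η) (f' ◁ η') := by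
  subst ha hb hc; cases hf; cases hp; cases hq; cases hη; rfl

theorem wr_heq {a b c a' b' c' : S} (ha : a = a') (hb : b = b') (hc : c = c') {f : b ⟶ c}
    {f' : b' ⟶ c'} {p q : a ⟶ b} {p' q' : a' ⟶ b'} (hf : HEq f f') (hp : HEq p p')
    (hq : HEq q q') {η : p ⟶ q} {η' : p' ⟶ q'} (hη : HEq η η') : HEq (η ▷ f) (η' ▷ f') := by
  subst ha hb hc; cases hf; cases hp; cases hq; cases hη; rfl

theorem eqToHom₂_heq {a b : S} {p q : a ⟶ b} (h : p = q) : HEq (eqToHom h) (𝟙 p) := by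
  subst h; rfl

theorem conj_heq {a b : S} {p p' q q' : a ⟶ b} (h : p' = p) (η : p ⟶ q) (h' : q = q') :
    HEq (eqToHom h ≫ η ≫ eqToHom h') η := by
  subst h h'; simp

variable {C : Type*} [Bicategory C] {D : Type*} [Bicategory D]

theorem strict_wl (F : StrictPseudofunctor C D) {a b c : C} (f : a ⟶ b) {g h : b ⟶ c} (η : g ⟶ h) :
    F.map₂ (f ◁ η) = eqToHom (F.map_comp f g) ≫ F.map f ◁ F.map₂ η ≫
      eqToHom (F.map_comp f h).symm := by
  rw [Pseudofunctor.map₂_whisker_left, F.mapComp_eq_eqToIso, F.mapComp_eq_eqToIso]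
  simp

theorem strict_wr (F : StrictPseudofunctor C D) {a b c : C} {f g : a ⟶ b} (η : f ⟶ g) (h : b ⟶ c) :
    F.map₂ (η ▷ h) = eqToHom (F.map_comp f h) ≫ F.map₂ η ▷ F.map h ≫
      eqToHom (F.map_comp g h).symm := by
  rw [Pseudofunctor.map₂_whisker_right, F.mapComp_eq_eqToIso, F.mapComp_eq_eqToIso]
  simp

/-- A 2-functor is locally fully faithful: every 2-cell between the images of two 1-cells lifts
uniquely. -/
structure LFF (E : StrictPseudofunctor D S) where
  lift {x y : D} {p q : x ⟶ y} (η : E.map p ⟶ E.map q) : p ⟶ q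
  map_lift {x y : D} {p q : x ⟶ y} (η : E.map p ⟶ E.map q) : E.map₂ (lift η) = η
  lift_map {x y : D} {p q : x ⟶ y} (η : p ⟶ q) : lift (E.map₂ η) = η

namespace LFF

variable {E : StrictPseudofunctor D S} (L : LFF E) 

theorem ext (L : LFF E) {x y : D} {p q : x ⟶ y} {η θ : p ⟶ q} (h : E.map₂ η = E.map₂ θ) : η = θ := by
  rw [← L.lift_map η, h, L.lift_map]

/-- The isomorphism lifting an equality. -/
def isoOfEq {x y : D} {p q : x ⟶ y} (h : E.map p = E.map q) : p ≅ q where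
  hom := L.lift (eqToHom h)
  inv := L.lift (eqToHom h.symm)
  hom_inv_id := L.ext (by simp [L.map_lift])
  inv_hom_id := L.ext (by simp [L.map_lift])

theorem map_isoOfEq_hom {x y : D} {p q : x ⟶ y} (h : E.map p = E.map q) :
    E.map₂ (L.isoOfEq h).hom = eqToHom h := L.map_lift _

theorem map_isoOfEq_inv {x y : D} {p q : x ⟶ y} (h : E.map p = E.map q) :
    E.map₂ (L.isoOfEq h).inv = eqToHom h.symm := L.map_lift _

theorem map_id_eq
    (G : StrictPseudofunctor C S) (obj : C → D)
    (map : ∀ {x y : C}, (x ⟶ y) → (obj x ⟶ obj y)) (hobj : ∀ x, E.obj (obj x) = G.obj x)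
    (hmap : ∀ {x y : C} (p : x ⟶ y), HEq (E.map (map p)) (G.map p))
    (x : C) : E.map (map (𝟙 x)) = E.map (𝟙 (obj x)) := by
  refine eq_of_heq ((hmap (𝟙 x)).trans ?_)
  rw [G.map_id, E.map_id]
  exact (id₁_heq (hobj x)).symm

theorem map_comp_eq
    (G : StrictPseudofunctor C S) (obj : C → D)
    (map : ∀ {x y : C}, (x ⟶ y) → (obj x ⟶ obj y)) (hobj : ∀ x, E.obj (obj x) = G.obj x)
    (hmap : ∀ {x y : C} (p : x ⟶ y), HEq (E.map (map p)) (G.map p))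
    {x y z : C} (p : x ⟶ y) (q : y ⟶ z) : E.map (map (p ≫ q)) = E.map (map p ≫ map q) := by
  refine eq_of_heq ((hmap (p ≫ q)).trans ?_)
  rw [G.map_comp, E.map_comp]
  exact (comp₁_heq (hobj x) (hobj y) (hobj z) (hmap p) (hmap q)).symm

variable (G : StrictPseudofunctor C S) (obj : C → D) (map : ∀ {x y : C}, (x ⟶ y) → (obj x ⟶ obj y))
  (hobj : ∀ x, E.obj (obj x) = G.obj x)
  (hmap : ∀ {x y : C} (p : x ⟶ y), HEq (E.map (map p)) (G.map p))

/-- The lift of the action of `G` on 2-cells. -/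
def lift₂ {x y : C} {p q : x ⟶ y} (η : p ⟶ q) : map p ⟶ map q :=
  L.lift (cast (hom₂_congr (hobj x) (hobj y) (hmap p) (hmap q)).symm (G.map₂ η))

theorem map_lift₂ {x y : C} {p q : x ⟶ y} (η : p ⟶ q) :
    HEq (E.map₂ (L.lift₂ G obj map hobj hmap η)) (G.map₂ η) := by
  rw [lift₂, L.map_lift]
  exact cast_heq _ _

theorem lift₂_id {x y : C} (p : x ⟶ y) : L.lift₂ G obj map hobj hmap (𝟙 p) = 𝟙 (map p) := by
  refine L.ext (eq_of_heq ((L.map_lift₂ G obj map hobj hmap (𝟙 p)).trans ?_))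
  rw [PrelaxFunctor.map₂_id, PrelaxFunctor.map₂_id]
  exact (id₂_heq (hobj x) (hobj y) (hmap p)).symm

theorem lift₂_comp {x y : C} {p q r : x ⟶ y} (η : p ⟶ q) (θ : q ⟶ r) :
    L.lift₂ G obj map hobj hmap (η ≫ θ) =
      L.lift₂ G obj map hobj hmap η ≫ L.lift₂ G obj map hobj hmap θ := by
  refine L.ext (eq_of_heq ((L.map_lift₂ G obj map hobj hmap _).trans ?_))
  rw [PrelaxFunctor.map₂_comp, PrelaxFunctor.map₂_comp]
  exact (comp₂_heq (hobj x) (hobj y) (hmap p) (hmap q) (hmap r) (L.map_lift₂ G obj map hobj hmap η)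
    (L.map_lift₂ G obj map hobj hmap θ)).symm

theorem lift₂_eqToHom {x y : C} {p q : x ⟶ y} (h : p = q) :
    L.lift₂ G obj map hobj hmap (eqToHom h) = eqToHom (congrArg map h) := by
  subst h
  exact L.lift₂_id ..

theorem lift₂_wl {x y z : C} (f : x ⟶ y) {p q : y ⟶ z} (η : p ⟶ q) :
    HEq (E.map₂ (L.lift₂ G obj map hobj hmap (f ◁ η)))
      (E.map₂ (map f ◁ L.lift₂ G obj map hobj hmap η)) := by
  refine (L.map_lift₂ G obj map hobj hmap _).trans ?_
  rw [strict_wl, strict_wl]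
  exact (conj_heq _ _ _).trans ((wl_heq (hobj x) (hobj y) (hobj z) (hmap f) (hmap p) (hmap q)
    (L.map_lift₂ G obj map hobj hmap η)).symm.trans (conj_heq _ _ _).symm)

theorem lift₂_wr {x y z : C} {p q : x ⟶ y} (η : p ⟶ q) (f : y ⟶ z) :
    HEq (E.map₂ (L.lift₂ G obj map hobj hmap (η ▷ f)))
      (E.map₂ (L.lift₂ G obj map hobj hmap η ▷ map f)) := by
  refine (L.map_lift₂ G obj map hobj hmap _).trans ?_
  rw [strict_wr, strict_wr]
  exact (conj_heq _ _ _).trans ((wr_heq (hobj x) (hobj y) (hobj z) (hmap f) (hmap p) (hmap q)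
    (L.map_lift₂ G obj map hobj hmap η)).symm.trans (conj_heq _ _ _).symm)

variable [Strict C] [Strict D]

/-- The pseudofunctor which lifts the 2-functor `G` along the locally fully faithful 2-functor `E`
and has the given actions on objects and 1-cells. -/
def liftPseudofunctor : C ⥤ᵖ D where
  obj := obj
  map := map
  map₂ η := L.lift₂ G obj map hobj hmap η
  map₂_id p := L.lift₂_id G obj map hobj hmap p
  map₂_comp η θ := L.lift₂_comp G obj map hobj hmap η θ
  mapId x := L.isoOfEq (map_id_eq G obj map hobj hmap x)
  mapComp p q := L.isoOfEq (map_comp_eq G obj map hobj hmap p q)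
  map₂_whisker_left f _ _ η := L.ext (by
    rw [PrelaxFunctor.map₂_comp, PrelaxFunctor.map₂_comp, map_isoOfEq_hom, map_isoOfEq_inv]
    exact eq_of_heq ((L.lift₂_wl G obj map hobj hmap f η).trans (conj_heq _ _ _).symm))
  map₂_whisker_right η f := L.ext (by
    rw [PrelaxFunctor.map₂_comp, PrelaxFunctor.map₂_comp, map_isoOfEq_hom, map_isoOfEq_inv]
    exact eq_of_heq ((L.lift₂_wr G obj map hobj hmap η f).trans (conj_heq _ _ _).symm))
  map₂_associator f g h := L.ext (by
    rw [Strict.associator_eqToIso, Strict.associator_eqToIso, eqToIso.hom, L.lift₂_eqToHom]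
    simp only [PrelaxFunctor.map₂_comp, map_isoOfEq_hom, map_isoOfEq_inv, strict_wl, strict_wr,
      PrelaxFunctor.map₂_eqToHom, eqToIso.hom, whiskerLeft_eqToHom, eqToHom_whiskerRight,
      eqToHom_trans])
  map₂_left_unitor f := L.ext (by
    rw [Strict.leftUnitor_eqToIso, Strict.leftUnitor_eqToIso, eqToIso.hom, L.lift₂_eqToHom]
    simp only [PrelaxFunctor.map₂_comp, map_isoOfEq_hom, map_isoOfEq_inv, strict_wl, strict_wr,
      PrelaxFunctor.map₂_eqToHom, eqToIso.hom, whiskerLeft_eqToHom, eqToHom_whiskerRight,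
      eqToHom_trans])
  map₂_right_unitor f := L.ext (by
    rw [Strict.rightUnitor_eqToIso, Strict.rightUnitor_eqToIso, eqToIso.hom, L.lift₂_eqToHom]
    simp only [PrelaxFunctor.map₂_comp, map_isoOfEq_hom, map_isoOfEq_inv, strict_wl, strict_wr,
      PrelaxFunctor.map₂_eqToHom, eqToIso.hom, whiskerLeft_eqToHom, eqToHom_whiskerRight,
      eqToHom_trans])

/-- The 2-functor which lifts the 2-functor `G` along the locally fully faithful 2-functor `E`
and has the given, functorial, actions on objects and 1-cells. -/
def liftStrict (map_id : ∀ x, map (𝟙 x) = 𝟙 (obj x))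
    (map_comp : ∀ {x y z : C} (p : x ⟶ y) (q : y ⟶ z), map (p ≫ q) = map p ≫ map q) :
    StrictPseudofunctor C D := .mk''
  { obj := obj
    map := map
    map₂ η := L.lift₂ G obj map hobj hmap η
    map₂_id p := L.lift₂_id G obj map hobj hmap p
    map₂_comp η θ := L.lift₂_comp G obj map hobj hmap η θ
    map_id := map_id
    map_comp := map_comp
    map₂_whisker_left f _ _ η := L.ext (by
      rw [PrelaxFunctor.map₂_comp, PrelaxFunctor.map₂_comp, PrelaxFunctor.map₂_eqToHom,
        PrelaxFunctor.map₂_eqToHom]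
      exact eq_of_heq ((L.lift₂_wl G obj map hobj hmap f η).trans (conj_heq _ _ _).symm))
    map₂_whisker_right η f := L.ext (by
      rw [PrelaxFunctor.map₂_comp, PrelaxFunctor.map₂_comp, PrelaxFunctor.map₂_eqToHom,
        PrelaxFunctor.map₂_eqToHom]
      exact eq_of_heq ((L.lift₂_wr G obj map hobj hmap η f).trans (conj_heq _ _ _).symm)) }

end LFF

end Lift

end

section
open HCell

section Funny

variable {A : Type u} [Bicategory.{w, v} A] {B : Type u'} [Bicategory.{w', v'} B]

/-- Formal composites of the generating 1-cells `f ⊗ 1` and `1 ⊗ g`. -/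
inductive Word : A × B → A × B → Type (max u v u' v')
  | id (x : A × B) : Word x x
  | comp {x y z : A × B} (p : Word x y) (q : Word y z) : Word x z
  | left {a a' : A} (f : a ⟶ a') (b : B) : Word (a, b) (a', b)
  | right (a : A) {b b' : B} (g : b ⟶ b') : Word (a, b) (a, b')

/-- The relations between formal composites of generating 1-cells: those of a category, and the
functoriality of `f ⊗ 1` and `1 ⊗ g` in `f` and `g`. -/
inductive WordRel : ∀ {x y : A × B}, Word x y → Word x y → Prop
  | comp_left {x y z : A × B} (p : Word x y) {q q' : Word y z} (h : WordRel q q') :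
      WordRel (.comp p q) (.comp p q')
  | comp_right {x y z : A × B} {p p' : Word x y} (q : Word y z) (h : WordRel p p') :
      WordRel (.comp p q) (.comp p' q)
  | id_comp {x y : A × B} (p : Word x y) : WordRel (.comp (.id x) p) p
  | comp_id {x y : A × B} (p : Word x y) : WordRel (.comp p (.id y)) p
  | assoc {x y z t : A × B} (p : Word x y) (q : Word y z) (r : Word z t) :
      WordRel (.comp (.comp p q) r) (.comp p (.comp q r))
  | left_id (a : A) (b : B) : WordRel (.left (𝟙 a) b) (.id (a, b))
  | left_comp {a a' a'' : A} (f : a ⟶ a') (f' : a' ⟶ a'') (b : B) :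
      WordRel (.left (f ≫ f') b) (.comp (.left f b) (.left f' b))
  | right_id (a : A) (b : B) : WordRel (.right a (𝟙 b)) (.id (a, b))
  | right_comp (a : A) {b b' b'' : B} (g : b ⟶ b') (g' : b' ⟶ b'') :
      WordRel (.right a (g ≫ g')) (.comp (.right a g) (.right a g'))

/-- The composite in `A × B` of a formal composite. -/
def Word.eval : ∀ {x y : A × B}, Word x y → (x ⟶ y)
  | _, _, .id x => 𝟙 x
  | _, _, .comp p q => eval p ≫ eval q
  | _, _, .left f b => f ×ₘ 𝟙 b
  | _, _, .right a g => 𝟙 a ×ₘ g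

theorem WordRel.eval_eq [Strict A] [Strict B] {x y : A × B} {p q : Word x y} (h : WordRel p q) :
    p.eval = q.eval := by
  induction h with
  | comp_left p _ ih => exact congrArg (p.eval ≫ ·) ih
  | comp_right q _ ih => exact congrArg (· ≫ q.eval) ih
  | id_comp p => exact Strict.id_comp _
  | comp_id p => exact Strict.comp_id _
  | assoc p q r => exact Strict.assoc _ _ _
  | left_id a b => rfl
  | left_comp f f' b => exact Prod.ext rfl (Strict.id_comp _).symm
  | right_id a b => rfl
  | right_comp a g g' => exact Prod.ext (Strict.id_comp _).symm rfl

variable (A B) in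
/-- The category generated by the 1-cells `f ⊗ 1` and `1 ⊗ g`, subject to functoriality of
`f ⊗ 1` in `f` and of `1 ⊗ g` in `g`. -/
structure Funny where
  as : A × B

namespace Funny

/-- Equivalence classes of formal composites. -/
abbrev Class (x y : A × B) := Quot (WordRel (x := x) (y := y))

/-- Composition of equivalence classes of formal composites. -/
def comp {x y z : A × B} (p : Class x y) (q : Class y z) : Class x z :=
  Quot.map₂ Word.comp (fun p _ _ h => .comp_left p h) (fun _ _ q h => .comp_right q h) p q

instance : Category (Funny A B) where
  Hom x y := Class x.as y.as
  id x := Quot.mk _ (.id x.as)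
  comp p q := comp p q
  id_comp := by rintro x y ⟨p⟩; exact Quot.sound (.id_comp p)
  comp_id := by rintro x y ⟨p⟩; exact Quot.sound (.comp_id p)
  assoc := by rintro x y z t ⟨p⟩ ⟨q⟩ ⟨r⟩; exact Quot.sound (.assoc p q r)

/-- The 1-cell represented by a formal composite. -/
def cls {x y : Funny A B} (p : Word x.as y.as) : x ⟶ y := Quot.mk _ p

theorem cls_eq {x y : Funny A B} {p q : Word x.as y.as} (h : WordRel p q) :
    (cls p : x ⟶ y) = cls q := Quot.sound h

theorem ind {x y : Funny A B} {P : (x ⟶ y) → Prop} (h : ∀ p, P (cls p)) (p : x ⟶ y) : P p :=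
  Quot.ind h p

/-- The object `a ⊗ b`. -/
abbrev mk' (a : A) (b : B) : Funny A B := ⟨(a, b)⟩

/-- The generator `f ⊗ 1`. -/
def left {a a' : A} (f : a ⟶ a') (b : B) : mk' a b ⟶ mk' a' b := cls (.left f b)

/-- The generator `1 ⊗ g`. -/
def right (a : A) {b b' : B} (g : b ⟶ b') : mk' a b ⟶ mk' a b' := cls (.right a g)

theorem left_id (a : A) (b : B) : left (𝟙 a) b = 𝟙 (mk' a b) := cls_eq (.left_id a b)

theorem left_comp {a a' a'' : A} (f : a ⟶ a') (f' : a' ⟶ a'') (b : B) :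
    left (f ≫ f') b = left f b ≫ left f' b := cls_eq (.left_comp f f' b)

theorem right_id (a : A) (b : B) : right a (𝟙 b) = 𝟙 (mk' a b) := cls_eq (.right_id a b)

theorem right_comp (a : A) {b b' b'' : B} (g : b ⟶ b') (g' : b' ⟶ b'') :
    right a (g ≫ g') = right a g ≫ right a g' := cls_eq (.right_comp a g g')

/-- The action of a functor out of `Funny A B` determined by its values on generators. -/
def lift {K : Type*} [Category K] (obj : A × B → K)
    (l : ∀ {a a' : A} (_ : a ⟶ a') (b : B), obj (a, b) ⟶ obj (a', b))
    (r : ∀ (a : A) {b b' : B} (_ : b ⟶ b'), obj (a, b) ⟶ obj (a, b')) :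
    ∀ {x y : A × B}, Word x y → (obj x ⟶ obj y)
  | _, _, .id x => 𝟙 (obj x)
  | _, _, .comp p q => lift obj l r p ≫ lift obj l r q
  | _, _, .left f b => l f b
  | _, _, .right a g => r a g

theorem lift_eq {K : Type*} [Category K] (obj : A × B → K)
    (l : ∀ {a a' : A} (_ : a ⟶ a') (b : B), obj (a, b) ⟶ obj (a', b))
    (r : ∀ (a : A) {b b' : B} (_ : b ⟶ b'), obj (a, b) ⟶ obj (a, b'))
    (hl : ∀ a b, l (𝟙 a) b = 𝟙 _)
    (hl' : ∀ {a a' a'' : A} (f : a ⟶ a') (f' : a' ⟶ a'') (b : B), l (f ≫ f') b = l f b ≫ l f' b)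
    (hr : ∀ a b, r a (𝟙 b) = 𝟙 _)
    (hr' : ∀ (a : A) {b b' b'' : B} (g : b ⟶ b') (g' : b' ⟶ b''), r a (g ≫ g') = r a g ≫ r a g')
    {x y : A × B} {p q : Word x y} (h : WordRel p q) : lift obj l r p = lift obj l r q := by
  induction h with
  | comp_left p _ ih => exact congrArg (lift obj l r p ≫ ·) ih
  | comp_right q _ ih => exact congrArg (· ≫ lift obj l r q) ih
  | id_comp p => exact Category.id_comp _
  | comp_id p => exact Category.comp_id _
  | assoc p q r => exact Category.assoc _ _ _
  | left_id a b => exact hl a b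
  | left_comp f f' b => exact hl' f f' b
  | right_id a b => exact hr a b
  | right_comp a g g' => exact hr' a g g'

/-- The functor out of `Funny A B` determined by its values on generators. -/
def liftFunctor {K : Type*} [Category K] (obj : A × B → K)
    (l : ∀ {a a' : A} (_ : a ⟶ a') (b : B), obj (a, b) ⟶ obj (a', b))
    (r : ∀ (a : A) {b b' : B} (_ : b ⟶ b'), obj (a, b) ⟶ obj (a, b'))
    (hl : ∀ a b, l (𝟙 a) b = 𝟙 _)
    (hl' : ∀ {a a' a'' : A} (f : a ⟶ a') (f' : a' ⟶ a'') (b : B), l (f ≫ f') b = l f b ≫ l f' b)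
    (hr : ∀ a b, r a (𝟙 b) = 𝟙 _)
    (hr' : ∀ (a : A) {b b' b'' : B} (g : b ⟶ b') (g' : b' ⟶ b''), r a (g ≫ g') = r a g ≫ r a g') :
    Funny A B ⥤ K where
  obj x := obj x.as
  map {x y} p := Quot.lift (lift obj l r (x := x.as) (y := y.as))
    (fun _ _ h => lift_eq obj l r hl hl' hr hr' h) p
  map_id _ := rfl
  map_comp := by rintro x y z ⟨p⟩ ⟨q⟩; rfl

end Funny

variable [Strict A] [Strict B]

/-- A functor from a category to (the underlying category of) a 2-category. -/
def Realization.ofStrict {K : Type*} [Category K] {S : Type*} [Bicategory S] [Strict S]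
    (obj : K → S) (map : ∀ {x y : K}, (x ⟶ y) → (obj x ⟶ obj y))
    (map_id : ∀ x, map (𝟙 x) = 𝟙 (obj x))
    (map_comp : ∀ {x y z : K} (p : x ⟶ y) (q : y ⟶ z), map (p ≫ q) = map p ≫ map q) :
    Realization K S where
  obj := obj
  map := map
  idIso x := eqToIso (map_id x).symm
  compIso p q := eqToIso (map_comp p q).symm
  assoc p q r := by
    simp only [Strict.associator_eqToIso, eqToIso.hom, eqToHom_whiskerRight, whiskerLeft_eqToHom,
      eqToHom_trans]
  id_left p := by
    simp only [Strict.leftUnitor_eqToIso, eqToIso.hom, eqToHom_whiskerRight, eqToHom_trans]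
  id_right p := by
    simp only [Strict.rightUnitor_eqToIso, eqToIso.hom, whiskerLeft_eqToHom, eqToHom_trans]

variable (A B) in
/-- Realization of the 1-cells of the Gray tensor product in the cartesian product. -/
def grayReal : Realization (Funny A B) (A × B) := .ofStrict (fun x => x.as)
  (fun {x y} p => Quot.lift (Word.eval (x := x.as) (y := y.as)) (fun _ _ h => h.eval_eq) p)
  (fun _ => rfl) (by rintro x y z ⟨p⟩ ⟨q⟩; rfl)

variable (A B) in
/-- The Gray tensor product of the 2-categories `A` and `B`. -/
abbrev GrayTensor := Full (grayReal A B)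

variable (A B) in
/-- The projection from the Gray tensor product to the cartesian product. -/
def grayProj : StrictPseudofunctor (GrayTensor A B) (A × B) :=
  Full.evStrict (grayReal A B) (fun _ => ⟨rfl, rfl⟩) (fun _ _ => ⟨_, rfl⟩)

/-- The projection to the cartesian product is locally fully faithful. -/
def grayLFF : LFF (grayProj A B) where
  lift η := η
  map_lift _ := rfl
  lift_map _ := rfl

end Funny

end

section
open HCell

section ProdStrict

variable {A : Type*} [Bicategory A] {A' : Type*} [Bicategory A'] {B : Type*} [Bicategory B]
  {B' : Type*} [Bicategory B']

/-- The product of two 2-functors. -/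
def prodStrict (F : StrictPseudofunctor A A') (G : StrictPseudofunctor B B') :
    StrictPseudofunctor (A × B) (A' × B') where
  toPseudofunctor := prodMap F.toPseudofunctor G.toPseudofunctor
  map_id x := Prod.ext (F.map_id x.1) (G.map_id x.2)
  map_comp f g := Prod.ext (F.map_comp f.1 g.1) (G.map_comp f.2 g.2)
  mapId_eq_eqToIso x := by
    have h {a b : A'} {c d : B'} {p p' : a ⟶ b} {q q' : c ⟶ d} (h : p = p') (h' : q = q') :
        Iso.prod (eqToIso h) (eqToIso h') = eqToIso (Prod.ext h h' : (p ×ₘ q) = (p' ×ₘ q')) := by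
      subst h h'; rfl
    change Iso.prod (F.mapId x.1) (G.mapId x.2) = _
    rw [F.mapId_eq_eqToIso, G.mapId_eq_eqToIso]
    exact h _ _
  mapComp_eq_eqToIso f g := by
    have h {a b : A'} {c d : B'} {p p' : a ⟶ b} {q q' : c ⟶ d} (h : p = p') (h' : q = q') :
        Iso.prod (eqToIso h) (eqToIso h') = eqToIso (Prod.ext h h' : (p ×ₘ q) = (p' ×ₘ q')) := by
      subst h h'; rfl
    change Iso.prod (F.mapComp f.1 g.1) (G.mapComp f.2 g.2) = _
    rw [F.mapComp_eq_eqToIso, G.mapComp_eq_eqToIso]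
    exact h _ _

/-- The associativity isomorphism of the product, as a 2-functor. -/
def prodAssocStrict (A B C : Type*) [Bicategory A] [Bicategory B] [Bicategory C] :
    StrictPseudofunctor ((A × B) × C) (A × (B × C)) where
  toPseudofunctor := prodAssoc A B C
  map_id _ := rfl
  map_comp _ _ := rfl
  mapId_eq_eqToIso _ := rfl
  mapComp_eq_eqToIso _ _ := rfl

/-- Composites of locally fully faithful 2-functors. -/
def LFF.comp {E : StrictPseudofunctor A A'} {E' : StrictPseudofunctor A' B} (L : LFF E)
    (L' : LFF E') : LFF (E.comp E') where
  lift η := L.lift (L'.lift η)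
  map_lift η := (congrArg (fun t => E'.map₂ t) (L.map_lift _)).trans (L'.map_lift η)
  lift_map η := (congrArg L.lift (L'.lift_map _)).trans (L.lift_map η)

/-- The product of the identity and a locally fully faithful 2-functor. -/
def LFF.idProd (A : Type*) [Bicategory A] {E : StrictPseudofunctor B B'} (L : LFF E) :
    LFF (prodStrict (StrictPseudofunctor.id A) E) where
  lift η := η.1 ×ₘ L.lift η.2
  map_lift η := Prod.ext rfl (L.map_lift η.2)
  lift_map η := Prod.ext rfl (L.lift_map η.2)

end ProdStrict

section Gray

variable {A : Type u} [Bicategory.{w, v} A] [Strict A] {B : Type u'} [Bicategory.{w', v'} B]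
  [Strict B]

/-- The 1-cell `f ⊗ 1` of the Gray tensor product. -/
def grayLeft {a a' : A} (f : a ⟶ a') (b : B) :
    (⟨⟨(a, b)⟩⟩ : GrayTensor A B) ⟶ ⟨⟨(a', b)⟩⟩ := Funny.left f b

/-- The 1-cell `1 ⊗ g` of the Gray tensor product. -/
def grayRight (a : A) {b b' : B} (g : b ⟶ b') :
    (⟨⟨(a, b)⟩⟩ : GrayTensor A B) ⟶ ⟨⟨(a, b')⟩⟩ := Funny.right a g

variable (A B) in
/-- The universal cubical functor: it sends `(f, g)` to the composite of `f ⊗ 1` followed by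
`1 ⊗ g`. -/
def cub : (A × B) ⥤ᵖ GrayTensor A B :=
  grayLFF.liftPseudofunctor (StrictPseudofunctor.id (A × B)) (fun x => ⟨⟨x⟩⟩)
    (fun {x y} f => grayLeft f.1 x.2 ≫ grayRight y.1 f.2) (fun _ => rfl)
    (fun _ => heq_of_eq (Prod.ext (Strict.comp_id _) (Strict.id_comp _)))

variable {A' : Type*} [Bicategory A'] [Strict A'] {B' : Type*} [Bicategory B'] [Strict B']

/-- The action of the Gray tensor product of two 2-functors on 1-cells:
`f ⊗ 1 ↦ F f ⊗ 1` and `1 ⊗ g ↦ 1 ⊗ G g`. -/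
def grayMap₁ (F : StrictPseudofunctor A A') (G : StrictPseudofunctor B B') :
    Funny A B ⥤ Funny A' B' :=
  Funny.liftFunctor (fun x => ⟨(F.obj x.1, G.obj x.2)⟩) (fun f b => Funny.left (F.map f) (G.obj b))
    (fun a _ _ g => Funny.right (F.obj a) (G.map g))
    (fun a b => by rw [F.map_id, Funny.left_id]) (fun f f' b => by rw [F.map_comp, Funny.left_comp])
    (fun a b => by rw [G.map_id, Funny.right_id]) (fun a _ _ _ g g' => by rw [G.map_comp, Funny.right_comp])

theorem grayReal_comp {x y z : Funny A B} (p : x ⟶ y) (q : y ⟶ z) :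
    (grayReal A B).map (p ≫ q) = (grayReal A B).map p ≫ (grayReal A B).map q := by
  obtain ⟨p⟩ := p
  obtain ⟨q⟩ := q
  rfl

theorem grayMap₁_word (F : StrictPseudofunctor A A') (G : StrictPseudofunctor B B')
    {x y : A × B} (p : Word x y) :
    (grayReal A' B').map ((grayMap₁ F G).map (Funny.cls (x := ⟨x⟩) (y := ⟨y⟩) p)) =
      (prodStrict F G).map p.eval := by
  induction p with
  | id x => exact ((prodStrict F G).map_id x).symm
  | @comp x y z t r iht ihr =>
    refine (grayReal_comp ((grayMap₁ F G).map (Funny.cls (x := ⟨x⟩) (y := ⟨y⟩) t))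
      ((grayMap₁ F G).map (Funny.cls (x := ⟨y⟩) (y := ⟨z⟩) r))).trans ?_
    refine Eq.trans ?_ ((prodStrict F G).map_comp t.eval r.eval).symm
    exact congrArg₂ _ iht ihr
  | left f b => exact Prod.ext rfl (G.map_id b).symm
  | right a g => exact Prod.ext (F.map_id a).symm rfl

theorem grayMap₁_eq (F : StrictPseudofunctor A A') (G : StrictPseudofunctor B B')
    {x y : Funny A B} (p : x ⟶ y) : (grayReal A' B').map ((grayMap₁ F G).map p) =
      (prodStrict F G).map ((grayReal A B).map p) := by
  obtain ⟨p⟩ := p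
  exact grayMap₁_word F G p

/-- The Gray tensor product of two 2-functors. Its action on 2-cells is determined by the
projections to the cartesian products. -/
def grayMap (F : StrictPseudofunctor A A') (G : StrictPseudofunctor B B') :
    StrictPseudofunctor (GrayTensor A B) (GrayTensor A' B') :=
  grayLFF.liftStrict ((grayProj A B).comp (prodStrict F G))
    (fun x => ⟨⟨(F.obj x.as.as.1, G.obj x.as.as.2)⟩⟩)
    (fun {x y} p => (grayMap₁ F G).map (X := x.as) (Y := y.as) p) (fun _ => rfl)
    (fun p => heq_of_eq (grayMap₁_eq F G p)) (fun x => (grayMap₁ F G).map_id x.as)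
    (fun {x y z} p q => (grayMap₁ F G).map_comp (X := x.as) (Y := y.as) (Z := z.as) p q)

section Conj

variable {S : Type*} [Bicategory S]

theorem conj_naturality {a b a' b' : S} {m n m₂ n₂ : a ⟶ b} {m' n' m₂' n₂' : a' ⟶ b'} (h : m = n)
    (h₂ : m₂ = n₂) (h' : m' = n') (h₂' : m₂' = n₂') {γ : HCell n n'} {γ₂ : HCell n₂ n₂'}
    {η : n ⟶ n₂} {η' : n' ⟶ n₂'} (e : vcomp (of η) γ₂ = vcomp γ (of η')) :
    vcomp (of (eqToHom h ≫ η ≫ eqToHom h₂.symm))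
      (vcomp (of (eqToHom h₂)) (vcomp γ₂ (of (eqToHom h₂'.symm)))) =
    vcomp (vcomp (of (eqToHom h)) (vcomp γ (of (eqToHom h'.symm))))
      (of (eqToHom h' ≫ η' ≫ eqToHom h₂'.symm)) := by
  subst h h₂ h' h₂'
  simpa only [eqToHom_refl, HCell.id_vcomp, HCell.vcomp_id, Category.id_comp, Category.comp_id]

theorem conj_id {a a' : S} (ha : a = a') {n : a ⟶ a} {n' : a' ⟶ a'} (h : 𝟙 a = n) (h' : 𝟙 a' = n')
    {γ : HCell n n'} (e : vcomp (of (eqToHom h)) γ = vcomp (unit ha) (of (eqToHom h'))) :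
    vcomp (of (eqToHom h)) (vcomp γ (of (eqToHom h'.symm))) = unit ha := by
  subst h h'
  simpa only [eqToHom_refl, HCell.id_vcomp, HCell.vcomp_id] using e

theorem conj_comp {a b c a' b' c' : S} {p r : a ⟶ b} {q s : b ⟶ c} {k m n : a ⟶ c}
    {p' r' : a' ⟶ b'} {q' s' : b' ⟶ c'} {k' m' n' : a' ⟶ c'} (hp : p = r) (hq : q = s)
    (hm : m = n) (hk : k = m) (hc : k = p ≫ q) (hn : r ≫ s = n) (hp' : p' = r') (hq' : q' = s')
    (hm' : m' = n') (hk' : k' = m') (hc' : k' = p' ≫ q') (hn' : r' ≫ s' = n') {γ : HCell n n'}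
    {γp : HCell r r'} {γq : HCell s s'}
    (e : vcomp (of (eqToHom hn)) γ = vcomp (hcomp γp γq) (of (eqToHom hn'))) :
    vcomp (of (eqToHom hk)) (vcomp (of (eqToHom hm)) (vcomp γ (of (eqToHom hm'.symm)))) =
      vcomp (vcomp (of (eqToHom hc)) (vcomp (hcomp
        (vcomp (of (eqToHom hp)) (vcomp γp (of (eqToHom hp'.symm))))
        (vcomp (of (eqToHom hq)) (vcomp γq (of (eqToHom hq'.symm))))) (of (eqToHom hc'.symm))))
        (of (eqToHom hk')) := by
  subst hp hq hm hk hn hp' hq' hm' hk' hn'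
  simpa only [eqToHom_refl, HCell.id_vcomp, HCell.vcomp_id] using e

end Conj

theorem grayMap_map₂ (F : StrictPseudofunctor A A') (G : StrictPseudofunctor B B')
    {x y : GrayTensor A B} {p q : x ⟶ y} (η : p ⟶ q) :
    Full.under (R := grayReal A' B') ((grayMap F G).map₂ η) =
      eqToHom (grayMap₁_eq F G (x := x.as) (y := y.as) p) ≫ (prodStrict F G).map₂ (Full.under η) ≫
        eqToHom (grayMap₁_eq F G (x := x.as) (y := y.as) q).symm := by
  have h := LFF.map_lift₂ (L := grayLFF (A := A') (B := B'))
    ((grayProj A B).comp (prodStrict F G)) (fun x => ⟨⟨(F.obj x.as.as.1, G.obj x.as.as.2)⟩⟩)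
    (fun {x y} p => (grayMap₁ F G).map (X := x.as) (Y := y.as) p) (fun _ => rfl)
    (fun p => heq_of_eq (grayMap₁_eq F G p)) η
  exact eq_of_heq (h.trans (conj_heq (grayMap₁_eq F G (x := x.as) (y := y.as) p)
    ((prodStrict F G).map₂ (Full.under η)) (grayMap₁_eq F G (x := x.as) (y := y.as) q).symm).symm)

section

variable {F F' : StrictPseudofunctor A A'} {G G' : StrictPseudofunctor B B'}
  (γ : Icon (prodStrict F G).toPseudofunctor (prodStrict F' G').toPseudofunctor)

/-- An icon between products of 2-functors, at the projection of a 1-cell of the Gray tensor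
product. -/
def grayApp {x y : Funny A B} (p : x ⟶ y) :
    HCell ((grayReal A' B').map ((grayMap₁ F G).map p))
      ((grayReal A' B').map ((grayMap₁ F' G').map p)) :=
  vcomp (of (eqToHom (grayMap₁_eq F G p))) (vcomp (γ.app ((grayReal A B).map p))
    (of (eqToHom (grayMap₁_eq F' G' p).symm)))

theorem grayApp_naturality {x y : Funny A B} {p q : x ⟶ y}
    (η : (grayReal A B).map p ⟶ (grayReal A B).map q)
    {t : (grayReal A' B').map ((grayMap₁ F G).map p) ⟶ (grayReal A' B').map ((grayMap₁ F G).map q)}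
    {t' : (grayReal A' B').map ((grayMap₁ F' G').map p) ⟶
      (grayReal A' B').map ((grayMap₁ F' G').map q)}
    (ht : t = eqToHom (grayMap₁_eq F G p) ≫ (prodStrict F G).map₂ η ≫
      eqToHom (grayMap₁_eq F G q).symm)
    (ht' : t' = eqToHom (grayMap₁_eq F' G' p) ≫ (prodStrict F' G').map₂ η ≫
      eqToHom (grayMap₁_eq F' G' q).symm) :
    vcomp (of t) (grayApp γ q) = vcomp (grayApp γ p) (of t') := by
  subst ht ht'
  exact conj_naturality (grayMap₁_eq F G p) (grayMap₁_eq F G q) (grayMap₁_eq F' G' p)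
    (grayMap₁_eq F' G' q) (γ.naturality η)

theorem grayApp_id (x : Funny A B) : grayApp γ (𝟙 x) = unit (γ.obj_eq x.as) := by
  have h := γ.app_id x.as
  rw [(prodStrict F G).mapId_eq_eqToIso, (prodStrict F' G').mapId_eq_eqToIso] at h
  exact conj_id (γ.obj_eq x.as) (grayMap₁_eq F G (𝟙 x)) (grayMap₁_eq F' G' (𝟙 x)) h

theorem grayApp_aux {x y z : Funny A B} (p : x ⟶ y) (q : y ⟶ z) :
    vcomp (of (eqToHom (((prodStrict F G).map_comp _ _).symm.trans
        (congrArg (prodStrict F G).map (grayReal_comp p q).symm))))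
      (γ.app ((grayReal A B).map (p ≫ q))) =
    vcomp (hcomp (γ.app ((grayReal A B).map p)) (γ.app ((grayReal A B).map q)))
      (of (eqToHom (((prodStrict F' G').map_comp _ _).symm.trans
        (congrArg (prodStrict F' G').map (grayReal_comp p q).symm)))) := by
  obtain ⟨p⟩ := p
  obtain ⟨q⟩ := q
  have h := γ.app_comp p.eval q.eval
  rw [(prodStrict F G).mapComp_eq_eqToIso, (prodStrict F' G').mapComp_eq_eqToIso] at h
  exact h

theorem grayApp_comp {x y z : Funny A B} (p : x ⟶ y) (q : y ⟶ z) :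
    vcomp (of (eqToHom (congrArg (grayReal A' B').map ((grayMap₁ F G).map_comp p q).symm)))
        (grayApp γ (p ≫ q)) =
      vcomp (vcomp (of ((grayReal A' B').compIso ((grayMap₁ F G).map p) ((grayMap₁ F G).map q)).inv)
        (vcomp (hcomp (grayApp γ p) (grayApp γ q))
          (of ((grayReal A' B').compIso ((grayMap₁ F' G').map p) ((grayMap₁ F' G').map q)).hom)))
        (of (eqToHom (congrArg (grayReal A' B').map ((grayMap₁ F' G').map_comp p q).symm))) := by
  have h := grayApp_aux γ p q
  exact conj_comp (grayMap₁_eq F G p) (grayMap₁_eq F G q) (grayMap₁_eq F G (p ≫ q))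
    (congrArg (grayReal A' B').map ((grayMap₁ F G).map_comp p q).symm) (grayReal_comp _ _)
    (((prodStrict F G).map_comp _ _).symm.trans
      (congrArg (prodStrict F G).map (grayReal_comp p q).symm)) (grayMap₁_eq F' G' p)
    (grayMap₁_eq F' G' q) (grayMap₁_eq F' G' (p ≫ q))
    (congrArg (grayReal A' B').map ((grayMap₁ F' G').map_comp p q).symm) (grayReal_comp _ _)
    (((prodStrict F' G').map_comp _ _).symm.trans
      (congrArg (prodStrict F' G').map (grayReal_comp p q).symm)) h

end

theorem grayIcon_unit {t t' : A' × B'} (h : t = t') :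
    Full.hcell (p := 𝟙 (⟨⟨t⟩⟩ : GrayTensor A' B')) (p' := 𝟙 (⟨⟨t'⟩⟩ : GrayTensor A' B'))
      (congrArg (fun t => (⟨⟨t⟩⟩ : GrayTensor A' B')) h)
      (congrArg (fun t => (⟨⟨t⟩⟩ : GrayTensor A' B')) h) (unit h) =
    unit (congrArg (fun t => (⟨⟨t⟩⟩ : GrayTensor A' B')) h) := by
  subst h; rfl

/-- The Gray tensor product of two icons. Its component at a 1-cell is the component of the
product of the icons at the projection of the 1-cell to the cartesian product. In particular, its
components at `f ⊗ 1` and `1 ⊗ g` are given by the component of `α` at `f` and of `β` at `g`. -/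
def grayIcon {F F' : StrictPseudofunctor A A'} {G G' : StrictPseudofunctor B B'}
    (α : Icon F.toPseudofunctor F'.toPseudofunctor) (β : Icon G.toPseudofunctor G'.toPseudofunctor) :
    Icon (grayMap F G).toPseudofunctor (grayMap F' G').toPseudofunctor where
  obj_eq x := congrArg (fun t => (⟨⟨t⟩⟩ : GrayTensor A' B')) ((α.prod β).obj_eq x.as.as)
  app {x y} p := Full.hcell
    (congrArg (fun t => (⟨⟨t⟩⟩ : GrayTensor A' B')) ((α.prod β).obj_eq x.as.as))
    (congrArg (fun t => (⟨⟨t⟩⟩ : GrayTensor A' B')) ((α.prod β).obj_eq y.as.as))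
    (grayApp (α.prod β) (x := x.as) (y := y.as) p)
  naturality {x y p q} η := by
    have e := grayApp_naturality (F := F) (F' := F') (G := G) (G' := G') (α.prod β) (x := x.as)
      (y := y.as) (p := p) (q := q) (Full.under η)
      (grayMap_map₂ F G (x := x) (y := y) (p := p) (q := q) η)
      (grayMap_map₂ F' G' (x := x) (y := y) (p := p) (q := q) η)
    refine (Full.hcell_vcomp (R := grayReal A' B') (x := (grayMap F G).obj x)
      (y := (grayMap F G).obj y) (x' := (grayMap F G).obj x) (y' := (grayMap F G).obj y)
      (x'' := (grayMap F' G').obj x) (y'' := (grayMap F' G').obj y) (p := (grayMap F G).map p)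
      (p' := (grayMap F G).map q) (p'' := (grayMap F' G').map q) rfl rfl _ _
      (of (Full.under ((grayMap F G).map₂ η)))
      (grayApp (α.prod β) (x := x.as) (y := y.as) q)).trans ?_
    refine (congrArg _ e).trans ?_
    exact (Full.hcell_vcomp (R := grayReal A' B') (x := (grayMap F G).obj x)
      (y := (grayMap F G).obj y) (x' := (grayMap F' G').obj x) (y' := (grayMap F' G').obj y)
      (x'' := (grayMap F' G').obj x) (y'' := (grayMap F' G').obj y) (p := (grayMap F G).map p)
      (p' := (grayMap F' G').map p) (p'' := (grayMap F' G').map q) _ _ rfl rfl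
      (grayApp (α.prod β) (x := x.as) (y := y.as) p)
      (of (Full.under ((grayMap F' G').map₂ η)))).symm
  app_id x := by
    refine (HCell.id_vcomp _).trans (Eq.trans ?_ (HCell.vcomp_id _).symm)
    refine (congrArg _ (grayApp_id (F := F) (F' := F') (G := G) (G' := G') (α.prod β) x.as)).trans ?_
    exact grayIcon_unit _
  app_comp {x y z} p q := by
    have e := Full.hcell_hcomp (R := grayReal A' B') (x := (grayMap F G).obj x)
      (y := (grayMap F G).obj y) (z := (grayMap F G).obj z) (x' := (grayMap F' G').obj x)
      (y' := (grayMap F' G').obj y) (z' := (grayMap F' G').obj z) (p := (grayMap F G).map p)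
      (p' := (grayMap F' G').map p) (q := (grayMap F G).map q) (q' := (grayMap F' G').map q)
      (congrArg (fun t => (⟨⟨t⟩⟩ : GrayTensor A' B')) ((α.prod β).obj_eq x.as.as))
      (congrArg (fun t => (⟨⟨t⟩⟩ : GrayTensor A' B')) ((α.prod β).obj_eq y.as.as))
      (congrArg (fun t => (⟨⟨t⟩⟩ : GrayTensor A' B')) ((α.prod β).obj_eq z.as.as))
      (grayApp (α.prod β) (x := x.as) (y := y.as) p) (grayApp (α.prod β) (x := y.as) (y := z.as) q)
    refine (Full.hcell_pre (R := grayReal A' B') (x := (grayMap F G).obj x)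
      (y := (grayMap F G).obj z) (x' := (grayMap F' G').obj x) (y' := (grayMap F' G').obj z)
      (p := (grayMap F G).map (p ≫ q)) (p' := (grayMap F' G').map (p ≫ q))
      ((grayMap F G).map_comp p q).symm _ _ _).trans ?_
    refine (congrArg _ (grayApp_comp (F := F) (F' := F') (G := G) (G' := G') (α.prod β)
      (x := x.as) (y := y.as) (z := z.as) p q)).trans ?_
    refine (Full.hcell_post (R := grayReal A' B') (x := (grayMap F G).obj x)
      (y := (grayMap F G).obj z) (x' := (grayMap F' G').obj x) (y' := (grayMap F' G').obj z)
      (p := (grayMap F G).map p ≫ (grayMap F G).map q)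
      (p' := (grayMap F' G').map p ≫ (grayMap F' G').map q)
      ((grayMap F' G').map_comp p q).symm _ _ _).symm.trans ?_
    exact congrArg (fun t => vcomp t (of (eqToHom _))) e.symm

/-- The action of the associativity isomorphism on 1-cells of the form `p ⊗ 1`. -/
def grayAssocLeft {C : Type*} [Bicategory C] [Strict C] (c : C) :
    Funny A B ⥤ Funny A (GrayTensor B C) :=
  Funny.liftFunctor (fun x => ⟨(x.1, (⟨⟨(x.2, c)⟩⟩ : GrayTensor B C))⟩)
    (fun f b => Funny.left f (⟨⟨(b, c)⟩⟩ : GrayTensor B C))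
    (fun a _ _ g => Funny.right a (grayLeft g c))
    (fun _ _ => Funny.left_id _ _) (fun _ _ _ => Funny.left_comp _ _ _)
    (fun a b => (congrArg (Funny.right a) (Funny.left_id b c)).trans (Funny.right_id a _))
    (fun a _ _ _ g g' =>
      (congrArg (Funny.right a) (Funny.left_comp g g' c)).trans (Funny.right_comp a _ _))

/-- The action of the associativity isomorphism on 1-cells:
`(f ⊗ 1) ⊗ 1 ↦ f ⊗ 1`, `(1 ⊗ g) ⊗ 1 ↦ 1 ⊗ (g ⊗ 1)` and `1 ⊗ h ↦ 1 ⊗ (1 ⊗ h)`. -/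
def grayAssoc₁ (A B C : Type*) [Bicategory A] [Strict A] [Bicategory B] [Strict B] [Bicategory C]
    [Strict C] : Funny (GrayTensor A B) C ⥤ Funny A (GrayTensor B C) :=
  Funny.liftFunctor (fun x => ⟨(x.1.as.as.1, (⟨⟨(x.1.as.as.2, x.2)⟩⟩ : GrayTensor B C))⟩)
    (fun {x y} p c => (grayAssocLeft c).map (X := x.as) (Y := y.as) p)
    (fun x _ _ h => Funny.right x.as.as.1 (grayRight x.as.as.2 h))
    (fun x c => (grayAssocLeft c).map_id x.as)
    (fun {x y z} p q c => (grayAssocLeft c).map_comp (X := x.as) (Y := y.as) (Z := z.as) p q)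
    (fun x c => (congrArg (Funny.right _) (Funny.right_id _ c)).trans (Funny.right_id _ _))
    (fun x _ _ _ h h' => (congrArg (Funny.right _) (Funny.right_comp _ h h')).trans
      (Funny.right_comp _ _ _))

section
variable (A B C : Type*) [Bicategory A] [Strict A] [Bicategory B] [Strict B] [Bicategory C]
    [Strict C]

theorem grayAssocLeft_word (c : C) {x y : A × B} (p : Word x y) :
    (prodStrict (StrictPseudofunctor.id A) (grayProj B C)).map ((grayReal A (GrayTensor B C)).map
      ((grayAssocLeft c).map (Funny.cls (x := ⟨x⟩) (y := ⟨y⟩) p))) =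
    (prodAssocStrict A B C).map (p.eval ×ₘ 𝟙 c) := by
  induction p with
  | id x => rfl
  | @comp x y z t r iht ihr =>
    refine (congrArg (prodStrict (StrictPseudofunctor.id A) (grayProj B C)).map (grayReal_comp
      ((grayAssocLeft c).map (Funny.cls (x := ⟨x⟩) (y := ⟨y⟩) t))
      ((grayAssocLeft c).map (Funny.cls (x := ⟨y⟩) (y := ⟨z⟩) r)))).trans ?_
    refine ((prodStrict (StrictPseudofunctor.id A) (grayProj B C)).map_comp _ _).trans ?_
    refine (congrArg₂ _ iht ihr).trans ?_
    exact Prod.ext rfl (Prod.ext rfl (Strict.id_comp (𝟙 c)))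
  | left f b => rfl
  | right a g => rfl

theorem grayAssocLeft_eq (c : C) {x y : Funny A B} (p : x ⟶ y) :
    (prodStrict (StrictPseudofunctor.id A) (grayProj B C)).map
      ((grayReal A (GrayTensor B C)).map ((grayAssocLeft c).map p)) =
    (prodAssocStrict A B C).map ((grayReal A B).map p ×ₘ 𝟙 c) := by
  obtain ⟨p⟩ := p
  exact grayAssocLeft_word A B C c p

theorem grayAssoc₁_word {x y : GrayTensor A B × C} (p : Word x y) :
    (prodStrict (StrictPseudofunctor.id A) (grayProj B C)).map ((grayReal A (GrayTensor B C)).map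
      ((grayAssoc₁ A B C).map (Funny.cls (x := ⟨x⟩) (y := ⟨y⟩) p))) =
    (prodAssocStrict A B C).map
      ((prodStrict (grayProj A B) (StrictPseudofunctor.id C)).map p.eval) := by
  induction p with
  | id x => rfl
  | @comp x y z t r iht ihr =>
    refine (congrArg (prodStrict (StrictPseudofunctor.id A) (grayProj B C)).map (grayReal_comp
      ((grayAssoc₁ A B C).map (Funny.cls (x := ⟨x⟩) (y := ⟨y⟩) t))
      ((grayAssoc₁ A B C).map (Funny.cls (x := ⟨y⟩) (y := ⟨z⟩) r)))).trans ?_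
    refine ((prodStrict (StrictPseudofunctor.id A) (grayProj B C)).map_comp _ _).trans ?_
    refine (congrArg₂ _ iht ihr).trans ?_
    refine Eq.trans ?_ (congrArg (prodAssocStrict A B C).map
      ((prodStrict (grayProj A B) (StrictPseudofunctor.id C)).map_comp t.eval r.eval)).symm
    exact ((prodAssocStrict A B C).map_comp _ _).symm
  | @left x y p c => exact grayAssocLeft_eq A B C c (x := x.as) (y := y.as) p
  | right x h => rfl

theorem grayAssoc₁_eq {x y : Funny (GrayTensor A B) C} (p : x ⟶ y) :
    (prodStrict (StrictPseudofunctor.id A) (grayProj B C)).map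
      ((grayReal A (GrayTensor B C)).map ((grayAssoc₁ A B C).map p)) =
    (prodAssocStrict A B C).map ((prodStrict (grayProj A B) (StrictPseudofunctor.id C)).map
      ((grayReal (GrayTensor A B) C).map p)) := by
  obtain ⟨p⟩ := p
  exact grayAssoc₁_word A B C p

/-- The associativity isomorphism of the Gray tensor product. -/
def grayAssoc : StrictPseudofunctor (GrayTensor (GrayTensor A B) C)
    (GrayTensor A (GrayTensor B C)) :=
  (grayLFF.comp (LFF.idProd A (grayLFF (A := B) (B := C)))).liftStrict
    (((grayProj (GrayTensor A B) C).comp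
      (prodStrict (grayProj A B) (StrictPseudofunctor.id C))).comp (prodAssocStrict A B C))
    (fun x => ⟨⟨(x.as.as.1.as.as.1, ⟨⟨(x.as.as.1.as.as.2, x.as.as.2)⟩⟩)⟩⟩)
    (fun {x y} p => (grayAssoc₁ A B C).map (X := x.as) (Y := y.as) p) (fun _ => rfl)
    (fun p => heq_of_eq (grayAssoc₁_eq A B C p)) (fun x => (grayAssoc₁ A B C).map_id x.as)
    (fun {x y z} p q => (grayAssoc₁ A B C).map_comp (X := x.as) (Y := y.as) (Z := z.as) p q)

end

end Gray

end

section
open HCell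

/-- The Gray tensor product of two 2-categories. -/
def grayObj (A B : GrayCat.{u}) : GrayCat.{u} := ⟨GrayTensor A B⟩

/-- The 2-category with one object, one 1-cell and one 2-cell. -/
def grayUnit : GrayCat.{u} := ⟨One.{u}⟩

/-- The associativity isomorphism of the Gray tensor product, for small 2-categories. -/
def grayAssocCat (A B C : GrayCat.{u}) : StrictPseudofunctor (GrayTensor (GrayTensor A B) C)
    (GrayTensor A (GrayTensor B C)) :=
  grayAssoc A B C

/-- The associativity isomorphism of the Gray tensor product, as a 1-cell. -/
def grayAssocHom (A B C : GrayCat.{u}) : grayObj (grayObj A B) C ⟶ grayObj A (grayObj B C) :=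
  grayAssocCat A B C

/-- The left unit isomorphism of the Gray tensor product. -/
def grayLeftUnitor (A : GrayCat.{u}) : grayObj grayUnit A ⟶ A :=
  (grayProj One A).comp (Bicategory.Prod.snd One A)

/-- The right unit isomorphism of the Gray tensor product. -/
def grayRightUnitor (A : GrayCat.{u}) : grayObj A grayUnit ⟶ A :=
  (grayProj A One).comp (Bicategory.Prod.fst A One)

/-- The Gray tensor product of two 1-cells. -/
def grayHom {A A' B B' : GrayCat.{u}} (F : A ⟶ A') (G : B ⟶ B') : grayObj A B ⟶ grayObj A' B' :=
  grayMap F G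

/-- The Gray tensor product of two 2-cells. -/
def grayHom₂ {A A' B B' : GrayCat.{u}} {F F' : A ⟶ A'} {G G' : B ⟶ B'} (α : F ⟶ F') (β : G ⟶ G') :
    grayHom F G ⟶ grayHom F' G' :=
  grayIcon α β

/-- The monoidal structure on the 2-category of 2-categories, 2-functors and icons given by the
Gray tensor product. -/
def grayMonoidal : MonoidalData GrayCat.{u} where
  tensor :=
    { obj x := grayObj x.1 x.2
      map f := grayHom f.1 f.2
      map₂ α := grayHom₂ α.1 α.2 }
  unit := grayUnit
  assoc A B C := grayAssocHom A B C
  leftUnitor A := grayLeftUnitor A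
  rightUnitor A := grayRightUnitor A

/-- The universal cubical functor, as a 1-cell of the 2-category of bicategories. -/
def cubHom (A B : GrayCat.{u}) :
    iconMonoidal.tensor.obj (incl.obj A, incl.obj B) ⟶ incl.obj (grayMonoidal.tensor.obj (A, B)) :=
  cub A B


/-- A pseudofunctor of two variables is cubical: it strictly preserves identities, and its
comparison 2-cell at a composable pair `p`, `q` is an identity whenever the second component of `p`
or the first component of `q` is an identity. -/
structure IsCubical {A : Type*} [Bicategory A] {B : Type*} [Bicategory B] {C : Type*}
    [Bicategory C] (H : (A × B) ⥤ᵖ C) : Prop where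
  mapId (x : A × B) : ∃ h : H.map (𝟙 x) = 𝟙 (H.obj x), H.mapId x = eqToIso h
  mapComp_left {a a' : A} (f : a ⟶ a') (b : B) {y : A × B} (q : (a', b) ⟶ y) :
    ∃ h : H.map ((f ×ₘ 𝟙 b) ≫ q) = H.map (f ×ₘ 𝟙 b) ≫ H.map q,
      H.mapComp (f ×ₘ 𝟙 b) q = eqToIso h
  mapComp_right {x : A × B} (a : A) {b b' : B} (p : x ⟶ (a, b)) (g : b ⟶ b') :
    ∃ h : H.map (p ≫ (𝟙 a ×ₘ g)) = H.map p ≫ H.map (𝟙 a ×ₘ g),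
      H.mapComp p (𝟙 a ×ₘ g) = eqToIso h

/-- The pseudofunctor `c` is a universal cubical functor out of `A × B`: composition with `c` is a
bijection between 2-functors `T ⟶ C` and cubical functors `A × B ⟶ C`, for every 2-category `C`. -/
structure IsUniversalCubical {A B T : GrayCat.{u}} (c : (A × B) ⥤ᵖ T) : Prop where
  cubical : IsCubical c
  universal (C : GrayCat.{u}) (H : (A × B) ⥤ᵖ C) (hH : IsCubical H) :
    ∃! K : StrictPseudofunctor T C, c.comp K.toPseudofunctor = H

end

end IconGray

/-!
Equalities between functors and icons are equalities on the nose, but two functors agree on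
objects only propositionally. They are therefore established by comparing actions on cells, and
constraints, up to heterogeneous equality (`pseudofunctor_hext`, `strict_hext`, `icon_heq`).

**Coherence of the Gray tensor product.** The projection `A ⊗ B → A × B` is locally fully faithful
by definition. Hence functors and icons with values in `A ⊗ B`, or in an iterated tensor product,
are equal as soon as they agree on 1-cells and after projection to the cartesian product
(`LFF.cancel`, `LFF.icon_heq`); and for 2-functors out of a tensor product the agreement on 1-cells
need only be checked on the generators `f ⊗ 1` and `1 ⊗ g` (`Funny.map_heq`). As the tensor product
of 2-functors and icons, the associativity isomorphism and `c` lie over their cartesian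
counterparts, the axioms of a strong monoidal structure for `⊗` and the lax monoidal axioms for `c`
follow from the evident ones for `×` (`grayMonoidal_isStronglyMonoidal`,
`incl_isCatLaxMonoidal`).

**Universality of `c`.** For a cubical functor `H : A × B → C`, consider the 2-category of 1-cells
`p` of `A × B` equipped with a 1-cell of `C` isomorphic to `H p`, with 2-cells those of `A × B`
(`Rectified`). It projects to `A × B`, and evaluates to `C` by conjugating the action of `H` with
the chosen isomorphisms. The 1-cells `(f, 1)` and `(1, g)` with their actual images under `H` are
functorial in `f` and in `g`, precisely because `H` is cubical; so they define a 2-functor out of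
`A ⊗ B`, and its composite with the evaluation is the extension of `H` (`cubExtend`). It is unique
because every 1-cell of `A ⊗ B` is isomorphic to one in the image of `c`, by an isomorphism built
from constraints of `c` (`map₂_toNormal_heq`, `cub_cancel`).

**The 2-adjunction.** In the same way, every string is isomorphic to a string of length one by
constraints of `η`, whence 2-functors and icons out of `st B` are determined by their restrictions
along `η` (`stIncl_cancel`, `stIncl_cancel_icon`). Since `η` is natural for the explicitly given
action of `st`, and `ε` satisfies one triangle identity, the remaining part of the 2-adjunction,
including the 2-functoriality of `st` and the 2-naturality of `ε`, is formal
(`UnitDetermines.isTwoAdjunction`).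

**The oplax structure.** This is doctrinal adjunction: the mates of a lax monoidal structure on a
right 2-adjoint form an oplax monoidal structure on the left 2-adjoint. Each oplax axiom is an
equality of 1-cells or 2-cells out of a value of `st`, so it may be checked on transposes, where it
becomes the corresponding lax axiom (`IsTwoAdjunction.isCatOplaxMonoidal`).
-/

namespace IconGray

open HCell

/-! ### Heterogeneous equality of functors, icons and 2-cells -/

section Toolkit

variable {B : Type*} [Bicategory B] {C : Type*} [Bicategory C] {D : Type*} [Bicategory D]

theorem eqToHom_comp_heq₂ {a b : C} {f g h : a ⟶ b} (e : f = g) (η : g ⟶ h) :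
    HEq (eqToHom e ≫ η) η := by
  subst e; simp

theorem comp_eqToHom_heq₂ {a b : C} {f g h : a ⟶ b} (η : f ⟶ g) (e : g = h) :
    HEq (η ≫ eqToHom e) η := by
  subst e; simp

/-- Converse to `conj_heq`. -/
theorem eq_conj_of_heq {a b : C} {p p' q q' : a ⟶ b} {η : p ⟶ q} {θ : p' ⟶ q'} (h : p = p')
    (h' : q' = q) (e : HEq η θ) : η = eqToHom h ≫ θ ≫ eqToHom h' :=
  eq_of_heq (e.trans (conj_heq _ _ _).symm)

theorem eqToHom_heq_eqToHom₂ {a b a' b' : C} (ha : a = a') (hb : b = b') {p q : a ⟶ b}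
    {p' q' : a' ⟶ b'} (h : p = q) (h' : p' = q') (e : HEq p p') :
    HEq (eqToHom h) (eqToHom h') := by
  subst ha hb; cases e; subst h h'; rfl

theorem prelaxFunctor_hext {F G : PrelaxFunctor B C} (hobj : ∀ a, F.obj a = G.obj a)
    (hmap : ∀ {a b : B} (f : a ⟶ b), HEq (F.map f) (G.map f))
    (hmap₂ : ∀ {a b : B} {f g : a ⟶ b} (η : f ⟶ g), HEq (F.map₂ η) (G.map₂ η)) : F = G := by
  obtain ⟨⟨⟨Fo, Fm⟩, F₂⟩, hF, hF'⟩ := F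
  obtain ⟨⟨⟨Go, Gm⟩, G₂⟩, hG, hG'⟩ := G
  obtain rfl : Fo = Go := funext hobj
  obtain rfl : @Fm = @Gm := by
    funext a b f; exact eq_of_heq (hmap f)
  obtain rfl : @F₂ = @G₂ := by
    funext a b f g η; exact eq_of_heq (hmap₂ η)
  rfl

/-- Two pseudofunctors with the same action on cells and the same constraints are equal. The
hypotheses are heterogeneous since values on objects agree only propositionally; this is the form
in which equality of functors is established throughout. -/
theorem pseudofunctor_hext {F G : B ⥤ᵖ C} (hobj : ∀ a, F.obj a = G.obj a)
    (hmap : ∀ {a b : B} (f : a ⟶ b), HEq (F.map f) (G.map f))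
    (hmap₂ : ∀ {a b : B} {f g : a ⟶ b} (η : f ⟶ g), HEq (F.map₂ η) (G.map₂ η))
    (hid : ∀ a, HEq (F.mapId a).inv (G.mapId a).inv)
    (hcomp : ∀ {a b c : B} (f : a ⟶ b) (g : b ⟶ c),
      HEq (F.mapComp f g).inv (G.mapComp f g).inv) : F = G :=
  pseudofunctor_ext (prelaxFunctor_hext hobj hmap hmap₂) hid hcomp

theorem strict_mapId_inv_heq (F : StrictPseudofunctor B C) (a : B) :
    HEq (F.mapId a).inv (𝟙 (𝟙 (F.obj a))) := by
  rw [F.mapId_eq_eqToIso]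
  exact eqToHom₂_heq (F.map_id a).symm

theorem strict_mapComp_inv_heq (F : StrictPseudofunctor B C) {a b c : B} (f : a ⟶ b) (g : b ⟶ c) :
    HEq (F.mapComp f g).inv (𝟙 (F.map f ≫ F.map g)) := by
  rw [F.mapComp_eq_eqToIso]
  exact eqToHom₂_heq (F.map_comp f g).symm

/-- Two 2-functors with the same action on cells are equal: their constraints are identities. -/
theorem strict_hext {F G : StrictPseudofunctor B C} (hobj : ∀ a, F.obj a = G.obj a)
    (hmap : ∀ {a b : B} (f : a ⟶ b), HEq (F.map f) (G.map f))
    (hmap₂ : ∀ {a b : B} {f g : a ⟶ b} (η : f ⟶ g), HEq (F.map₂ η) (G.map₂ η)) : F = G := by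
  refine strictPseudofunctor_ext (pseudofunctor_hext hobj hmap hmap₂ (fun a => ?_) (fun f g => ?_))
  · exact (strict_mapId_inv_heq F a).trans ((id₂_heq (hobj a) (hobj a) (id₁_heq (hobj a))).trans
      (strict_mapId_inv_heq G a).symm)
  · exact (strict_mapComp_inv_heq F f g).trans ((id₂_heq (hobj _) (hobj _)
      (comp₁_heq (hobj _) (hobj _) (hobj _) (hmap f) (hmap g))).trans
      (strict_mapComp_inv_heq G f g).symm)

theorem comp_strict_mapId_heq (F : B ⥤ᵖ C) (G : StrictPseudofunctor C D) (a : B) :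
    HEq ((F.comp G.toPseudofunctor).mapId a).inv (G.map₂ (F.mapId a).inv) := by
  change HEq ((G.mapId (F.obj a)).inv ≫ G.map₂ (F.mapId a).inv) _
  rw [G.mapId_eq_eqToIso]
  exact eqToHom_comp_heq₂ (G.map_id _).symm _

theorem comp_strict_mapComp_heq (F : B ⥤ᵖ C) (G : StrictPseudofunctor C D) {a b c : B}
    (f : a ⟶ b) (g : b ⟶ c) :
    HEq ((F.comp G.toPseudofunctor).mapComp f g).inv (G.map₂ (F.mapComp f g).inv) := by
  change HEq ((G.mapComp _ _).inv ≫ G.map₂ (F.mapComp f g).inv) _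
  rw [G.mapComp_eq_eqToIso]
  exact eqToHom_comp_heq₂ (G.map_comp _ _).symm _

theorem strict_comp_mapId_heq (F : StrictPseudofunctor B C) (G : C ⥤ᵖ D) (a : B) :
    HEq ((F.toPseudofunctor.comp G).mapId a).inv (G.mapId (F.obj a)).inv := by
  change HEq ((G.mapId (F.obj a)).inv ≫ G.map₂ (F.mapId a).inv) _
  rw [F.mapId_eq_eqToIso, eqToIso.inv, PrelaxFunctor.map₂_eqToHom]
  exact comp_eqToHom_heq₂ _ _

theorem strict_comp_mapComp_heq (F : StrictPseudofunctor B C) (G : C ⥤ᵖ D) {a b c : B}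
    (f : a ⟶ b) (g : b ⟶ c) :
    HEq ((F.toPseudofunctor.comp G).mapComp f g).inv (G.mapComp (F.map f) (F.map g)).inv := by
  change HEq ((G.mapComp _ _).inv ≫ G.map₂ (F.mapComp f g).inv) _
  rw [F.mapComp_eq_eqToIso, eqToIso.inv, PrelaxFunctor.map₂_eqToHom]
  exact comp_eqToHom_heq₂ _ _

theorem icon_heq {F G F' G' : B ⥤ᵖ C} (hF : F = F') (hG : G = G') {α : Icon F G}
    {β : Icon F' G'} (h : ∀ {a b : B} (f : a ⟶ b), HEq (α.app f) (β.app f)) : HEq α β := by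
  subst hF hG
  refine heq_of_eq (Icon.ext ?_)
  funext a b f
  exact eq_of_heq (h f)

namespace HCell

theorem map_heq (F : C ⥤ᵖ D) {a b c d a' b' c' d' : C} (ha : a = a') (hb : b = b') (hc : c = c')
    (hd : d = d') {f : a ⟶ b} {g : c ⟶ d} {f' : a' ⟶ b'} {g' : c' ⟶ d'} (hf : HEq f f')
    (hg : HEq g g') {x : HCell f g} {x' : HCell f' g'} (h : HEq x x') :
    HEq (map F x) (map F x') := by
  subst ha hb hc hd; cases hf; cases hg; cases h; rfl

end HCell

variable {F G : PrelaxFunctorStruct B C}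

theorem IsTwoNatural.of_heq {η : ∀ a, F.obj a ⟶ G.obj a}
    (naturality : ∀ {a b : B} (f : a ⟶ b), F.map f ≫ η b = η a ≫ G.map f)
    (h : ∀ {a b : B} {f g : a ⟶ b} (α : f ⟶ g), HEq (F.map₂ α ▷ η b) (η a ◁ G.map₂ α)) :
    IsTwoNatural F G η :=
  ⟨naturality, fun α => eq_conj_of_heq _ _ (h α)⟩

theorem IsTwoNatural.heq {η : ∀ a, F.obj a ⟶ G.obj a} (h : IsTwoNatural F G η) {a b : B}
    {f g : a ⟶ b} (α : f ⟶ g) : HEq (F.map₂ α ▷ η b) (η a ◁ G.map₂ α) := by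
  rw [h.naturality₂]
  exact conj_heq _ _ _

/-- A strict action on cells is a 2-functor; the compatibility with whiskering is heterogeneous
because both sides have 1-cells which agree only by functoriality. -/
theorem IsTwoFunctor.of_heq [Strict B] [Strict C] (F : PrelaxFunctorStruct B C)
    (map_id : ∀ a, F.map (𝟙 a) = 𝟙 (F.obj a))
    (map_comp : ∀ {a b c : B} (f : a ⟶ b) (g : b ⟶ c), F.map (f ≫ g) = F.map f ≫ F.map g)
    (map₂_id : ∀ {a b : B} (f : a ⟶ b), F.map₂ (𝟙 f) = 𝟙 (F.map f))
    (map₂_comp : ∀ {a b : B} {f g h : a ⟶ b} (η : f ⟶ g) (θ : g ⟶ h),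
      F.map₂ (η ≫ θ) = F.map₂ η ≫ F.map₂ θ)
    (wl : ∀ {a b c : B} (f : a ⟶ b) {g h : b ⟶ c} (η : g ⟶ h),
      HEq (F.map₂ (f ◁ η)) (F.map f ◁ F.map₂ η))
    (wr : ∀ {a b c : B} {f g : a ⟶ b} (η : f ⟶ g) (h : b ⟶ c),
      HEq (F.map₂ (η ▷ h)) (F.map₂ η ▷ F.map h)) : IsTwoFunctor F :=
  ⟨.mk''
    { toPrelaxFunctorStruct := F
      map₂_id := map₂_id
      map₂_comp := map₂_comp
      map_id := map_id
      map_comp := map_comp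
      map₂_whisker_left f _ _ η := eq_conj_of_heq _ _ (wl f η)
      map₂_whisker_right η f := eq_conj_of_heq _ _ (wr η f) }, rfl⟩

theorem IsTwoFunctor.map_id (h : IsTwoFunctor F) (a : B) : F.map (𝟙 a) = 𝟙 (F.obj a) := by
  obtain ⟨P, rfl⟩ := h
  exact P.map_id a

theorem IsTwoFunctor.map_comp (h : IsTwoFunctor F) {a b c : B} (f : a ⟶ b) (g : b ⟶ c) :
    F.map (f ≫ g) = F.map f ≫ F.map g := by
  obtain ⟨P, rfl⟩ := h
  exact P.map_comp f g

theorem IsTwoFunctor.wl_heq (h : IsTwoFunctor F) {a b c : B} (f : a ⟶ b) {g k : b ⟶ c}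
    (η : g ⟶ k) : HEq (F.map₂ (f ◁ η)) (F.map f ◁ F.map₂ η) := by
  obtain ⟨P, rfl⟩ := h
  exact (heq_of_eq (strict_wl P f η)).trans (conj_heq _ _ _)

theorem IsTwoFunctor.wr_heq (h : IsTwoFunctor F) {a b c : B} {f g : a ⟶ b} (η : f ⟶ g)
    (k : b ⟶ c) : HEq (F.map₂ (η ▷ k)) (F.map₂ η ▷ F.map k) := by
  obtain ⟨P, rfl⟩ := h
  exact (heq_of_eq (strict_wr P η k)).trans (conj_heq _ _ _)

end Toolkit

/-! ### The cartesian monoidal structure -/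

section Cartesian

theorem prodMap_comp {A A' A'' B B' B'' : Type*} [Bicategory A] [Bicategory A'] [Bicategory A'']
    [Bicategory B] [Bicategory B'] [Bicategory B''] (F : A ⥤ᵖ A') (F' : A' ⥤ᵖ A'') (G : B ⥤ᵖ B')
    (G' : B' ⥤ᵖ B'') :
    prodMap (F.comp F') (G.comp G') = (prodMap F G).comp (prodMap F' G') :=
  rfl

theorem prodMap_id (A B : Type*) [Bicategory A] [Bicategory B] :
    prodMap (Pseudofunctor.id A) (Pseudofunctor.id B) = Pseudofunctor.id (A × B) :=
  rfl

variable {A A' B B' C C' : Type*} [Bicategory A] [Bicategory A'] [Bicategory B] [Bicategory B']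
  [Bicategory C] [Bicategory C']

theorem prodAssoc_natural (F : A ⥤ᵖ A') (G : B ⥤ᵖ B') (H : C ⥤ᵖ C') :
    (prodMap (prodMap F G) H).comp (prodAssoc A' B' C') =
      (prodAssoc A B C).comp (prodMap F (prodMap G H)) :=
  pseudofunctor_hext (fun _ => rfl) (fun _ => HEq.rfl) (fun _ => HEq.rfl)
    (fun a => (comp_strict_mapId_heq (prodMap (prodMap F G) H) (prodAssocStrict A' B' C') a).trans
      (strict_comp_mapId_heq (prodAssocStrict A B C) (prodMap F (prodMap G H)) a).symm)
    (fun f g =>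
      (comp_strict_mapComp_heq (prodMap (prodMap F G) H) (prodAssocStrict A' B' C') f g).trans
      (strict_comp_mapComp_heq (prodAssocStrict A B C) (prodMap F (prodMap G H)) f g).symm)

theorem HCell.map_prodAssoc {a b a' b' : A} {f : a ⟶ b} {f' : a' ⟶ b'} {c d c' d' : B} {g : c ⟶ d}
    {g' : c' ⟶ d'} {k l k' l' : C} {h : k ⟶ l} {h' : k' ⟶ l'} (x : HCell f f') (y : HCell g g')
    (z : HCell h h') : HCell.map (prodAssoc A B C) ((x.prod y).prod z) = x.prod (y.prod z) := by
  obtain rfl := x.src; obtain rfl := x.tgt; obtain rfl := y.src; obtain rfl := y.tgt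
  obtain rfl := z.src; obtain rfl := z.tgt
  rfl

theorem HCell.map_prodMap {D D' : Type*} [Bicategory D] [Bicategory D'] (F : A ⥤ᵖ D)
    (G : B ⥤ᵖ D') {a b a' b' : A} {f : a ⟶ b} {f' : a' ⟶ b'} {c d c' d' : B} {g : c ⟶ d}
    {g' : c' ⟶ d'} (x : HCell f f') (y : HCell g g') :
    HCell.map (prodMap F G) (x.prod y) = (HCell.map F x).prod (HCell.map G y) := by
  obtain rfl := x.src; obtain rfl := x.tgt; obtain rfl := y.src; obtain rfl := y.tgt
  rfl

theorem HCell.map_prodSnd {a b a' b' : A} {f : a ⟶ b} {f' : a' ⟶ b'} {c d c' d' : B} {g : c ⟶ d}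
    {g' : c' ⟶ d'} (x : HCell f f') (y : HCell g g') : HCell.map (prodSnd A B) (x.prod y) = y := by
  obtain rfl := x.src; obtain rfl := x.tgt; obtain rfl := y.src; obtain rfl := y.tgt
  rfl

theorem HCell.map_prodFst {a b a' b' : A} {f : a ⟶ b} {f' : a' ⟶ b'} {c d c' d' : B} {g : c ⟶ d}
    {g' : c' ⟶ d'} (x : HCell f f') (y : HCell g g') : HCell.map (prodFst A B) (x.prod y) = x := by
  obtain rfl := x.src; obtain rfl := x.tgt; obtain rfl := y.src; obtain rfl := y.tgt
  rfl

theorem prodSnd_natural (F : A ⥤ᵖ A') (G : B ⥤ᵖ B') :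
    (prodMap F G).comp (prodSnd A' B') = (prodSnd A B).comp G :=
  pseudofunctor_hext (fun _ => rfl) (fun _ => HEq.rfl) (fun _ => HEq.rfl)
    (fun a => (comp_strict_mapId_heq (prodMap F G) (Bicategory.Prod.snd A' B') a).trans
      (strict_comp_mapId_heq (Bicategory.Prod.snd A B) G a).symm)
    (fun f g => (comp_strict_mapComp_heq (prodMap F G) (Bicategory.Prod.snd A' B') f g).trans
      (strict_comp_mapComp_heq (Bicategory.Prod.snd A B) G f g).symm)

theorem prodFst_natural (F : A ⥤ᵖ A') (G : B ⥤ᵖ B') :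
    (prodMap F G).comp (prodFst A' B') = (prodFst A B).comp F :=
  pseudofunctor_hext (fun _ => rfl) (fun _ => HEq.rfl) (fun _ => HEq.rfl)
    (fun a => (comp_strict_mapId_heq (prodMap F G) (Bicategory.Prod.fst A' B') a).trans
      (strict_comp_mapId_heq (Bicategory.Prod.fst A B) F a).symm)
    (fun f g => (comp_strict_mapComp_heq (prodMap F G) (Bicategory.Prod.fst A' B') f g).trans
      (strict_comp_mapComp_heq (Bicategory.Prod.fst A B) F f g).symm)

theorem iconMonoidal_tensor_functor : IsTwoFunctor iconMonoidal.{u}.tensor := by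
  refine .of_heq _ (fun _ => rfl) (fun _ _ => rfl) (fun _ => ?_) ?_ ?_ ?_
  · rfl
  · intro a b f g h η θ
    exact IconCat.hom₂_ext fun _ => HCell.prod_vcomp _ _ _ _
  · intro a b c f g h η
    refine heq_of_eq (IconCat.hom₂_ext ?_)
    intro x y k
    rfl
  · intro a b c f g η h
    refine heq_of_eq (IconCat.hom₂_ext ?_)
    intro x y k
    exact (HCell.map_prodMap h.1 h.2 (Icon.app η.1 k.1) (Icon.app η.2 k.2)).symm

/-- The inverse of the associativity isomorphism of the product. -/
def prodAssocInv (A B C : Type*) [Bicategory A] [Bicategory B] [Bicategory C] :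
    StrictPseudofunctor (A × (B × C)) ((A × B) × C) where
  obj x := ((x.1, x.2.1), x.2.2)
  map f := (f.1 ×ₘ f.2.1) ×ₘ f.2.2
  map₂ η := (η.1 ×ₘ η.2.1) ×ₘ η.2.2
  mapId _ := Iso.refl _
  mapComp _ _ := Iso.refl _

/-- The inverse of the left unit isomorphism of the product. -/
def prodLeftUnitorInv (A : Type u) [Bicategory.{u, u} A] : StrictPseudofunctor A (One.{u} × A) where
  obj a := (⟨⟨⟨⟩⟩⟩, a)
  map f := 𝟙 _ ×ₘ f
  map₂ η := 𝟙 _ ×ₘ η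
  mapId _ := Iso.refl _
  mapComp _ _ := Iso.refl _

/-- The inverse of the right unit isomorphism of the product. -/
def prodRightUnitorInv (A : Type u) [Bicategory.{u, u} A] :
    StrictPseudofunctor A (A × One.{u}) where
  obj a := (a, ⟨⟨⟨⟩⟩⟩)
  map f := f ×ₘ 𝟙 _
  map₂ η := η ×ₘ 𝟙 _
  mapId _ := Iso.refl _
  mapComp _ _ := Iso.refl _

theorem prodAssoc_pentagon (A B C D : Type*) [Bicategory A] [Bicategory B] [Bicategory C]
    [Bicategory D] :
    (prodStrict (prodAssocStrict A B C) (.id D)).comp ((prodAssocStrict A (B × C) D).comp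
      (prodStrict (.id A) (prodAssocStrict B C D))) =
    (prodAssocStrict (A × B) C D).comp (prodAssocStrict A B (C × D)) :=
  strict_hext (fun _ => rfl) (fun _ => HEq.rfl) (fun _ => HEq.rfl)

theorem prodAssoc_triangle (A B : Type u) [Bicategory.{u, u} A] [Bicategory.{u, u} B] :
    (prodAssocStrict A One.{u} B).comp (prodStrict (.id A) (Bicategory.Prod.snd One B)) =
      prodStrict (Bicategory.Prod.fst A One) (.id B) :=
  strict_hext (fun _ => rfl) (fun _ => HEq.rfl) (fun _ => HEq.rfl)

theorem prodAssoc_comp_inv (A B C : Type*) [Bicategory A] [Bicategory B] [Bicategory C] :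
    (prodAssocStrict A B C).comp (prodAssocInv A B C) = .id _ :=
  strict_hext (fun _ => rfl) (fun _ => HEq.rfl) (fun _ => HEq.rfl)

theorem prodAssocInv_comp (A B C : Type*) [Bicategory A] [Bicategory B] [Bicategory C] :
    (prodAssocInv A B C).comp (prodAssocStrict A B C) = .id _ :=
  strict_hext (fun _ => rfl) (fun _ => HEq.rfl) (fun _ => HEq.rfl)

theorem prodSnd_comp_inv (A : Type u) [Bicategory.{u, u} A] :
    (Bicategory.Prod.snd One.{u} A).comp (prodLeftUnitorInv A) = .id _ :=
  strict_hext (fun _ => rfl) (fun _ => HEq.rfl) (fun _ => HEq.rfl)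

theorem prodFst_comp_inv (A : Type u) [Bicategory.{u, u} A] :
    (Bicategory.Prod.fst A One.{u}).comp (prodRightUnitorInv A) = .id _ :=
  strict_hext (fun _ => rfl) (fun _ => HEq.rfl) (fun _ => HEq.rfl)

theorem prodLeftUnitorInv_comp (A : Type u) [Bicategory.{u, u} A] :
    (prodLeftUnitorInv A).comp (Bicategory.Prod.snd One.{u} A) = .id _ :=
  strict_hext (fun _ => rfl) (fun _ => HEq.rfl) (fun _ => HEq.rfl)

theorem prodRightUnitorInv_comp (A : Type u) [Bicategory.{u, u} A] :
    (prodRightUnitorInv A).comp (Bicategory.Prod.fst A One.{u}) = .id _ :=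
  strict_hext (fun _ => rfl) (fun _ => HEq.rfl) (fun _ => HEq.rfl)

theorem congr_toPs {B C : Type*} [Bicategory B] [Bicategory C] {F G : StrictPseudofunctor B C}
    (h : F = G) : F.toPseudofunctor = G.toPseudofunctor := h ▸ rfl

theorem iconMonoidal_assoc_natural : IsTwoNatural
    ((prodStruct iconMonoidal.{u}.tensor (.id IconCat)).comp iconMonoidal.tensor)
    ((prodAssoc IconCat IconCat IconCat).toPrelaxFunctorStruct.comp
      ((prodStruct (.id IconCat) iconMonoidal.tensor).comp iconMonoidal.tensor))
    (fun x => iconMonoidal.assoc x.1.1 x.1.2 x.2) := by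
  refine .of_heq (fun f => prodAssoc_natural f.1.1 f.1.2 f.2) ?_
  intro a b f g α
  refine icon_heq (prodAssoc_natural f.1.1 f.1.2 f.2) (prodAssoc_natural g.1.1 g.1.2 g.2) ?_
  intro x y k
  exact heq_of_eq (HCell.map_prodAssoc (Icon.app α.1.1 k.1.1) (Icon.app α.1.2 k.1.2)
    (Icon.app α.2 k.2))

theorem iconMonoidal_leftUnitor_natural : IsTwoNatural
    { obj a := iconMonoidal.{u}.tensor.obj (iconMonoidal.unit, a)
      map f := iconMonoidal.hom (𝟙 iconMonoidal.unit) f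
      map₂ η := iconMonoidal.tensor.map₂ (𝟙 (𝟙 iconMonoidal.unit) ×ₘ η) } (.id IconCat)
    iconMonoidal.leftUnitor := by
  refine .of_heq (fun f => prodSnd_natural (Pseudofunctor.id One) f) ?_
  intro a b f g α
  refine icon_heq (prodSnd_natural (Pseudofunctor.id One) f)
    (prodSnd_natural (Pseudofunctor.id One) g) ?_
  intro x y k
  exact heq_of_eq (HCell.map_prodSnd (Icon.app (Icon.id (Pseudofunctor.id One)) k.1)
    (Icon.app α k.2))

theorem iconMonoidal_rightUnitor_natural : IsTwoNatural
    { obj a := iconMonoidal.{u}.tensor.obj (a, iconMonoidal.unit)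
      map f := iconMonoidal.hom f (𝟙 iconMonoidal.unit)
      map₂ η := iconMonoidal.tensor.map₂ (η ×ₘ 𝟙 (𝟙 iconMonoidal.unit)) } (.id IconCat)
    iconMonoidal.rightUnitor := by
  refine .of_heq (fun f => prodFst_natural f (Pseudofunctor.id One)) ?_
  intro a b f g α
  refine icon_heq (prodFst_natural f (Pseudofunctor.id One))
    (prodFst_natural g (Pseudofunctor.id One)) ?_
  intro x y k
  exact heq_of_eq (HCell.map_prodFst (Icon.app α k.1)
    (Icon.app (Icon.id (Pseudofunctor.id One)) k.2))

theorem iconMonoidal_pentagon (A B C D : IconCat.{u}) :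
    iconMonoidal.hom (iconMonoidal.assoc A B C) (𝟙 D) ≫
      iconMonoidal.assoc A (iconMonoidal.tensor.obj (B, C)) D ≫
      iconMonoidal.hom (𝟙 A) (iconMonoidal.assoc B C D) =
    iconMonoidal.assoc (iconMonoidal.tensor.obj (A, B)) C D ≫
      iconMonoidal.assoc A B (iconMonoidal.tensor.obj (C, D)) :=
  congr_toPs (prodAssoc_pentagon A B C D)

theorem iconMonoidal_triangle (A B : IconCat.{u}) :
    iconMonoidal.assoc A iconMonoidal.unit B ≫
      iconMonoidal.hom (𝟙 A) (iconMonoidal.leftUnitor B) =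
    iconMonoidal.hom (iconMonoidal.rightUnitor A) (𝟙 B) :=
  congr_toPs (prodAssoc_triangle A B)

theorem iconMonoidal_isStronglyMonoidal : IsStronglyMonoidal iconMonoidal.{u} where
  tensor_functor := iconMonoidal_tensor_functor
  assoc_natural := iconMonoidal_assoc_natural
  assoc_invertible A B C := ⟨(prodAssocInv A B C).toPseudofunctor,
    congr_toPs (prodAssoc_comp_inv A B C), congr_toPs (prodAssocInv_comp A B C)⟩
  leftUnitor_natural := iconMonoidal_leftUnitor_natural
  leftUnitor_invertible A := ⟨(prodLeftUnitorInv A).toPseudofunctor,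
    congr_toPs (prodSnd_comp_inv A), congr_toPs (prodLeftUnitorInv_comp A)⟩
  rightUnitor_natural := iconMonoidal_rightUnitor_natural
  rightUnitor_invertible A := ⟨(prodRightUnitorInv A).toPseudofunctor,
    congr_toPs (prodFst_comp_inv A), congr_toPs (prodRightUnitorInv_comp A)⟩
  pentagon := iconMonoidal_pentagon
  triangle := iconMonoidal_triangle

end Cartesian

/-! ### Cancelling locally fully faithful 2-functors -/

section Cancel

variable {C : Type*} [Bicategory C] {D : Type*} [Bicategory D] {S : Type*} [Bicategory S]
  {E : StrictPseudofunctor D S}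

/-- A locally fully faithful 2-functor reflects equality of 2-cells, also between 1-cells which are
only known to be equal. -/
theorem LFF.heq (L : LFF E) {x y x' y' : D} (hx : x = x') (hy : y = y') {p q : x ⟶ y}
    {p' q' : x' ⟶ y'} (hp : HEq p p') (hq : HEq q q') {η : p ⟶ q} {η' : p' ⟶ q'}
    (h : HEq (E.map₂ η) (E.map₂ η')) : HEq η η' := by
  subst hx hy; cases hp; cases hq
  exact heq_of_eq (L.ext (eq_of_heq h))

theorem pseudofunctor_obj_congr {F G : C ⥤ᵖ D} (h : F = G) (x : C) : F.obj x = G.obj x := h ▸ rfl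

theorem pseudofunctor_map_congr {F G : C ⥤ᵖ D} (h : F = G) {x y : C} (f : x ⟶ y) :
    HEq (F.map f) (G.map f) := h ▸ HEq.rfl

theorem pseudofunctor_map₂_congr {F G : C ⥤ᵖ D} (h : F = G) {x y : C} {f g : x ⟶ y} (η : f ⟶ g) :
    HEq (F.map₂ η) (G.map₂ η) := h ▸ HEq.rfl

theorem pseudofunctor_mapId_congr {F G : C ⥤ᵖ D} (h : F = G) (x : C) :
    HEq (F.mapId x).inv (G.mapId x).inv := h ▸ HEq.rfl

theorem pseudofunctor_mapComp_congr {F G : C ⥤ᵖ D} (h : F = G) {x y z : C} (f : x ⟶ y)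
    (g : y ⟶ z) : HEq (F.mapComp f g).inv (G.mapComp f g).inv := h ▸ HEq.rfl

theorem hcell_map_congr {F G : C ⥤ᵖ D} (h : F = G) {a b a' b' : C} {f : a ⟶ b} {g : a' ⟶ b'}
    (x : HCell f g) : HEq (HCell.map F x) (HCell.map G x) := h ▸ HEq.rfl

/-- Pseudofunctors which agree on 1-cells and after composition with a locally fully faithful
2-functor are equal. -/
theorem LFF.cancel (L : LFF E) {F G : C ⥤ᵖ D}
    (h : F.comp E.toPseudofunctor = G.comp E.toPseudofunctor)
    (hobj : ∀ x, F.obj x = G.obj x) (hmap : ∀ {x y : C} (f : x ⟶ y), HEq (F.map f) (G.map f)) :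
    F = G := by
  refine pseudofunctor_hext hobj hmap (fun η => ?_) (fun a => ?_) (fun f g => ?_)
  · exact L.heq (hobj _) (hobj _) (hmap _) (hmap _) (pseudofunctor_map₂_congr h η)
  · refine L.heq (hobj _) (hobj _) (id₁_heq (hobj a)) (hmap _) ?_
    exact (comp_strict_mapId_heq F E a).symm.trans
      ((pseudofunctor_mapId_congr h a).trans (comp_strict_mapId_heq G E a))
  · refine L.heq (hobj _) (hobj _) (comp₁_heq (hobj _) (hobj _) (hobj _) (hmap f) (hmap g))
      (hmap _) ?_
    exact (comp_strict_mapComp_heq F E f g).symm.trans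
      ((pseudofunctor_mapComp_congr h f g).trans (comp_strict_mapComp_heq G E f g))

theorem LFF.cancel_strict (L : LFF E) {F G : StrictPseudofunctor C D} (h : F.comp E = G.comp E)
    (hobj : ∀ x, F.obj x = G.obj x) (hmap : ∀ {x y : C} (f : x ⟶ y), HEq (F.map f) (G.map f)) :
    F = G :=
  strictPseudofunctor_ext (L.cancel (congr_toPs h) hobj hmap)

/-- A locally fully faithful 2-functor is injective on 2-cells between 1-cells with propositionally
equal end points. -/
theorem LFF.hcell_heq (L : LFF E) {a b c d a' b' c' d' : D} (ha : a = a') (hb : b = b')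
    (hc : c = c') (hd : d = d') {f : a ⟶ b} {g : c ⟶ d} {f' : a' ⟶ b'} {g' : c' ⟶ d'}
    (hf : HEq f f') (hg : HEq g g') {x : HCell f g} {x' : HCell f' g'}
    (h : HEq (HCell.map E.toPseudofunctor x) (HCell.map E.toPseudofunctor x')) : HEq x x' := by
  subst ha hb hc hd; cases hf; cases hg
  obtain rfl := x.src; obtain rfl := x.tgt
  obtain ⟨η, rfl⟩ := exists_of x
  obtain ⟨θ, rfl⟩ := exists_of x'
  exact heq_of_eq (congrArg of (L.ext (of_inj (eq_of_heq h))))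

/-- Icons which agree after whiskering with a locally fully faithful 2-functor are equal. -/
theorem LFF.icon_heq (L : LFF E) {F G F' G' : C ⥤ᵖ D} (hF : F = F') (hG : G = G') {α : Icon F G}
    {β : Icon F' G'} (h : ∀ {a b : C} (f : a ⟶ b), HEq (HCell.map E.toPseudofunctor (α.app f))
      (HCell.map E.toPseudofunctor (β.app f))) : HEq α β := by
  subst hF hG
  exact IconGray.icon_heq rfl rfl fun f =>
    L.hcell_heq rfl rfl rfl rfl HEq.rfl HEq.rfl (h f)

/-- Lifting a 2-functor along a locally fully faithful one, given the action on 1-cells, does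
produce a factorization. -/
theorem LFF.liftStrict_comp [Strict C] [Strict D] (L : LFF E) (G : StrictPseudofunctor C S)
    (obj : C → D) (map : ∀ {x y : C}, (x ⟶ y) → (obj x ⟶ obj y))
    (hobj : ∀ x, E.obj (obj x) = G.obj x)
    (hmap : ∀ {x y : C} (p : x ⟶ y), HEq (E.map (map p)) (G.map p))
    (map_id : ∀ x, map (𝟙 x) = 𝟙 (obj x))
    (map_comp : ∀ {x y z : C} (p : x ⟶ y) (q : y ⟶ z), map (p ≫ q) = map p ≫ map q) :
    (L.liftStrict G obj map hobj hmap map_id map_comp).comp E = G :=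
  strict_hext hobj hmap (fun η => L.map_lift₂ G obj map hobj hmap η)

end Cancel

section StrictComp

variable {A B C D : Type*} [Bicategory A] [Bicategory B] [Bicategory C] [Bicategory D]

theorem strict_assoc (F : StrictPseudofunctor A B) (G : StrictPseudofunctor B C)
    (H : StrictPseudofunctor C D) : (F.comp G).comp H = F.comp (G.comp H) :=
  strict_hext (fun _ => rfl) (fun _ => HEq.rfl) (fun _ => HEq.rfl)

theorem strict_id_comp (F : StrictPseudofunctor A B) :
    (StrictPseudofunctor.id A).comp F = F :=
  strict_hext (fun _ => rfl) (fun _ => HEq.rfl) (fun _ => HEq.rfl)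

theorem strict_comp_id (F : StrictPseudofunctor A B) :
    F.comp (StrictPseudofunctor.id B) = F :=
  strict_hext (fun _ => rfl) (fun _ => HEq.rfl) (fun _ => HEq.rfl)

theorem prodStrict_comp {A' B' C' : Type*} [Bicategory A'] [Bicategory B'] [Bicategory C']
    (F : StrictPseudofunctor A B) (G : StrictPseudofunctor B C) (F' : StrictPseudofunctor A' B')
    (G' : StrictPseudofunctor B' C') :
    (prodStrict F F').comp (prodStrict G G') = prodStrict (F.comp G) (F'.comp G') :=
  strict_hext (fun _ => rfl) (fun _ => HEq.rfl) (fun _ => HEq.rfl)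

theorem prodStrict_comp_left {X : Type*} [Bicategory X] (F : StrictPseudofunctor A B)
    (G : StrictPseudofunctor B C) : prodStrict (F.comp G) (.id X) =
      (prodStrict F (.id X)).comp (prodStrict G (.id X)) :=
  strict_hext (fun _ => rfl) (fun _ => HEq.rfl) (fun _ => HEq.rfl)

theorem prodStrict_comp_right {X : Type*} [Bicategory X] (F : StrictPseudofunctor A B)
    (G : StrictPseudofunctor B C) : prodStrict (.id X) (F.comp G) =
      (prodStrict (.id X) F).comp (prodStrict (.id X) G) :=
  strict_hext (fun _ => rfl) (fun _ => HEq.rfl) (fun _ => HEq.rfl)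

theorem prodStrict_exchange {X Y : Type*} [Bicategory X] [Bicategory Y]
    (F : StrictPseudofunctor A B) (G : StrictPseudofunctor X Y) :
    (prodStrict F (.id X)).comp (prodStrict (.id B) G) =
      (prodStrict (.id A) G).comp (prodStrict F (.id Y)) :=
  strict_hext (fun _ => rfl) (fun _ => HEq.rfl) (fun _ => HEq.rfl)

theorem prodStrict_id :
    prodStrict (StrictPseudofunctor.id A) (StrictPseudofunctor.id B) = .id (A × B) :=
  strict_hext (fun _ => rfl) (fun _ => HEq.rfl) (fun _ => HEq.rfl)

theorem prodStrict_assoc {A' B' C' : Type*} [Bicategory A'] [Bicategory B'] [Bicategory C']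
    (F : StrictPseudofunctor A A') (G : StrictPseudofunctor B B') (H : StrictPseudofunctor C C') :
    (prodStrict (prodStrict F G) H).comp (prodAssocStrict A' B' C') =
      (prodAssocStrict A B C).comp (prodStrict F (prodStrict G H)) :=
  strict_hext (fun _ => rfl) (fun _ => HEq.rfl) (fun _ => HEq.rfl)

theorem prodStrict_snd {A' B' : Type*} [Bicategory A'] [Bicategory B']
    (F : StrictPseudofunctor A A') (G : StrictPseudofunctor B B') :
    (prodStrict F G).comp (Bicategory.Prod.snd A' B') = (Bicategory.Prod.snd A B).comp G :=
  strict_hext (fun _ => rfl) (fun _ => HEq.rfl) (fun _ => HEq.rfl)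

theorem prodStrict_fst {A' B' : Type*} [Bicategory A'] [Bicategory B']
    (F : StrictPseudofunctor A A') (G : StrictPseudofunctor B B') :
    (prodStrict F G).comp (Bicategory.Prod.fst A' B') = (Bicategory.Prod.fst A B).comp F :=
  strict_hext (fun _ => rfl) (fun _ => HEq.rfl) (fun _ => HEq.rfl)

end StrictComp

/-! ### 2-functors and icons out of, and into, Gray tensor products -/

section GrayExt

variable {A : Type*} [Bicategory A] {B : Type*} [Bicategory B]

/-- Functorial assignments on the 1-cells of the Gray tensor product which agree on generators
are equal. -/
theorem Funny.map_heq {S : Type*} [Bicategory S] {o o' : Funny A B → S}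
    (m : ∀ {x y : Funny A B}, (x ⟶ y) → (o x ⟶ o y))
    (m' : ∀ {x y : Funny A B}, (x ⟶ y) → (o' x ⟶ o' y)) (ho : ∀ x, o x = o' x)
    (hid : ∀ x, m (𝟙 x) = 𝟙 (o x)) (hid' : ∀ x, m' (𝟙 x) = 𝟙 (o' x))
    (hcomp : ∀ {x y z : Funny A B} (p : x ⟶ y) (q : y ⟶ z), m (p ≫ q) = m p ≫ m q)
    (hcomp' : ∀ {x y z : Funny A B} (p : x ⟶ y) (q : y ⟶ z), m' (p ≫ q) = m' p ≫ m' q)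
    (hl : ∀ {a a' : A} (f : a ⟶ a') (b : B), HEq (m (Funny.left f b)) (m' (Funny.left f b)))
    (hr : ∀ (a : A) {b b' : B} (g : b ⟶ b'), HEq (m (Funny.right a g)) (m' (Funny.right a g)))
    {x y : Funny A B} (p : x ⟶ y) : HEq (m p) (m' p) := by
  have key {x y : A × B} (w : Word x y) :
      HEq (m (Funny.cls (x := ⟨x⟩) (y := ⟨y⟩) w)) (m' (Funny.cls (x := ⟨x⟩) (y := ⟨y⟩) w)) := by
    induction w with
    | id x =>
      exact (heq_of_eq (hid ⟨x⟩)).trans ((id₁_heq (ho _)).trans (heq_of_eq (hid' ⟨x⟩)).symm)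
    | @comp x y z p q hp hq =>
      refine (heq_of_eq (hcomp (x := ⟨x⟩) (y := ⟨y⟩) (z := ⟨z⟩) (Funny.cls p) (Funny.cls q))).trans
        ((comp₁_heq (ho _) (ho _) (ho _) hp hq).trans ?_)
      exact (heq_of_eq (hcomp' (x := ⟨x⟩) (y := ⟨y⟩) (z := ⟨z⟩) (Funny.cls p) (Funny.cls q))).symm
    | left f b => exact hl f b
    | right a g => exact hr a g
  obtain ⟨w⟩ := p
  exact key w

variable [Strict A] [Strict B]

/-- 2-functors out of a Gray tensor product which agree on the generating 1-cells agree on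
all 1-cells. -/
theorem strict_gray_heq {S : Type*} [Bicategory S] {F G : StrictPseudofunctor (GrayTensor A B) S}
    (ho : ∀ x, F.obj x = G.obj x)
    (hl : ∀ {a a' : A} (f : a ⟶ a') (b : B), HEq (F.map (grayLeft f b)) (G.map (grayLeft f b)))
    (hr : ∀ (a : A) {b b' : B} (g : b ⟶ b'), HEq (F.map (grayRight a g)) (G.map (grayRight a g)))
    {x y : GrayTensor A B} (p : x ⟶ y) : HEq (F.map p) (G.map p) :=
  Funny.map_heq (o := fun x => F.obj ⟨x⟩) (o' := fun x => G.obj ⟨x⟩)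
    (fun {x y} p => F.map (X := ⟨x⟩) (Y := ⟨y⟩) p) (fun {x y} p => G.map (X := ⟨x⟩) (Y := ⟨y⟩) p)
    (fun x => ho ⟨x⟩) (fun x => F.map_id ⟨x⟩) (fun x => G.map_id ⟨x⟩)
    (fun {x y z} p q => F.map_comp (a := ⟨x⟩) (b := ⟨y⟩) (c := ⟨z⟩) p q)
    (fun {x y z} p q => G.map_comp (a := ⟨x⟩) (b := ⟨y⟩) (c := ⟨z⟩) p q) hl hr (x := x.as)
    (y := y.as) p

theorem grayLeft_id (a : A) (b : B) : grayLeft (𝟙 a) b = 𝟙 (⟨⟨(a, b)⟩⟩ : GrayTensor A B) :=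
  Funny.left_id a b

theorem grayLeft_comp {a a' a'' : A} (f : a ⟶ a') (f' : a' ⟶ a'') (b : B) :
    grayLeft (f ≫ f') b = grayLeft f b ≫ grayLeft f' b := Funny.left_comp f f' b

theorem grayRight_id (a : A) (b : B) : grayRight a (𝟙 b) = 𝟙 (⟨⟨(a, b)⟩⟩ : GrayTensor A B) :=
  Funny.right_id a b

theorem grayRight_comp (a : A) {b b' b'' : B} (g : b ⟶ b') (g' : b' ⟶ b'') :
    grayRight a (g ≫ g') = grayRight a g ≫ grayRight a g' := Funny.right_comp a g g'

variable {C : Type*} [Bicategory C] [Strict C]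

theorem strict_gray₃_heq {S : Type*} [Bicategory S]
    {F G : StrictPseudofunctor (GrayTensor (GrayTensor A B) C) S} (ho : ∀ x, F.obj x = G.obj x)
    (h₁ : ∀ {a a' : A} (f : a ⟶ a') (b : B) (c : C),
      HEq (F.map (grayLeft (grayLeft f b) c)) (G.map (grayLeft (grayLeft f b) c)))
    (h₂ : ∀ (a : A) {b b' : B} (g : b ⟶ b') (c : C),
      HEq (F.map (grayLeft (grayRight a g) c)) (G.map (grayLeft (grayRight a g) c)))
    (h₃ : ∀ (x : GrayTensor A B) {c c' : C} (h : c ⟶ c'),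
      HEq (F.map (grayRight x h)) (G.map (grayRight x h)))
    {x y : GrayTensor (GrayTensor A B) C} (p : x ⟶ y) : HEq (F.map p) (G.map p) := by
  refine strict_gray_heq ho ?_ h₃ p
  intro x y p c
  exact Funny.map_heq (o := fun x => F.obj ⟨⟨(⟨x⟩, c)⟩⟩) (o' := fun x => G.obj ⟨⟨(⟨x⟩, c)⟩⟩)
    (fun {x y} p => F.map (grayLeft (a := (⟨x⟩ : GrayTensor A B)) (a' := ⟨y⟩) p c))
    (fun {x y} p => G.map (grayLeft (a := (⟨x⟩ : GrayTensor A B)) (a' := ⟨y⟩) p c))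
    (fun x => ho _)
    (fun x => (congrArg (fun t => F.map t) (grayLeft_id (⟨x⟩ : GrayTensor A B) c)).trans
      (F.map_id _))
    (fun x => (congrArg (fun t => G.map t) (grayLeft_id (⟨x⟩ : GrayTensor A B) c)).trans
      (G.map_id _))
    (fun {x y z} p q => (congrArg (fun t => F.map t) (grayLeft_comp (a := (⟨x⟩ : GrayTensor A B))
      (a' := ⟨y⟩) (a'' := ⟨z⟩) p q c)).trans (F.map_comp _ _))
    (fun {x y z} p q => (congrArg (fun t => G.map t) (grayLeft_comp (a := (⟨x⟩ : GrayTensor A B))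
      (a' := ⟨y⟩) (a'' := ⟨z⟩) p q c)).trans (G.map_comp _ _))
    (fun f b => h₁ f b c) (fun a _ _ g => h₂ a g c) (x := x.as) (y := y.as) p

theorem strict_gray₄_heq {D : Type*} [Bicategory D] [Strict D] {S : Type*} [Bicategory S]
    {F G : StrictPseudofunctor (GrayTensor (GrayTensor (GrayTensor A B) C) D) S}
    (ho : ∀ x, F.obj x = G.obj x)
    (h₁ : ∀ {a a' : A} (f : a ⟶ a') (b : B) (c : C) (d : D),
      HEq (F.map (grayLeft (grayLeft (grayLeft f b) c) d))
        (G.map (grayLeft (grayLeft (grayLeft f b) c) d)))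
    (h₂ : ∀ (a : A) {b b' : B} (g : b ⟶ b') (c : C) (d : D),
      HEq (F.map (grayLeft (grayLeft (grayRight a g) c) d))
        (G.map (grayLeft (grayLeft (grayRight a g) c) d)))
    (h₃ : ∀ (x : GrayTensor A B) {c c' : C} (h : c ⟶ c') (d : D),
      HEq (F.map (grayLeft (grayRight x h) d)) (G.map (grayLeft (grayRight x h) d)))
    (h₄ : ∀ (x : GrayTensor (GrayTensor A B) C) {d d' : D} (k : d ⟶ d'),
      HEq (F.map (grayRight x k)) (G.map (grayRight x k)))
    {x y : GrayTensor (GrayTensor (GrayTensor A B) C) D} (p : x ⟶ y) :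
    HEq (F.map p) (G.map p) := by
  refine strict_gray₃_heq ho ?_ h₃ h₄ p
  intro x y p c d
  have e (x : Funny A B) : grayLeft (grayLeft (𝟙 (⟨x⟩ : GrayTensor A B)) c) d = 𝟙 _ :=
    (congrArg (fun t => grayLeft t d) (grayLeft_id (⟨x⟩ : GrayTensor A B) c)).trans
      (grayLeft_id (⟨⟨(⟨x⟩, c)⟩⟩ : GrayTensor (GrayTensor A B) C) d)
  have e' {x y z : GrayTensor A B} (p : x ⟶ y) (q : y ⟶ z) : grayLeft (grayLeft (p ≫ q) c) d =
      grayLeft (grayLeft p c) d ≫ grayLeft (grayLeft q c) d :=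
    (congrArg (fun t => grayLeft t d) (grayLeft_comp p q c)).trans
      (grayLeft_comp (grayLeft p c) (grayLeft q c) d)
  exact Funny.map_heq (o := fun x => F.obj ⟨⟨(⟨⟨(⟨x⟩, c)⟩⟩, d)⟩⟩)
    (o' := fun x => G.obj ⟨⟨(⟨⟨(⟨x⟩, c)⟩⟩, d)⟩⟩)
    (fun {x y} p => F.map (grayLeft (grayLeft (a := (⟨x⟩ : GrayTensor A B)) (a' := ⟨y⟩) p c) d))
    (fun {x y} p => G.map (grayLeft (grayLeft (a := (⟨x⟩ : GrayTensor A B)) (a' := ⟨y⟩) p c) d))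
    (fun x => ho _)
    (fun x => (congrArg (fun t => F.map t) (e x)).trans (F.map_id _))
    (fun x => (congrArg (fun t => G.map t) (e x)).trans (G.map_id _))
    (fun {x y z} p q => (congrArg (fun t => F.map t)
      (e' (x := ⟨x⟩) (y := ⟨y⟩) (z := ⟨z⟩) p q)).trans (F.map_comp _ _))
    (fun {x y z} p q => (congrArg (fun t => G.map t)
      (e' (x := ⟨x⟩) (y := ⟨y⟩) (z := ⟨z⟩) p q)).trans (G.map_comp _ _))
    (fun f b => h₁ f b c d) (fun a _ _ g => h₂ a g c d) (x := x.as) (y := y.as) p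

section

variable {X S : Type*} [Bicategory X] [Bicategory S] {E : StrictPseudofunctor X S}

theorem LFF.gray_hext (L : LFF E) {F G : StrictPseudofunctor (GrayTensor A B) X}
    (h : F.comp E = G.comp E) (ho : ∀ x, F.obj x = G.obj x)
    (hl : ∀ {a a' : A} (f : a ⟶ a') (b : B), HEq (F.map (grayLeft f b)) (G.map (grayLeft f b)))
    (hr : ∀ (a : A) {b b' : B} (g : b ⟶ b'),
      HEq (F.map (grayRight a g)) (G.map (grayRight a g))) : F = G :=
  L.cancel_strict h ho (fun p => strict_gray_heq ho hl hr p)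

theorem LFF.gray₃_hext (L : LFF E) {F G : StrictPseudofunctor (GrayTensor (GrayTensor A B) C) X}
    (h : F.comp E = G.comp E) (ho : ∀ x, F.obj x = G.obj x)
    (h₁ : ∀ {a a' : A} (f : a ⟶ a') (b : B) (c : C),
      HEq (F.map (grayLeft (grayLeft f b) c)) (G.map (grayLeft (grayLeft f b) c)))
    (h₂ : ∀ (a : A) {b b' : B} (g : b ⟶ b') (c : C),
      HEq (F.map (grayLeft (grayRight a g) c)) (G.map (grayLeft (grayRight a g) c)))
    (h₃ : ∀ (x : GrayTensor A B) {c c' : C} (h : c ⟶ c'),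
      HEq (F.map (grayRight x h)) (G.map (grayRight x h))) : F = G :=
  L.cancel_strict h ho (fun p => strict_gray₃_heq ho h₁ h₂ h₃ p)

theorem LFF.gray₄_hext {D : Type*} [Bicategory D] [Strict D] (L : LFF E)
    {F G : StrictPseudofunctor (GrayTensor (GrayTensor (GrayTensor A B) C) D) X}
    (h : F.comp E = G.comp E) (ho : ∀ x, F.obj x = G.obj x)
    (h₁ : ∀ {a a' : A} (f : a ⟶ a') (b : B) (c : C) (d : D),
      HEq (F.map (grayLeft (grayLeft (grayLeft f b) c) d))
        (G.map (grayLeft (grayLeft (grayLeft f b) c) d)))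
    (h₂ : ∀ (a : A) {b b' : B} (g : b ⟶ b') (c : C) (d : D),
      HEq (F.map (grayLeft (grayLeft (grayRight a g) c) d))
        (G.map (grayLeft (grayLeft (grayRight a g) c) d)))
    (h₃ : ∀ (x : GrayTensor A B) {c c' : C} (h : c ⟶ c') (d : D),
      HEq (F.map (grayLeft (grayRight x h) d)) (G.map (grayLeft (grayRight x h) d)))
    (h₄ : ∀ (x : GrayTensor (GrayTensor A B) C) {d d' : D} (k : d ⟶ d'),
      HEq (F.map (grayRight x k)) (G.map (grayRight x k))) : F = G :=
  L.cancel_strict h ho (fun p => strict_gray₄_heq ho h₁ h₂ h₃ h₄ p)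

end

end GrayExt

/-! ### The Gray tensor product of 2-functors and icons over the cartesian product -/

section GrayOverProduct

variable {A : Type u} [Bicategory.{u, u} A] [Strict A] {B : Type u} [Bicategory.{u, u} B] [Strict B]
  {C : Type u} [Bicategory.{u, u} C] [Strict C] {D : Type u} [Bicategory.{u, u} D] [Strict D]
  {A' : Type u} [Bicategory.{u, u} A'] [Strict A'] {B' : Type u} [Bicategory.{u, u} B'] [Strict B']
  {C' : Type u} [Bicategory.{u, u} C'] [Strict C']

/-- The Gray tensor product of 2-functors lies over their cartesian product. -/
theorem grayMap_proj (F : StrictPseudofunctor A A') (G : StrictPseudofunctor B B') :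
    (grayMap F G).comp (grayProj A' B') = (grayProj A B).comp (prodStrict F G) :=
  grayLFF.liftStrict_comp ((grayProj A B).comp (prodStrict F G))
    (fun x => ⟨⟨(F.obj x.as.as.1, G.obj x.as.as.2)⟩⟩)
    (fun {x y} p => (grayMap₁ F G).map (X := x.as) (Y := y.as) p) (fun _ => rfl)
    (fun p => heq_of_eq (grayMap₁_eq F G p)) (fun x => (grayMap₁ F G).map_id x.as)
    (fun {x y z} p q => (grayMap₁ F G).map_comp (X := x.as) (Y := y.as) (Z := z.as) p q)

theorem grayMap_proj_comp {S : Type*} [Bicategory S] (F : StrictPseudofunctor A A')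
    (G : StrictPseudofunctor B B') (K : StrictPseudofunctor (A' × B') S) :
    (grayMap F G).comp ((grayProj A' B').comp K) =
      (grayProj A B).comp ((prodStrict F G).comp K) := by
  rw [← strict_assoc, grayMap_proj, strict_assoc]

variable (A B C) in
/-- The associativity isomorphism of the Gray tensor product lies over that of the cartesian
product. -/
theorem grayAssoc_proj :
    (grayAssoc A B C).comp ((grayProj A (GrayTensor B C)).comp
      (prodStrict (.id A) (grayProj B C))) =
    (grayProj (GrayTensor A B) C).comp ((prodStrict (grayProj A B) (.id C)).comp
      (prodAssocStrict A B C)) :=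
  ((grayLFF.comp (LFF.idProd A (grayLFF (A := B) (B := C)))).liftStrict_comp
    (((grayProj (GrayTensor A B) C).comp
      (prodStrict (grayProj A B) (StrictPseudofunctor.id C))).comp (prodAssocStrict A B C))
    (fun x => ⟨⟨(x.as.as.1.as.as.1, ⟨⟨(x.as.as.1.as.as.2, x.as.as.2)⟩⟩)⟩⟩)
    (fun {x y} p => (grayAssoc₁ A B C).map (X := x.as) (Y := y.as) p) (fun _ => rfl)
    (fun p => heq_of_eq (grayAssoc₁_eq A B C p)) (fun x => (grayAssoc₁ A B C).map_id x.as)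
    (fun {x y z} p q => (grayAssoc₁ A B C).map_comp (X := x.as) (Y := y.as) (Z := z.as) p q)).trans
    (strict_assoc _ _ _)

theorem prodStrict_comp_comp {X X' Y Y' Z Z' S : Type*} [Bicategory X] [Bicategory X']
    [Bicategory Y] [Bicategory Y'] [Bicategory Z] [Bicategory Z'] [Bicategory S]
    (F : StrictPseudofunctor X Y) (G : StrictPseudofunctor Y Z) (F' : StrictPseudofunctor X' Y')
    (G' : StrictPseudofunctor Y' Z') (K : StrictPseudofunctor (Z × Z') S) :
    (prodStrict F F').comp ((prodStrict G G').comp K) =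
      (prodStrict (F.comp G) (F'.comp G')).comp K := by
  rw [← strict_assoc, prodStrict_comp]

/-- Evaluation of a 2-cell of `Full R` gives back the 2-cell from which it is made. -/
theorem HCell.map_ev {K : Type*} [Category K] {S : Type*} [Bicategory S] {R : Realization K S}
    {x y x' y' : Full R} {p : x ⟶ y} {p' : x' ⟶ y'} (hx : x = x') (hy : y = y')
    (c : HCell (Full.real p) (Full.real p')) : HCell.map (Full.ev R) (Full.hcell hx hy c) = c := by
  subst hx hy; rfl

theorem HCell.conj_heq {S : Type*} [Bicategory S] {a b a' b' : S} {f g : a ⟶ b} {f' g' : a' ⟶ b'}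
    (h : f = g) (h' : g' = f') (x : HCell g g') :
    HEq (vcomp (of (eqToHom h)) (vcomp x (of (eqToHom h')))) x := by
  subst h h'
  exact heq_of_eq ((HCell.id_vcomp _).trans (HCell.vcomp_id _))

theorem HCell.prod_heq {a b c d a' b' c' d' : A} (ha : a = a') (hb : b = b') (hc : c = c')
    (hd : d = d') {f : a ⟶ b} {g : c ⟶ d} {f' : a' ⟶ b'} {g' : c' ⟶ d'} (hf : HEq f f')
    (hg : HEq g g') {k l m n k' l' m' n' : B} (hk : k = k') (hl : l = l') (hm : m = m')
    (hn : n = n') {s : k ⟶ l} {t : m ⟶ n} {s' : k' ⟶ l'} {t' : m' ⟶ n'} (hs : HEq s s')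
    (ht : HEq t t') {x : HCell f g} {x' : HCell f' g'} (h : HEq x x') {y : HCell s t}
    {y' : HCell s' t'} (h' : HEq y y') : HEq (x.prod y) (x'.prod y') := by
  subst ha hb hc hd hk hl hm hn; cases hf; cases hg; cases hs; cases ht; cases h; cases h'; rfl

theorem HCell.app_heq {S T : Type*} [Bicategory S] [Bicategory T] {F G : S ⥤ᵖ T} (α : Icon F G)
    {a b a' b' : S} (ha : a = a') (hb : b = b') {f : a ⟶ b} {f' : a' ⟶ b'} (h : HEq f f') :
    HEq (α.app f) (α.app f') := by
  subst ha hb; cases h; rfl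

/-- The projection to the cartesian product sends the Gray tensor product of two icons to their
product. -/
theorem grayIcon_proj {F F' : StrictPseudofunctor A A'} {G G' : StrictPseudofunctor B B'}
    (α : Icon F.toPseudofunctor F'.toPseudofunctor) (β : Icon G.toPseudofunctor G'.toPseudofunctor)
    {x y : GrayTensor A B} (p : x ⟶ y) :
    HEq (HCell.map (grayProj A' B').toPseudofunctor ((grayIcon α β).app p))
      ((α.app ((grayProj A B).map p).1).prod (β.app ((grayProj A B).map p).2)) :=
  (heq_of_eq (HCell.map_ev (R := grayReal A' B') _ _ _)).trans
    (HCell.conj_heq (grayMap₁_eq F G (x := x.as) (y := y.as) p)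
      (grayMap₁_eq F' G' (x := x.as) (y := y.as) p).symm _)

/-- The inverse of `grayLeftUnitor`. -/
def grayLeftUnitorInv (A : Type u) [Bicategory.{u, u} A] [Strict A] :
    StrictPseudofunctor A (GrayTensor One.{u} A) :=
  grayLFF.liftStrict (prodLeftUnitorInv A) (fun a => ⟨⟨(⟨⟨⟨⟩⟩⟩, a)⟩⟩)
    (fun f => grayRight (⟨⟨⟨⟩⟩⟩ : One) f) (fun _ => rfl) (fun _ => HEq.rfl)
    (fun a => grayRight_id (⟨⟨⟨⟩⟩⟩ : One) a) (fun f g => grayRight_comp (⟨⟨⟨⟩⟩⟩ : One) f g)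

/-- The inverse of `grayRightUnitor`. -/
def grayRightUnitorInv (A : Type u) [Bicategory.{u, u} A] [Strict A] :
    StrictPseudofunctor A (GrayTensor A One.{u}) :=
  grayLFF.liftStrict (prodRightUnitorInv A) (fun a => ⟨⟨(a, ⟨⟨⟨⟩⟩⟩)⟩⟩)
    (fun f => grayLeft f (⟨⟨⟨⟩⟩⟩ : One)) (fun _ => rfl) (fun _ => HEq.rfl)
    (fun a => grayLeft_id a (⟨⟨⟨⟩⟩⟩ : One)) (fun f g => grayLeft_comp f g (⟨⟨⟨⟩⟩⟩ : One))

theorem grayLeftUnitorInv_proj (A : Type u) [Bicategory.{u, u} A] [Strict A] :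
    (grayLeftUnitorInv A).comp (grayProj One.{u} A) = prodLeftUnitorInv A :=
  grayLFF.liftStrict_comp (prodLeftUnitorInv A) (fun a => ⟨⟨(⟨⟨⟨⟩⟩⟩, a)⟩⟩)
    (fun f => grayRight (⟨⟨⟨⟩⟩⟩ : One) f) (fun _ => rfl) (fun _ => HEq.rfl)
    (fun a => grayRight_id (⟨⟨⟨⟩⟩⟩ : One) a) (fun f g => grayRight_comp (⟨⟨⟨⟩⟩⟩ : One) f g)

theorem grayRightUnitorInv_proj (A : Type u) [Bicategory.{u, u} A] [Strict A] :
    (grayRightUnitorInv A).comp (grayProj A One.{u}) = prodRightUnitorInv A :=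
  grayLFF.liftStrict_comp (prodRightUnitorInv A) (fun a => ⟨⟨(a, ⟨⟨⟨⟩⟩⟩)⟩⟩)
    (fun f => grayLeft f (⟨⟨⟨⟩⟩⟩ : One)) (fun _ => rfl) (fun _ => HEq.rfl)
    (fun a => grayLeft_id a (⟨⟨⟨⟩⟩⟩ : One)) (fun f g => grayLeft_comp f g (⟨⟨⟨⟩⟩⟩ : One))

theorem grayLeftUnitorInv_comp (A : Type u) [Bicategory.{u, u} A] [Strict A] :
    (grayLeftUnitorInv A).comp ((grayProj One A).comp (Bicategory.Prod.snd One A)) = .id A := by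
  rw [← strict_assoc, grayLeftUnitorInv_proj, prodLeftUnitorInv_comp]

theorem grayRightUnitorInv_comp (A : Type u) [Bicategory.{u, u} A] [Strict A] :
    (grayRightUnitorInv A).comp ((grayProj A One).comp (Bicategory.Prod.fst A One)) = .id A := by
  rw [← strict_assoc, grayRightUnitorInv_proj, prodRightUnitorInv_comp]

theorem grayLeftUnitor_comp_inv (A : Type u) [Bicategory.{u, u} A] [Strict A] :
    ((grayProj One A).comp (Bicategory.Prod.snd One A)).comp (grayLeftUnitorInv A) =
      .id (GrayTensor One.{u} A) := by
  refine grayLFF.gray_hext ?_ (fun _ => rfl) ?_ ?_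
  · rw [strict_assoc, grayLeftUnitorInv_proj, strict_assoc, prodSnd_comp_inv,
      strict_comp_id, strict_id_comp]
  · intro a a' f b
    exact heq_of_eq ((grayRight_id (⟨⟨⟨⟩⟩⟩ : One) b).trans (grayLeft_id (⟨⟨⟨⟩⟩⟩ : One) b).symm)
  · intro a b b' g
    rfl

theorem grayRightUnitor_comp_inv (A : Type u) [Bicategory.{u, u} A] [Strict A] :
    ((grayProj A One).comp (Bicategory.Prod.fst A One)).comp (grayRightUnitorInv A) =
      .id (GrayTensor A One.{u}) := by
  refine grayLFF.gray_hext ?_ (fun _ => rfl) ?_ ?_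
  · rw [strict_assoc, grayRightUnitorInv_proj, strict_assoc, prodFst_comp_inv,
      strict_comp_id, strict_id_comp]
  · intro a a' f b
    rfl
  · intro a b b' g
    exact heq_of_eq ((grayLeft_id a (⟨⟨⟨⟩⟩⟩ : One)).trans (grayRight_id a (⟨⟨⟨⟩⟩⟩ : One)).symm)

theorem grayMap_id : grayMap (.id A) (.id B) = .id (GrayTensor A B) := by
  refine grayLFF.gray_hext ?_ (fun _ => rfl) ?_ ?_
  · rw [grayMap_proj, prodStrict_id, strict_comp_id, strict_id_comp]
  · intros; rfl
  · intros; rfl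

theorem grayMap_comp {A'' B'' : Type u} [Bicategory.{u, u} A''] [Strict A'']
    [Bicategory.{u, u} B''] [Strict B'']
    (F : StrictPseudofunctor A A') (F' : StrictPseudofunctor A' A'') (G : StrictPseudofunctor B B')
    (G' : StrictPseudofunctor B' B'') :
    grayMap (F.comp F') (G.comp G') = (grayMap F G).comp (grayMap F' G') := by
  refine grayLFF.gray_hext ?_ (fun _ => rfl) ?_ ?_
  · rw [grayMap_proj, strict_assoc, grayMap_proj, grayMap_proj_comp, prodStrict_comp]
  · intros; rfl
  · intros; rfl

theorem grayAssoc_natural (F : StrictPseudofunctor A A') (G : StrictPseudofunctor B B')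
    (H : StrictPseudofunctor C C') :
    (grayMap (grayMap F G) H).comp (grayAssoc A' B' C') =
      (grayAssoc A B C).comp (grayMap F (grayMap G H)) := by
  refine (grayLFF.comp (LFF.idProd A' grayLFF)).gray₃_hext ?_ (fun _ => rfl) ?_ ?_ ?_
  · rw [strict_assoc, grayAssoc_proj, grayMap_proj_comp, prodStrict_comp_comp, grayMap_proj,
      strict_assoc, grayMap_proj_comp, prodStrict_comp, grayMap_proj, strict_comp_id,
      strict_comp_id]
    have e : prodStrict ((grayProj A B).comp (prodStrict F G)) H =
        (prodStrict (grayProj A B) (.id C)).comp (prodStrict (prodStrict F G) H) := by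
      rw [prodStrict_comp, strict_id_comp]
    have e' : prodStrict F ((grayProj B C).comp (prodStrict G H)) =
        (prodStrict (.id A) (grayProj B C)).comp (prodStrict F (prodStrict G H)) := by
      rw [prodStrict_comp, strict_id_comp]
    rw [e, e', strict_assoc, prodStrict_assoc, ← strict_assoc (grayProj A (GrayTensor B C)),
      ← strict_assoc (grayAssoc A B C), grayAssoc_proj, strict_assoc, strict_assoc]
  · intros; rfl
  · intros; rfl
  · intros; rfl

/-- The pentagon holds on generating 1-cells by definition, and the projection to
`A × (B × (C × D))` is locally fully faithful, so it reduces to the pentagon for the cartesian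
product. -/
theorem grayAssoc_pentagon :
    (grayMap (grayAssoc A B C) (.id D)).comp ((grayAssoc A (GrayTensor B C) D).comp
      (grayMap (.id A) (grayAssoc B C D))) =
    (grayAssoc (GrayTensor A B) C D).comp (grayAssoc A B (GrayTensor C D)) := by
  refine (grayLFF.comp (LFF.idProd A (grayLFF.comp (LFF.idProd B
    (grayLFF (A := C) (B := D)))))).gray₄_hext ?_ (fun _ => rfl) ?_ ?_ ?_ ?_
  · calc
      _ = (grayMap (grayAssoc A B C) (.id D)).comp ((grayAssoc A (GrayTensor B C) D).comp
          ((grayMap (.id A) (grayAssoc B C D)).comp ((grayProj A _).comp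
            (prodStrict (.id A) ((grayProj B _).comp (prodStrict (.id B) (grayProj C D))))))) := by
        rw [strict_assoc, strict_assoc]
      _ = (grayMap (grayAssoc A B C) (.id D)).comp ((grayAssoc A (GrayTensor B C) D).comp
          (((grayProj A _).comp (prodStrict (.id A) (grayProj _ D))).comp
            ((prodStrict (.id A) (prodStrict (grayProj B C) (.id D))).comp
            (prodStrict (.id A) (prodAssocStrict B C D))))) := by
        rw [grayMap_proj_comp, ← prodStrict_comp_right, grayAssoc_proj, prodStrict_comp_right,
          prodStrict_comp_right, strict_assoc]
      _ = (grayProj _ D).comp ((prodStrict ((grayAssoc A B C).comp ((grayProj A _).comp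
            (prodStrict (.id A) (grayProj B C)))) (.id D)).comp
            ((prodAssocStrict A (B × C) D).comp (prodStrict (.id A) (prodAssocStrict B C D)))) := by
        rw [← strict_assoc (grayAssoc A (GrayTensor B C) D), grayAssoc_proj, strict_assoc,
          strict_assoc, ← strict_assoc (prodAssocStrict A (GrayTensor B C) D),
          ← prodStrict_assoc, grayMap_proj_comp, strict_assoc, prodStrict_comp_left,
          prodStrict_comp_left, strict_assoc, strict_assoc]
      _ = (grayProj _ D).comp ((prodStrict (grayProj _ C) (.id D)).comp
          ((prodStrict (prodStrict (grayProj A B) (.id C)) (.id D)).comp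
            ((prodAssocStrict _ C D).comp (prodAssocStrict A B _)))) := by
        rw [grayAssoc_proj, prodStrict_comp_left, prodStrict_comp_left, strict_assoc, strict_assoc,
          prodAssoc_pentagon]
      _ = (grayAssoc _ C D).comp ((grayProj _ _).comp ((prodStrict (.id _) (grayProj C D)).comp
          ((prodStrict (grayProj A B) (.id _)).comp (prodAssocStrict A B _)))) := by
        rw [← strict_assoc (grayProj (GrayTensor A B) (GrayTensor C D)),
          ← strict_assoc (grayAssoc (GrayTensor A B) C D), grayAssoc_proj, strict_assoc,
          strict_assoc, ← strict_assoc (prodAssocStrict (GrayTensor A B) C D), ← prodStrict_id,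
          ← prodStrict_assoc, strict_assoc]
      _ = _ := by
        rw [← strict_assoc (prodStrict (.id _) (grayProj C D)), ← prodStrict_exchange, strict_assoc,
          ← prodStrict_id, prodStrict_assoc, prodStrict_comp_right, strict_assoc,
          ← strict_assoc (grayProj A _), ← strict_assoc (grayAssoc A B _), grayAssoc_proj,
          strict_assoc, strict_assoc]
  · intros; rfl
  · intros; rfl
  · intros; rfl
  · intros; rfl

theorem grayAssoc_triangle {A B : Type u} [Bicategory.{u, u} A] [Strict A] [Bicategory.{u, u} B]
    [Strict B] : (grayAssoc A One.{u} B).comp (grayMap (.id A)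
      ((grayProj One B).comp (Bicategory.Prod.snd One B))) =
    grayMap ((grayProj A One).comp (Bicategory.Prod.fst A One)) (.id B) := by
  refine grayLFF.gray₃_hext ?_ (fun _ => rfl) ?_ ?_ ?_
  · rw [strict_assoc, grayMap_proj, grayMap_proj]
    have e : prodStrict (.id A) ((grayProj One B).comp (Bicategory.Prod.snd One.{u} B)) =
        (prodStrict (.id A) (grayProj One B)).comp
          (prodStrict (.id A) (Bicategory.Prod.snd One B)) := by
      rw [prodStrict_comp, strict_id_comp]
    have e' : prodStrict ((grayProj A One).comp (Bicategory.Prod.fst A One.{u})) (.id B) =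
        (prodStrict (grayProj A One) (.id B)).comp
          (prodStrict (Bicategory.Prod.fst A One) (.id B)) := by
      rw [prodStrict_comp, strict_id_comp]
    rw [e, e', ← strict_assoc (grayProj A (GrayTensor One B)), ← strict_assoc (grayAssoc A One B),
      grayAssoc_proj, strict_assoc, strict_assoc, prodAssoc_triangle]
  · intros; rfl
  · intro a b b' g c
    exact heq_of_eq ((grayRight_id a c).trans (grayLeft_id a c).symm)
  · intros; rfl

end GrayOverProduct

/-! ### The Gray tensor product is a strong monoidal structure -/

section GrayMonoidal

section Congr

variable {S : Type*} [Bicategory S]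

theorem HCell.of_id_heq {a b a' b' : S} (ha : a = a') (hb : b = b') {f : a ⟶ b} {f' : a' ⟶ b'}
    (h : HEq f f') : HEq (of (𝟙 f)) (of (𝟙 f')) := by
  subst ha hb; cases h; rfl

theorem HCell.vcomp_heq {a b c d s t a' b' c' d' s' t' : S} (ha : a = a') (hb : b = b')
    (hc : c = c') (hd : d = d') (hs : s = s') (ht : t = t') {f : a ⟶ b} {g : c ⟶ d} {h : s ⟶ t}
    {f' : a' ⟶ b'} {g' : c' ⟶ d'} {h' : s' ⟶ t'} (hf : HEq f f') (hg : HEq g g') (hh : HEq h h')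
    {x : HCell f g} {y : HCell g h} {x' : HCell f' g'} {y' : HCell g' h'} (hx : HEq x x')
    (hy : HEq y y') : HEq (vcomp x y) (vcomp x' y') := by
  subst ha hb hc hd hs ht; cases hf; cases hg; cases hh; cases hx; cases hy; rfl

end Congr

/-- The product of a locally fully faithful 2-functor and the identity. -/
def LFF.prodId {B B' : Type*} [Bicategory B] [Bicategory B'] (A : Type*) [Bicategory A]
    {E : StrictPseudofunctor B B'} (L : LFF E) : LFF (prodStrict E (StrictPseudofunctor.id A)) where
  lift η := L.lift η.1 ×ₘ η.2
  map_lift η := Prod.ext (L.map_lift η.1) rfl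
  lift_map η := Prod.ext (L.lift_map η.1) rfl

variable {A : Type u} [Bicategory.{u, u} A] [Strict A] {B : Type u} [Bicategory.{u, u} B] [Strict B]
  {C : Type u} [Bicategory.{u, u} C] [Strict C]
  {A' : Type u} [Bicategory.{u, u} A'] [Strict A'] {B' : Type u} [Bicategory.{u, u} B'] [Strict B']
  {C' : Type u} [Bicategory.{u, u} C'] [Strict C']

section AssocInv

/-- The analogue of `strict_gray₃_heq` for the other bracketing. -/
theorem strict_gray₃_heq' {S : Type*} [Bicategory S]
    {F G : StrictPseudofunctor (GrayTensor A (GrayTensor B C)) S} (ho : ∀ x, F.obj x = G.obj x)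
    (h₁ : ∀ {a a' : A} (f : a ⟶ a') (y : GrayTensor B C),
      HEq (F.map (grayLeft f y)) (G.map (grayLeft f y)))
    (h₂ : ∀ (a : A) {b b' : B} (g : b ⟶ b') (c : C),
      HEq (F.map (grayRight a (grayLeft g c))) (G.map (grayRight a (grayLeft g c))))
    (h₃ : ∀ (a : A) (b : B) {c c' : C} (h : c ⟶ c'),
      HEq (F.map (grayRight a (grayRight b h))) (G.map (grayRight a (grayRight b h))))
    {x y : GrayTensor A (GrayTensor B C)} (p : x ⟶ y) : HEq (F.map p) (G.map p) := by
  refine strict_gray_heq ho h₁ ?_ p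
  intro a x y p
  exact Funny.map_heq (o := fun x => F.obj ⟨⟨(a, ⟨x⟩)⟩⟩) (o' := fun x => G.obj ⟨⟨(a, ⟨x⟩)⟩⟩)
    (fun {x y} p => F.map (grayRight a (b := (⟨x⟩ : GrayTensor B C)) (b' := ⟨y⟩) p))
    (fun {x y} p => G.map (grayRight a (b := (⟨x⟩ : GrayTensor B C)) (b' := ⟨y⟩) p))
    (fun x => ho _)
    (fun x => (congrArg (fun t => F.map t) (grayRight_id a (⟨x⟩ : GrayTensor B C))).trans
      (F.map_id _))
    (fun x => (congrArg (fun t => G.map t) (grayRight_id a (⟨x⟩ : GrayTensor B C))).trans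
      (G.map_id _))
    (fun {x y z} p q => (congrArg (fun t => F.map t) (grayRight_comp a
      (b := (⟨x⟩ : GrayTensor B C)) (b' := ⟨y⟩) (b'' := ⟨z⟩) p q)).trans (F.map_comp _ _))
    (fun {x y z} p q => (congrArg (fun t => G.map t) (grayRight_comp a
      (b := (⟨x⟩ : GrayTensor B C)) (b' := ⟨y⟩) (b'' := ⟨z⟩) p q)).trans (G.map_comp _ _))
    (fun g c => h₂ a g c) (fun b _ _ h => h₃ a b h) (x := x.as) (y := y.as) p

/-- The action of the inverse of the associativity isomorphism on 1-cells of the form `1 ⊗ p`. -/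
def grayAssocRight (a : A) : Funny B C ⥤ Funny (GrayTensor A B) C :=
  Funny.liftFunctor (fun x => ⟨((⟨⟨(a, x.1)⟩⟩ : GrayTensor A B), x.2)⟩)
    (fun g c => Funny.left (grayRight a g) c)
    (fun b _ _ h => Funny.right (⟨⟨(a, b)⟩⟩ : GrayTensor A B) h)
    (fun b c => (congrArg (fun t => Funny.left t c) (Funny.right_id a b)).trans
      (Funny.left_id (⟨⟨(a, b)⟩⟩ : GrayTensor A B) c))
    (fun g g' c => (congrArg (fun t => Funny.left t c) (Funny.right_comp a g g')).trans
      (Funny.left_comp (grayRight a g) (grayRight a g') c))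
    (fun _ _ => Funny.right_id _ _) (fun _ _ _ _ _ _ => Funny.right_comp _ _ _)

variable (A B C) in
/-- The action of the inverse of the associativity isomorphism on 1-cells. -/
def grayAssocInv₁ : Funny A (GrayTensor B C) ⥤ Funny (GrayTensor A B) C :=
  Funny.liftFunctor (fun x => ⟨((⟨⟨(x.1, x.2.as.as.1)⟩⟩ : GrayTensor A B), x.2.as.as.2)⟩)
    (fun f y => Funny.left (grayLeft f y.as.as.1) y.as.as.2)
    (fun a {x y} q => (grayAssocRight a).map (X := x.as) (Y := y.as) q)
    (fun a y => (congrArg (fun t => Funny.left t _) (Funny.left_id a y.as.as.1)).trans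
      (Funny.left_id (⟨⟨(a, y.as.as.1)⟩⟩ : GrayTensor A B) y.as.as.2))
    (fun f f' y => (congrArg (fun t => Funny.left t _) (Funny.left_comp f f' y.as.as.1)).trans
      (Funny.left_comp (grayLeft f y.as.as.1) (grayLeft f' y.as.as.1) y.as.as.2))
    (fun a y => (grayAssocRight a).map_id y.as)
    (fun a {x y z} p q => (grayAssocRight a).map_comp (X := x.as) (Y := y.as) (Z := z.as) p q)

variable (A B C) in
theorem grayAssocInv₁_heq {x y : GrayTensor A (GrayTensor B C)} (p : x ⟶ y) :
    HEq (((grayProj (GrayTensor A B) C).comp (prodStrict (grayProj A B) (.id C))).map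
      ((grayAssocInv₁ A B C).map (X := x.as) (Y := y.as) p))
    (((grayProj A (GrayTensor B C)).comp ((prodStrict (.id A) (grayProj B C)).comp
      (prodAssocInv A B C))).map p) := by
  set P := (grayProj (GrayTensor A B) C).comp (prodStrict (grayProj A B) (.id C))
  set Q := (grayProj A (GrayTensor B C)).comp ((prodStrict (.id A) (grayProj B C)).comp
      (prodAssocInv A B C))
  refine Funny.map_heq (o := fun x => P.obj ⟨(grayAssocInv₁ A B C).obj x⟩)
    (o' := fun x => Q.obj ⟨x⟩) (fun {x y} p => P.map ((grayAssocInv₁ A B C).map p))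
    (fun {x y} p => Q.map (X := ⟨x⟩) (Y := ⟨y⟩) p) (fun x => rfl)
    (fun x => (congrArg _ ((grayAssocInv₁ A B C).map_id x)).trans (P.map_id _))
    (fun x => Q.map_id ⟨x⟩)
    (fun {x y z} p q => (congrArg _ ((grayAssocInv₁ A B C).map_comp p q)).trans
      (P.map_comp (a := ⟨(grayAssocInv₁ A B C).obj x⟩) (b := ⟨(grayAssocInv₁ A B C).obj y⟩)
        (c := ⟨(grayAssocInv₁ A B C).obj z⟩) _ _))
    (fun {x y z} p q => Q.map_comp (a := ⟨x⟩) (b := ⟨y⟩) (c := ⟨z⟩) p q) ?_ ?_ (x := x.as)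
    (y := y.as) p
  · intro a a' f y; rfl
  · intro a x y q
    refine Funny.map_heq (o := fun x => P.obj ⟨(grayAssocRight a).obj x⟩)
      (o' := fun x => Q.obj ⟨⟨(a, (⟨x⟩ : GrayTensor B C))⟩⟩)
      (fun {x y} p => P.map ((grayAssocRight a).map p))
      (fun {x y} p => Q.map (grayRight a (b := (⟨x⟩ : GrayTensor B C)) (b' := ⟨y⟩) p))
      (fun x => rfl)
      (fun x => (congrArg _ ((grayAssocRight a).map_id x)).trans (P.map_id _))
      (fun x => (congrArg (fun t => Q.map t) (grayRight_id a (⟨x⟩ : GrayTensor B C))).trans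
        (Q.map_id _))
      (fun {x y z} p q => (congrArg _ ((grayAssocRight a).map_comp p q)).trans
        (P.map_comp (a := ⟨(grayAssocRight a).obj x⟩) (b := ⟨(grayAssocRight a).obj y⟩)
          (c := ⟨(grayAssocRight a).obj z⟩) _ _))
      (fun {x y z} p q => (congrArg (fun t => Q.map t) (grayRight_comp a
        (b := (⟨x⟩ : GrayTensor B C)) (b' := ⟨y⟩) (b'' := ⟨z⟩) p q)).trans (Q.map_comp _ _))
      ?_ ?_ (x := x.as) (y := y.as) q
    · intro b b' g c; rfl
    · intro b c c' h; rfl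

variable (A B C) in
/-- The inverse of the associativity isomorphism of the Gray tensor product. -/
def grayAssocInv : StrictPseudofunctor (GrayTensor A (GrayTensor B C))
    (GrayTensor (GrayTensor A B) C) :=
  (grayLFF.comp (LFF.prodId C (grayLFF (A := A) (B := B)))).liftStrict
    ((grayProj A (GrayTensor B C)).comp ((prodStrict (.id A) (grayProj B C)).comp
      (prodAssocInv A B C)))
    (fun x => ⟨⟨(⟨⟨(x.as.as.1, x.as.as.2.as.as.1)⟩⟩, x.as.as.2.as.as.2)⟩⟩)
    (fun {x y} p => (grayAssocInv₁ A B C).map (X := x.as) (Y := y.as) p) (fun _ => rfl)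
    (fun p => grayAssocInv₁_heq A B C p) (fun x => (grayAssocInv₁ A B C).map_id x.as)
    (fun {x y z} p q => (grayAssocInv₁ A B C).map_comp (X := x.as) (Y := y.as) (Z := z.as) p q)

variable (A B C) in
theorem grayAssocInv_proj :
    (grayAssocInv A B C).comp ((grayProj (GrayTensor A B) C).comp
      (prodStrict (grayProj A B) (.id C))) =
    (grayProj A (GrayTensor B C)).comp ((prodStrict (.id A) (grayProj B C)).comp
      (prodAssocInv A B C)) :=
  (grayLFF.comp (LFF.prodId C (grayLFF (A := A) (B := B)))).liftStrict_comp
    ((grayProj A (GrayTensor B C)).comp ((prodStrict (.id A) (grayProj B C)).comp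
      (prodAssocInv A B C)))
    (fun x => ⟨⟨(⟨⟨(x.as.as.1, x.as.as.2.as.as.1)⟩⟩, x.as.as.2.as.as.2)⟩⟩)
    (fun {x y} p => (grayAssocInv₁ A B C).map (X := x.as) (Y := y.as) p) (fun _ => rfl)
    (fun p => grayAssocInv₁_heq A B C p) (fun x => (grayAssocInv₁ A B C).map_id x.as)
    (fun {x y z} p q => (grayAssocInv₁ A B C).map_comp (X := x.as) (Y := y.as) (Z := z.as) p q)

variable (A B C) in
theorem grayAssoc_comp_inv : (grayAssoc A B C).comp (grayAssocInv A B C) = .id _ := by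
  refine (grayLFF.comp (LFF.prodId C (grayLFF (A := A) (B := B)))).gray₃_hext ?_ (fun _ => rfl)
    ?_ ?_ ?_
  · rw [strict_assoc, grayAssocInv_proj, ← strict_assoc (grayProj A _),
      ← strict_assoc (grayAssoc A B C), grayAssoc_proj, strict_assoc, strict_assoc,
      prodAssoc_comp_inv, strict_comp_id, strict_id_comp]
  · intros; rfl
  · intros; rfl
  · intros; rfl

variable (A B C) in
theorem grayAssocInv_comp : (grayAssocInv A B C).comp (grayAssoc A B C) = .id _ := by
  have e : ((grayAssocInv A B C).comp (grayAssoc A B C)).comp ((grayProj A (GrayTensor B C)).comp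
      (prodStrict (.id A) (grayProj B C))) = (StrictPseudofunctor.id _).comp
        ((grayProj A (GrayTensor B C)).comp (prodStrict (.id A) (grayProj B C))) := by
    rw [strict_assoc, grayAssoc_proj, ← strict_assoc (grayProj _ C),
      ← strict_assoc (grayAssocInv A B C), grayAssocInv_proj, strict_assoc, strict_assoc,
      prodAssocInv_comp, strict_comp_id, strict_id_comp]
  exact (grayLFF.comp (LFF.idProd A (grayLFF (A := B) (B := C)))).cancel_strict e (fun _ => rfl)
    (fun p => strict_gray₃_heq' (F := (grayAssocInv A B C).comp (grayAssoc A B C)) (G := .id _)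
      (fun _ => rfl) (fun _ _ => HEq.rfl) (fun _ _ _ _ _ => HEq.rfl) (by intros; rfl) p)

end AssocInv

section Icons

theorem HCell.map_comp_congr {X Y Z W : Type*} [Bicategory X] [Bicategory Y] [Bicategory Z]
    [Bicategory W] {F : StrictPseudofunctor X Y} {G : StrictPseudofunctor Y Z}
    {F' : StrictPseudofunctor X W} {G' : StrictPseudofunctor W Z} (h : F.comp G = F'.comp G')
    {a b a' b' : X} {f : a ⟶ b} {g : a' ⟶ b'} (x : HCell f g) :
    HEq (HCell.map G.toPseudofunctor (HCell.map F.toPseudofunctor x))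
      (HCell.map G'.toPseudofunctor (HCell.map F'.toPseudofunctor x)) :=
  (heq_of_eq (HCell.map_comp_functor F.toPseudofunctor G.toPseudofunctor x)).symm.trans
    ((hcell_map_congr (congr_toPs h) x).trans
      (heq_of_eq (HCell.map_comp_functor F'.toPseudofunctor G'.toPseudofunctor x)))

variable {F F' F'' : StrictPseudofunctor A A'} {G G' G'' : StrictPseudofunctor B B'}

theorem grayProj_grayMap (F : StrictPseudofunctor A A') (G : StrictPseudofunctor B B')
    {x y : GrayTensor A B} (p : x ⟶ y) : (grayProj A' B').map ((grayMap F G).map p) =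
      (F.map ((grayProj A B).map p).1 ×ₘ G.map ((grayProj A B).map p).2) :=
  grayMap₁_eq F G (x := x.as) (y := y.as) p

theorem grayIcon_id : grayIcon (Icon.id F.toPseudofunctor) (Icon.id G.toPseudofunctor) =
    Icon.id (grayMap F G).toPseudofunctor := by
  refine eq_of_heq (grayLFF.icon_heq rfl rfl fun p => (grayIcon_proj _ _ p).trans ?_)
  exact HCell.of_id_heq rfl rfl (pseudofunctor_map_congr (congr_toPs (grayMap_proj F G)) p).symm

theorem grayIcon_vcomp (α : Icon F.toPseudofunctor F'.toPseudofunctor)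
    (α' : Icon F'.toPseudofunctor F''.toPseudofunctor)
    (β : Icon G.toPseudofunctor G'.toPseudofunctor)
    (β' : Icon G'.toPseudofunctor G''.toPseudofunctor) :
    grayIcon (α.vcomp α') (β.vcomp β') = (grayIcon α β).vcomp (grayIcon α' β') := by
  refine eq_of_heq (grayLFF.icon_heq rfl rfl fun p => (grayIcon_proj _ _ p).trans ?_)
  refine (heq_of_eq (HCell.prod_vcomp _ _ _ _)).trans (HEq.symm ?_)
  refine (heq_of_eq (HCell.map_vcomp _ _ _)).trans ?_
  exact HCell.vcomp_heq rfl rfl rfl rfl rfl rfl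
    (pseudofunctor_map_congr (congr_toPs (grayMap_proj F G)) p)
    (pseudofunctor_map_congr (congr_toPs (grayMap_proj F' G')) p)
    (pseudofunctor_map_congr (congr_toPs (grayMap_proj F'' G'')) p) (grayIcon_proj α β p)
    (grayIcon_proj α' β' p)

theorem grayIcon_whiskerLeft {A₀ B₀ : Type u} [Bicategory.{u, u} A₀] [Strict A₀]
    [Bicategory.{u, u} B₀] [Strict B₀] (H : StrictPseudofunctor A₀ A) (K : StrictPseudofunctor B₀ B)
    (α : Icon F.toPseudofunctor F'.toPseudofunctor)
    (β : Icon G.toPseudofunctor G'.toPseudofunctor) :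
    HEq (grayIcon (F := H.comp F) (F' := H.comp F') (G := K.comp G) (G' := K.comp G')
      (α.whiskerLeft H.toPseudofunctor) (β.whiskerLeft K.toPseudofunctor))
    ((grayIcon α β).whiskerLeft (grayMap H K).toPseudofunctor) := by
  refine grayLFF.icon_heq (congr_toPs (grayMap_comp H F K G)) (congr_toPs (grayMap_comp H F' K G'))
    fun p => (grayIcon_proj _ _ p).trans (HEq.symm ((grayIcon_proj _ _ _).trans ?_))
  have e := eq_of_heq (pseudofunctor_map_congr (congr_toPs (grayMap_proj H K)) p)
  exact HCell.app_heq (α.prod β) rfl rfl (heq_of_eq e)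

theorem grayIcon_whiskerRight {A₀ B₀ : Type u} [Bicategory.{u, u} A₀] [Strict A₀]
    [Bicategory.{u, u} B₀] [Strict B₀] (H : StrictPseudofunctor A' A₀)
    (K : StrictPseudofunctor B' B₀) (α : Icon F.toPseudofunctor F'.toPseudofunctor)
    (β : Icon G.toPseudofunctor G'.toPseudofunctor) :
    HEq (grayIcon (F := F.comp H) (F' := F'.comp H) (G := G.comp K) (G' := G'.comp K)
      (α.whiskerRight H.toPseudofunctor) (β.whiskerRight K.toPseudofunctor))
    ((grayIcon α β).whiskerRight (grayMap H K).toPseudofunctor) := by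
  refine grayLFF.icon_heq (congr_toPs (grayMap_comp F H G K)) (congr_toPs (grayMap_comp F' H G' K))
    fun p => (grayIcon_proj _ _ p).trans (HEq.symm ?_)
  refine (HCell.map_comp_congr (grayMap_proj H K) _).trans ?_
  refine (HCell.map_heq _ rfl rfl rfl rfl
    (pseudofunctor_map_congr (congr_toPs (grayMap_proj F G)) p)
    (pseudofunctor_map_congr (congr_toPs (grayMap_proj F' G')) p) (grayIcon_proj α β p)).trans ?_
  exact heq_of_eq (HCell.map_prodMap _ _ _ _)

theorem grayIcon_assoc {H H' : StrictPseudofunctor C C'}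
    (α : Icon F.toPseudofunctor F'.toPseudofunctor)
    (β : Icon G.toPseudofunctor G'.toPseudofunctor)
    (γ : Icon H.toPseudofunctor H'.toPseudofunctor) :
    HEq ((grayIcon (grayIcon α β) γ).whiskerRight (grayAssoc A' B' C').toPseudofunctor)
      ((grayIcon α (grayIcon β γ)).whiskerLeft (grayAssoc A B C).toPseudofunctor) := by
  refine (grayLFF.comp (LFF.idProd A' (grayLFF (A := B') (B := C')))).icon_heq
    (congr_toPs (grayAssoc_natural F G H)) (congr_toPs (grayAssoc_natural F' G' H')) ?_
  intro x y p
  have e : HEq (((grayProj A (GrayTensor B C)).comp (prodStrict (.id A) (grayProj B C))).map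
      ((grayAssoc A B C).map p)) (((prodStrict (grayProj A B) (.id C)).comp
        (prodAssocStrict A B C)).map ((grayProj (GrayTensor A B) C).map p)) :=
    pseudofunctor_map_congr (congr_toPs (grayAssoc_proj A B C)) p
  refine HEq.trans ?_ (((HCell.app_heq (α.prod (β.prod γ)) rfl rfl e).symm).trans (HEq.symm ?_))
  · refine (HCell.map_comp_congr (grayAssoc_proj A' B' C') _).trans ?_
    refine (HCell.map_heq _ rfl rfl rfl rfl
      (pseudofunctor_map_congr (congr_toPs (grayMap_proj (grayMap F G) H)) p)
      (pseudofunctor_map_congr (congr_toPs (grayMap_proj (grayMap F' G') H')) p)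
      (grayIcon_proj (grayIcon α β) γ p)).trans ?_
    refine (heq_of_eq (HCell.map_comp_functor (prodStrict (grayProj A' B') (.id C')).toPseudofunctor
      (prodAssoc A' B' C') _)).trans ?_
    refine (HCell.map_heq _ rfl rfl rfl rfl ?_ ?_ ((heq_of_eq (HCell.map_prodMap _ _ _ _)).trans
      (HCell.prod_heq rfl rfl rfl rfl ?_ ?_ rfl rfl rfl rfl ?_ ?_ (grayIcon_proj α β _)
        (heq_of_eq (HCell.map_id_functor _))))).trans (heq_of_eq (HCell.map_prodAssoc _ _ _))
    · exact heq_of_eq (Prod.ext (grayProj_grayMap F G _) rfl)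
    · exact heq_of_eq (Prod.ext (grayProj_grayMap F' G' _) rfl)
    · exact heq_of_eq (grayProj_grayMap F G _)
    · exact heq_of_eq (grayProj_grayMap F' G' _)
    · rfl
    · rfl
  · refine (heq_of_eq (HCell.map_comp_functor (grayProj A' (GrayTensor B' C')).toPseudofunctor
      (prodStrict (.id A') (grayProj B' C')).toPseudofunctor _)).trans ?_
    refine (HCell.map_heq _ rfl rfl rfl rfl ?_ ?_
      (grayIcon_proj α (grayIcon β γ) ((grayAssoc A B C).map p))).trans ?_
    · exact heq_of_eq (grayProj_grayMap F (grayMap G H) _)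
    · exact heq_of_eq (grayProj_grayMap F' (grayMap G' H') _)
    refine (heq_of_eq (HCell.map_prodMap _ _ _ _)).trans ?_
    refine HCell.prod_heq rfl rfl rfl rfl ?_ ?_ rfl rfl rfl rfl ?_ ?_
      (heq_of_eq (HCell.map_id_functor _)) (grayIcon_proj β γ _)
    · rfl
    · rfl
    · exact heq_of_eq (grayProj_grayMap G H _)
    · exact heq_of_eq (grayProj_grayMap G' H' _)

theorem grayIcon_snd (α : Icon F.toPseudofunctor F'.toPseudofunctor)
    (β : Icon G.toPseudofunctor G'.toPseudofunctor) {x y : GrayTensor A B} (p : x ⟶ y) :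
    HEq (HCell.map (prodSnd A' B')
      (HCell.map (grayProj A' B').toPseudofunctor ((grayIcon α β).app p)))
      (β.app ((grayProj A B).map p).2) :=
  (HCell.map_heq _ rfl rfl rfl rfl (heq_of_eq (grayProj_grayMap F G p))
    (heq_of_eq (grayProj_grayMap F' G' p)) (grayIcon_proj α β p)).trans
    (heq_of_eq (HCell.map_prodSnd _ _))

theorem grayIcon_fst (α : Icon F.toPseudofunctor F'.toPseudofunctor)
    (β : Icon G.toPseudofunctor G'.toPseudofunctor) {x y : GrayTensor A B} (p : x ⟶ y) :
    HEq (HCell.map (prodFst A' B')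
      (HCell.map (grayProj A' B').toPseudofunctor ((grayIcon α β).app p)))
      (α.app ((grayProj A B).map p).1) :=
  (HCell.map_heq _ rfl rfl rfl rfl (heq_of_eq (grayProj_grayMap F G p))
    (heq_of_eq (grayProj_grayMap F' G' p)) (grayIcon_proj α β p)).trans
    (heq_of_eq (HCell.map_prodFst _ _))

end Icons

instance (A : GrayCat.{u}) : Strict A.toIcon := A.strict

theorem grayMonoidal_tensor_functor : IsTwoFunctor grayMonoidal.{u}.tensor := by
  refine .of_heq _ (fun _ => grayMap_id) ?_ (fun _ => grayIcon_id) ?_ ?_ ?_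
  · intro a b c f g
    exact grayMap_comp f.1 g.1 f.2 g.2
  · intro a b f g h η θ
    exact grayIcon_vcomp η.1 θ.1 η.2 θ.2
  · intro a b c f g h η
    exact grayIcon_whiskerLeft f.1 f.2 η.1 η.2
  · intro a b c f g η h
    exact grayIcon_whiskerRight h.1 h.2 η.1 η.2

theorem grayMonoidal_assoc_natural : IsTwoNatural
    ((prodStruct grayMonoidal.{u}.tensor (.id GrayCat)).comp grayMonoidal.tensor)
    ((prodAssoc GrayCat GrayCat GrayCat).toPrelaxFunctorStruct.comp
      ((prodStruct (.id GrayCat) grayMonoidal.tensor).comp grayMonoidal.tensor))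
    (fun x => grayMonoidal.assoc x.1.1 x.1.2 x.2) := by
  refine .of_heq (fun f => grayAssoc_natural f.1.1 f.1.2 f.2) ?_
  intro a b f g α
  exact grayIcon_assoc α.1.1 α.1.2 α.2

theorem grayLeftUnitor_naturality (F : StrictPseudofunctor A A') :
    (grayMap (.id One.{u}) F).comp ((grayProj One A').comp (Bicategory.Prod.snd One A')) =
      ((grayProj One A).comp (Bicategory.Prod.snd One A)).comp F := by
  rw [grayMap_proj_comp, prodStrict_snd, strict_assoc]

theorem grayRightUnitor_naturality (F : StrictPseudofunctor A A') :
    (grayMap F (.id One.{u})).comp ((grayProj A' One).comp (Bicategory.Prod.fst A' One)) =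
      ((grayProj A One).comp (Bicategory.Prod.fst A One)).comp F := by
  rw [grayMap_proj_comp, prodStrict_fst, strict_assoc]

theorem grayMonoidal_leftUnitor_natural : IsTwoNatural
    { obj a := grayMonoidal.{u}.tensor.obj (grayMonoidal.unit, a)
      map f := grayMonoidal.hom (𝟙 grayMonoidal.unit) f
      map₂ η := grayMonoidal.tensor.map₂ (𝟙 (𝟙 grayMonoidal.unit) ×ₘ η) } (.id GrayCat)
    grayMonoidal.leftUnitor := by
  refine .of_heq (fun f => grayLeftUnitor_naturality f) ?_
  intro a b f g α
  refine icon_heq (congr_toPs (grayLeftUnitor_naturality f))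
    (congr_toPs (grayLeftUnitor_naturality g)) ?_
  intro x y k
  exact (heq_of_eq (HCell.map_comp_functor (grayProj One b).toPseudofunctor
    (prodSnd One b) _)).trans
    (grayIcon_snd (Icon.id (StrictPseudofunctor.id One).toPseudofunctor) α k)

theorem grayMonoidal_rightUnitor_natural : IsTwoNatural
    { obj a := grayMonoidal.{u}.tensor.obj (a, grayMonoidal.unit)
      map f := grayMonoidal.hom f (𝟙 grayMonoidal.unit)
      map₂ η := grayMonoidal.tensor.map₂ (η ×ₘ 𝟙 (𝟙 grayMonoidal.unit)) } (.id GrayCat)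
    grayMonoidal.rightUnitor := by
  refine .of_heq (fun f => grayRightUnitor_naturality f) ?_
  intro a b f g α
  refine icon_heq (congr_toPs (grayRightUnitor_naturality f))
    (congr_toPs (grayRightUnitor_naturality g)) ?_
  intro x y k
  exact (heq_of_eq (HCell.map_comp_functor (grayProj b One).toPseudofunctor
    (prodFst b One) _)).trans
    (grayIcon_fst α (Icon.id (StrictPseudofunctor.id One).toPseudofunctor) k)

theorem grayMonoidal_isStronglyMonoidal : IsStronglyMonoidal grayMonoidal.{u} where
  tensor_functor := grayMonoidal_tensor_functor
  assoc_natural := grayMonoidal_assoc_natural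
  assoc_invertible A B C := ⟨grayAssocInv A B C, grayAssoc_comp_inv A B C, grayAssocInv_comp A B C⟩
  leftUnitor_natural := grayMonoidal_leftUnitor_natural
  leftUnitor_invertible A := ⟨grayLeftUnitorInv A, grayLeftUnitor_comp_inv A,
    grayLeftUnitorInv_comp A⟩
  rightUnitor_natural := grayMonoidal_rightUnitor_natural
  rightUnitor_invertible A := ⟨grayRightUnitorInv A, grayRightUnitor_comp_inv A,
    grayRightUnitorInv_comp A⟩
  pentagon A B C D := grayAssoc_pentagon (A := A) (B := B) (C := C) (D := D)
  triangle A B := grayAssoc_triangle (A := A) (B := B)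

end GrayMonoidal

/-! ### The universal cubical functor and the lax monoidal structure on the inclusion -/

section Cubical

theorem incl_isTwoFunctor : IsTwoFunctor incl.{u} :=
  .of_heq _ (fun _ => rfl) (fun _ _ => rfl) (fun _ => rfl) (fun _ _ => rfl) (fun _ _ _ _ => HEq.rfl)
    (fun _ _ => HEq.rfl)

/-- The lift of an identity between images of equal 1-cells is an identity. -/
theorem LFF.isoOfEq_eq {D S : Type*} [Bicategory D] [Bicategory S] {E : StrictPseudofunctor D S}
    (L : LFF E) {x y : D} {p q : x ⟶ y} (h : p = q) :
    L.isoOfEq (congrArg E.map h) = eqToIso h := by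
  subst h
  exact Iso.ext (L.ext ((L.map_isoOfEq_hom _).trans (E.map₂_id p).symm))

/-- Lifting along a locally fully faithful 2-functor produces a factorization, even if the
assignment on 1-cells is not functorial: the constraints of the lift lie over identities. -/
theorem LFF.liftPseudofunctor_comp {C D S : Type*} [Bicategory C] [Bicategory D] [Bicategory S]
    [Strict C] [Strict D] {E : StrictPseudofunctor D S} (L : LFF E) (G : StrictPseudofunctor C S)
    (obj : C → D) (map : ∀ {x y : C}, (x ⟶ y) → (obj x ⟶ obj y))
    (hobj : ∀ x, E.obj (obj x) = G.obj x)
    (hmap : ∀ {x y : C} (p : x ⟶ y), HEq (E.map (map p)) (G.map p)) :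
    (L.liftPseudofunctor G obj map hobj hmap).comp E.toPseudofunctor = G.toPseudofunctor := by
  refine pseudofunctor_hext hobj hmap (fun η => L.map_lift₂ G obj map hobj hmap η)
    (fun a => (comp_strict_mapId_heq _ E a).trans ?_)
    (fun f g => (comp_strict_mapComp_heq _ E f g).trans ?_)
  · refine (heq_of_eq (L.map_isoOfEq_inv _)).trans ((eqToHom₂_heq _).trans
      (HEq.trans ?_ (strict_mapId_inv_heq G a).symm))
    rw [E.map_id]
    exact id₂_heq (hobj a) (hobj a) (id₁_heq (hobj a))
  · refine (heq_of_eq (L.map_isoOfEq_inv _)).trans ((eqToHom₂_heq _).trans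
      (HEq.trans ?_ (strict_mapComp_inv_heq G f g).symm))
    rw [E.map_comp]
    exact id₂_heq (hobj _) (hobj _) (comp₁_heq (hobj _) (hobj _) (hobj _) (hmap f) (hmap g))

variable {A : Type u} [Bicategory.{u, u} A] [Strict A] {B : Type u} [Bicategory.{u, u} B] [Strict B]
  {C : Type u} [Bicategory.{u, u} C] [Strict C]
  {A' : Type u} [Bicategory.{u, u} A'] [Strict A'] {B' : Type u} [Bicategory.{u, u} B'] [Strict B']

variable (A B) in
/-- The universal cubical functor is a section of the projection to the cartesian product. -/
theorem cub_proj : (cub A B).comp (grayProj A B).toPseudofunctor = Pseudofunctor.id (A × B) :=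
  grayLFF.liftPseudofunctor_comp (StrictPseudofunctor.id (A × B)) (fun x => ⟨⟨x⟩⟩)
    (fun {x y} f => grayLeft f.1 x.2 ≫ grayRight y.1 f.2) (fun _ => rfl)
    (fun _ => heq_of_eq (Prod.ext (Strict.comp_id _) (Strict.id_comp _)))

theorem cub_proj_comp {S : Type*} [Bicategory S] (K : (A × B) ⥤ᵖ S) :
    (cub A B).comp ((grayProj A B).toPseudofunctor.comp K) = K := by
  rw [← comp_assoc, cub_proj, id_comp]

theorem grayProj_cub {x y : A × B} (f : x ⟶ y) : (grayProj A B).map ((cub A B).map f) = f :=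
  eq_of_heq (pseudofunctor_map_congr (cub_proj A B) f)

theorem cub_natural (F : StrictPseudofunctor A A') (G : StrictPseudofunctor B B') :
    (prodMap F.toPseudofunctor G.toPseudofunctor).comp (cub A' B') =
      (cub A B).comp (grayMap F G).toPseudofunctor := by
  refine grayLFF.cancel ?_ (fun _ => rfl) (fun _ => HEq.rfl)
  rw [comp_assoc, cub_proj, comp_id, comp_assoc]
  exact ((congrArg _ (congr_toPs (grayMap_proj F G))).trans (cub_proj_comp _)).symm

/-- The 2-dimensional part of the naturality of the universal cubical functor in 2-functors and
icons. -/
theorem cub_natural₂ {F F' : StrictPseudofunctor A A'} {G G' : StrictPseudofunctor B B'}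
    (α : Icon F.toPseudofunctor F'.toPseudofunctor)
    (β : Icon G.toPseudofunctor G'.toPseudofunctor) :
    HEq ((α.prod β).whiskerRight (cub A' B')) ((grayIcon α β).whiskerLeft (cub A B)) := by
  refine grayLFF.icon_heq (cub_natural F G) (cub_natural F' G') fun f => ?_
  refine HEq.trans ?_ (grayIcon_proj α β ((cub A B).map f)).symm
  refine (heq_of_eq (HCell.map_comp_functor _ _ _)).symm.trans ?_
  refine (hcell_map_congr (cub_proj A' B') _).trans ?_
  refine (heq_of_eq (HCell.map_id_functor _)).trans ?_
  exact HCell.app_heq (α.prod β) rfl rfl (heq_of_eq (grayProj_cub f).symm)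

theorem incl_natural : IsTwoNatural ((prodStruct incl.{u} incl).comp iconMonoidal.tensor)
    (grayMonoidal.tensor.comp incl) (fun x => cubHom x.1 x.2) := by
  refine .of_heq (fun f => cub_natural f.1 f.2) ?_
  intro a b f g α
  exact cub_natural₂ α.1 α.2

variable (A B C) in
/-- Both sides lie over the associativity isomorphism of the cartesian product, and agree on
1-cells: each sends `((f, g), h)` to the composite of `f`, `g` and `h` in this order. -/
theorem cub_assoc : (prodMap (cub A B) (Pseudofunctor.id C)).comp ((cub (GrayTensor A B) C).comp
      (grayAssoc A B C).toPseudofunctor) =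
    (prodAssoc A B C).comp ((prodMap (Pseudofunctor.id A) (cub B C)).comp
      (cub A (GrayTensor B C))) := by
  refine (grayLFF.comp (LFF.idProd A (grayLFF (A := B) (B := C)))).cancel ?_ (fun _ => rfl)
    (fun f => heq_of_eq ?_)
  · have e₁ : (grayAssoc A B C).toPseudofunctor.comp ((grayProj A (GrayTensor B C)).comp
        (prodStrict (.id A) (grayProj B C))).toPseudofunctor =
      (grayProj (GrayTensor A B) C).toPseudofunctor.comp
        ((prodMap (grayProj A B).toPseudofunctor (Pseudofunctor.id C)).comp (prodAssoc A B C)) :=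
      congr_toPs (grayAssoc_proj A B C)
    have e₂ : (prodMap (cub A B) (Pseudofunctor.id C)).comp
        (prodMap (grayProj A B).toPseudofunctor (Pseudofunctor.id C)) = Pseudofunctor.id _ := by
      rw [← prodMap_comp, cub_proj, id_comp, prodMap_id]
    have e₃ : (prodMap (Pseudofunctor.id A) (cub B C)).comp
        (prodMap (Pseudofunctor.id A) (grayProj B C).toPseudofunctor) = Pseudofunctor.id _ := by
      rw [← prodMap_comp, cub_proj, id_comp, prodMap_id]
    have e₄ : (cub A (GrayTensor B C)).comp ((grayProj A (GrayTensor B C)).comp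
        (prodStrict (.id A) (grayProj B C))).toPseudofunctor =
      prodMap (Pseudofunctor.id A) (grayProj B C).toPseudofunctor := cub_proj_comp _
    rw [comp_assoc, comp_assoc, e₁, cub_proj_comp, ← comp_assoc, e₂, comp_assoc, comp_assoc, e₄,
      e₃, id_comp, comp_id]
  · rename_i x y
    refine (Strict.assoc (grayLeft f.1.1 ⟨⟨(x.1.2, x.2)⟩⟩) (grayRight _ (grayLeft f.1.2 x.2))
      (grayRight _ (grayRight _ f.2))).trans ?_
    exact congrArg (fun t => grayLeft f.1.1 (⟨⟨(x.1.2, x.2)⟩⟩ : GrayTensor B C) ≫ t)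
      (grayRight_comp y.1.1 (grayLeft f.1.2 x.2) (grayRight y.1.2 f.2)).symm

variable (A) in
theorem cub_leftUnitor : (prodMap (Pseudofunctor.id One.{u}) (Pseudofunctor.id A)).comp
      ((cub One A).comp ((grayProj One A).comp (Bicategory.Prod.snd One A)).toPseudofunctor) =
    prodSnd One A := by
  rw [prodMap_id, id_comp]
  exact cub_proj_comp _

variable (A) in
theorem cub_rightUnitor : (prodMap (Pseudofunctor.id A) (Pseudofunctor.id One.{u})).comp
      ((cub A One).comp ((grayProj A One).comp (Bicategory.Prod.fst A One)).toPseudofunctor) =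
    prodFst A One := by
  rw [prodMap_id, id_comp]
  exact cub_proj_comp _

theorem incl_isCatLaxMonoidal : IsCatLaxMonoidal grayMonoidal.{u} iconMonoidal.{u} incl cubHom
    (𝟙 iconMonoidal.unit) where
  source := grayMonoidal_isStronglyMonoidal
  target := iconMonoidal_isStronglyMonoidal
  functor := incl_isTwoFunctor
  natural := incl_natural
  associativity A B C := cub_assoc A B C
  left_unitality A := cub_leftUnitor A
  right_unitality A := cub_rightUnitor A

variable (A B) in
/-- All constraints of `cub A B` lie over identities, so those between equal 1-cells are
identities. -/
theorem cub_isCubical : IsCubical (cub A B) where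
  mapId x := by
    have h : (cub A B).map (𝟙 x) = 𝟙 ((cub A B).obj x) := by
      change grayLeft (𝟙 x.1) x.2 ≫ grayRight x.1 (𝟙 x.2) = 𝟙 _
      rw [grayLeft_id, grayRight_id, Strict.id_comp]
    exact ⟨h, grayLFF.isoOfEq_eq h⟩
  mapComp_left {a a'} f b y q := by
    have h : (cub A B).map ((f ×ₘ 𝟙 b) ≫ q) = (cub A B).map (f ×ₘ 𝟙 b) ≫ (cub A B).map q := by
      change grayLeft (f ≫ q.1) b ≫ grayRight y.1 (𝟙 b ≫ q.2) =
        (grayLeft f b ≫ grayRight a' (𝟙 b)) ≫ grayLeft q.1 b ≫ grayRight y.1 q.2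
      rw [grayRight_id, Strict.comp_id, Strict.id_comp, grayLeft_comp, Strict.assoc]
    exact ⟨h, grayLFF.isoOfEq_eq h⟩
  mapComp_right {x} a b b' p g := by
    have h : (cub A B).map (p ≫ (𝟙 a ×ₘ g)) = (cub A B).map p ≫ (cub A B).map (𝟙 a ×ₘ g) := by
      change grayLeft (p.1 ≫ 𝟙 a) x.2 ≫ grayRight a (p.2 ≫ g) =
        (grayLeft p.1 x.2 ≫ grayRight a p.2) ≫ grayLeft (𝟙 a) b ≫ grayRight a g
      rw [grayLeft_id, Strict.comp_id, Strict.id_comp, grayRight_comp, Strict.assoc]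
    exact ⟨h, grayLFF.isoOfEq_eq h⟩

end Cubical

/-! ### Replacing the values of a pseudofunctor on 1-cells by isomorphic ones -/

section Rectified

/-- Isomorphisms onto images under `H`, composed by means of the constraints of `H`, compose
associatively. -/
theorem mapComp_conj_assoc {X : Type*} [Bicategory X] {C : Type*} [Bicategory C]
    (H : X ⥤ᵖ C) {x y z t : X} {p : x ⟶ y} {q : y ⟶ z} {r : z ⟶ t}
    {k : H.obj x ⟶ H.obj y} {l : H.obj y ⟶ H.obj z}
    {m : H.obj z ⟶ H.obj t} (κ : k ⟶ H.map p) (μ : l ⟶ H.map q) (ν : m ⟶ H.map r) :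
    ((κ ▷ l ≫ H.map p ◁ μ ≫ (H.mapComp p q).inv) ▷ m ≫ H.map (p ≫ q) ◁ ν ≫
      (H.mapComp (p ≫ q) r).inv) ≫ H.map₂ (α_ p q r).hom =
    (α_ k l m).hom ≫ κ ▷ (l ≫ m) ≫ H.map p ◁ (μ ▷ m ≫ H.map q ◁ ν ≫ (H.mapComp q r).inv) ≫
      (H.mapComp p (q ≫ r)).inv := by
  rw [H.map₂_associator]
  simp only [Category.assoc, Iso.inv_hom_id_assoc, comp_whiskerRight, whiskerLeft_comp]
  rw [whisker_exchange_assoc, inv_hom_whiskerRight_assoc]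
  simp only [associator_naturality_right_assoc, associator_naturality_middle_assoc,
    associator_naturality_left_assoc]

variable {X : Type u} [Bicategory.{w, v} X] [Strict X] {C : Type u'} [Bicategory.{w', v'} C]
  [Strict C]

/-- The objects of the source of a pseudofunctor `H : X ⥤ᵖ C`, as objects of the category whose
1-cells are the 1-cells of `X` equipped with a 1-cell isomorphic to their image under `H`. -/
structure Rectified (H : X ⥤ᵖ C) where
  as : X

namespace Rectified

/-- A 1-cell of `X` equipped with a 1-cell of `C` isomorphic to its image under `H`. -/
structure Hom {H : X ⥤ᵖ C} (x y : Rectified H) where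
  base : x.as ⟶ y.as
  value : H.obj x.as ⟶ H.obj y.as
  iso : value ≅ H.map base

variable {H : X ⥤ᵖ C}

theorem Hom.hext {x y : Rectified H} {p q : Hom x y} (h : p.base = q.base) (h' : p.value = q.value)
    (hi : HEq p.iso.hom q.iso.hom) : p = q := by
  obtain ⟨p, k, κ⟩ := p
  obtain ⟨q, l, ν⟩ := q
  obtain rfl : p = q := h
  obtain rfl : k = l := h'
  obtain rfl : κ = ν := Iso.ext (eq_of_heq hi)
  rfl

/-- The composite, with the constraints of `H` used to compose the isomorphisms. -/
def Hom.comp {x y z : Rectified H} (p : Hom x y) (q : Hom y z) : Hom x z where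
  base := p.base ≫ q.base
  value := p.value ≫ q.value
  iso := whiskerRightIso p.iso q.value ≪≫ whiskerLeftIso (H.map p.base) q.iso ≪≫
    (H.mapComp p.base q.base).symm

instance : Category (Rectified H) where
  Hom x y := Hom x y
  id x := ⟨𝟙 x.as, 𝟙 (H.obj x.as), (H.mapId x.as).symm⟩
  comp p q := p.comp q
  id_comp {x y} p := by
    refine Hom.hext (Strict.id_comp _) (Strict.id_comp _) ?_
    have e : ((H.mapId x.as).inv ▷ p.value ≫ H.map (𝟙 x.as) ◁ p.iso.hom ≫
        (H.mapComp (𝟙 x.as) p.base).inv) ≫ H.map₂ (λ_ p.base).hom =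
          (λ_ p.value).hom ≫ p.iso.hom := by
      rw [H.map₂_left_unitor]
      simp [← whisker_exchange_assoc]
    rw [Strict.leftUnitor_eqToIso, Strict.leftUnitor_eqToIso, eqToIso.hom, eqToIso.hom,
      PrelaxFunctor.map₂_eqToHom] at e
    exact (comp_eqToHom_heq₂ _ _).symm.trans ((heq_of_eq e).trans (eqToHom_comp_heq₂ _ _))
  comp_id {x y} p := by
    refine Hom.hext (Strict.comp_id _) (Strict.comp_id _) ?_
    have e : (p.iso.hom ▷ 𝟙 _ ≫ H.map p.base ◁ (H.mapId y.as).inv ≫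
        (H.mapComp p.base (𝟙 y.as)).inv) ≫ H.map₂ (ρ_ p.base).hom =
          (ρ_ p.value).hom ≫ p.iso.hom := by
      rw [H.map₂_right_unitor]
      simp
    rw [Strict.rightUnitor_eqToIso, Strict.rightUnitor_eqToIso, eqToIso.hom, eqToIso.hom,
      PrelaxFunctor.map₂_eqToHom] at e
    exact (comp_eqToHom_heq₂ _ _).symm.trans ((heq_of_eq e).trans (eqToHom_comp_heq₂ _ _))
  assoc {x y z t} p q r := by
    refine Hom.hext (Strict.assoc _ _ _) (Strict.assoc _ _ _) ?_
    have e := mapComp_conj_assoc H p.iso.hom q.iso.hom r.iso.hom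
    rw [Strict.associator_eqToIso, Strict.associator_eqToIso, eqToIso.hom, eqToIso.hom,
      PrelaxFunctor.map₂_eqToHom] at e
    exact (comp_eqToHom_heq₂ _ _).symm.trans ((heq_of_eq e).trans (eqToHom_comp_heq₂ _ _))

variable (H)

/-- The projection of the 1-cells to `X`. -/
def real : Realization (Rectified H) X :=
  .ofStrict (fun x => x.as) (fun p => Hom.base p) (fun _ => rfl) (fun _ _ => rfl)

/-- The 2-functor to `X`, which is the identity on 2-cells. -/
def proj : StrictPseudofunctor (Full (real H)) X :=
  Full.evStrict (real H) (fun _ => ⟨rfl, rfl⟩) (fun _ _ => ⟨rfl, rfl⟩)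

/-- The 2-functor to `X` is locally fully faithful. -/
def projLFF : LFF (proj H) where
  lift η := η
  map_lift _ := rfl
  lift_map _ := rfl

/-- The action on 2-cells of the 2-functor to `C`. -/
def evalMap₂ {x y : Rectified H} {p q : Hom x y} (η : p.base ⟶ q.base) : p.value ⟶ q.value :=
  p.iso.hom ≫ H.map₂ η ≫ q.iso.inv

theorem evalMap₂_comp {x y : Rectified H} {p q r : Hom x y} (η : p.base ⟶ q.base)
    (θ : q.base ⟶ r.base) : evalMap₂ H (p := p) (q := r) (η ≫ θ) = evalMap₂ H η ≫ evalMap₂ H θ := by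
  simp [evalMap₂]

theorem evalMap₂_wl {x y z : Rectified H} (f : Hom x y) {p q : Hom y z} (η : p.base ⟶ q.base) :
    evalMap₂ H (p := f.comp p) (q := f.comp q) (f.base ◁ η) = f.value ◁ evalMap₂ H η := by
  change (f.iso.hom ▷ p.value ≫ H.map f.base ◁ p.iso.hom ≫ (H.mapComp f.base p.base).inv) ≫
    H.map₂ (f.base ◁ η) ≫ ((H.mapComp f.base q.base).hom ≫ H.map f.base ◁ q.iso.inv) ≫
      f.iso.inv ▷ q.value = f.value ◁ (p.iso.hom ≫ H.map₂ η ≫ q.iso.inv)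
  rw [H.map₂_whisker_left]
  simp only [Category.assoc, Iso.inv_hom_id_assoc, ← whiskerLeft_comp_assoc]
  rw [whisker_exchange, hom_inv_whiskerRight_assoc]

theorem evalMap₂_wr {x y z : Rectified H} {p q : Hom x y} (η : p.base ⟶ q.base) (f : Hom y z) :
    evalMap₂ H (p := p.comp f) (q := q.comp f) (η ▷ f.base) = evalMap₂ H η ▷ f.value := by
  change (p.iso.hom ▷ f.value ≫ H.map p.base ◁ f.iso.hom ≫ (H.mapComp p.base f.base).inv) ≫
    H.map₂ (η ▷ f.base) ≫ ((H.mapComp q.base f.base).hom ≫ H.map q.base ◁ f.iso.inv) ≫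
      q.iso.inv ▷ f.value = (p.iso.hom ≫ H.map₂ η ≫ q.iso.inv) ▷ f.value
  rw [H.map₂_whisker_right]
  simp only [Category.assoc, Iso.inv_hom_id_assoc, whisker_exchange_assoc, comp_whiskerRight]
  simp

/-- The 2-functor to `C` which takes the chosen value on each 1-cell and acts on 2-cells by `H`
conjugated by the chosen isomorphisms. -/
def eval : StrictPseudofunctor (Full (real H)) C := .mk''
  { obj x := H.obj x.as.as
    map p := Hom.value p
    map₂ η := evalMap₂ H (Full.under η)
    map₂_id p := by
      change p.iso.hom ≫ H.map₂ (𝟙 p.base) ≫ p.iso.inv = 𝟙 p.value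
      simp
    map₂_comp η θ := evalMap₂_comp H (Full.under η) (Full.under θ)
    map_id _ := rfl
    map_comp _ _ := rfl
    map₂_whisker_left f p q η := by
      refine Eq.trans ?_ (Category.id_comp _).symm
      refine Eq.trans ?_ (Category.comp_id _).symm
      have e : Full.under (f ◁ η) = 𝟙 _ ≫ Hom.base f ◁ Full.under η ≫ 𝟙 _ := rfl
      rw [Category.id_comp, Category.comp_id] at e
      refine (congrArg (fun t => evalMap₂ H t) e).trans ?_
      exact evalMap₂_wl H f (Full.under η)
    map₂_whisker_right η f := by
      refine Eq.trans ?_ (Category.id_comp _).symm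
      refine Eq.trans ?_ (Category.comp_id _).symm
      have e : Full.under (η ▷ f) = 𝟙 _ ≫ Full.under η ▷ Hom.base f ≫ 𝟙 _ := rfl
      rw [Category.id_comp, Category.comp_id] at e
      refine (congrArg (fun t => evalMap₂ H t) e).trans ?_
      exact evalMap₂_wr H (Full.under η) f }

variable {H}

/-- A 1-cell of `X` together with its actual image under `H`. -/
def of {x y : X} (p : x ⟶ y) : (⟨x⟩ : Rectified H) ⟶ ⟨y⟩ := Hom.mk p (H.map p) (Iso.refl _)

/-- Taking the actual images under `H` preserves an identity as soon as `H` does so strictly. -/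
theorem of_id (x : X) (h : ∃ h : H.map (𝟙 x) = 𝟙 (H.obj x), H.mapId x = eqToIso h) :
    of (𝟙 x) = 𝟙 (⟨x⟩ : Rectified H) := by
  obtain ⟨h, e⟩ := h
  refine Hom.hext rfl h ?_
  change HEq (𝟙 (H.map (𝟙 x))) (H.mapId x).inv
  rw [e, eqToIso.inv]
  exact (id₂_heq rfl rfl (heq_of_eq h)).trans (eqToHom₂_heq _).symm

/-- Taking the actual images under `H` preserves a composite as soon as `H` does so strictly. -/
theorem of_comp {x y z : X} (p : x ⟶ y) (q : y ⟶ z)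
    (h : ∃ h : H.map (p ≫ q) = H.map p ≫ H.map q, H.mapComp p q = eqToIso h) :
    (of (p ≫ q) : (⟨x⟩ : Rectified H) ⟶ ⟨z⟩) = of p ≫ of q := by
  obtain ⟨h, e⟩ := h
  refine Hom.hext rfl h ?_
  change HEq (𝟙 (H.map (p ≫ q))) (𝟙 (H.map p) ▷ H.map q ≫ H.map p ◁ 𝟙 (H.map q) ≫
    (H.mapComp p q).inv)
  rw [e, eqToIso.inv, id_whiskerRight, whiskerLeft_id, Category.id_comp, Category.id_comp]
  exact (id₂_heq rfl rfl (heq_of_eq h)).trans (eqToHom₂_heq _).symm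

/-- Between actual images, `eval` acts on 2-cells as `H`. -/
theorem evalMap₂_of {x y : X} {p q : (⟨x⟩ : Rectified H) ⟶ ⟨y⟩} {f g : x ⟶ y} (hp : p = of f)
    (hq : q = of g) {ζ : Hom.base p ⟶ Hom.base q} {η : f ⟶ g} (h : HEq ζ η) :
    HEq (evalMap₂ H ζ) (H.map₂ η) := by
  subst hp hq
  obtain rfl : ζ = η := eq_of_heq h
  exact heq_of_eq ((Category.id_comp _).trans (Category.comp_id _))

/-- The 2-functor `eval` sends the 2-cell over an identity, from a composite of actual images to the
actual image of the composite, to the constraint of `H`. -/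
theorem evalMap₂_mapComp {x y z : X} {p q : (⟨x⟩ : Rectified H) ⟶ ⟨z⟩} {f : x ⟶ y} {g : y ⟶ z}
    (hp : p = (of f : _ ⟶ (⟨y⟩ : Rectified H)) ≫ of g) (hq : q = of (f ≫ g))
    {ζ : Hom.base p ⟶ Hom.base q} (h : HEq ζ (𝟙 (f ≫ g))) :
    HEq (evalMap₂ H ζ) (H.mapComp f g).inv := by
  subst hp hq
  obtain rfl : ζ = 𝟙 (f ≫ g) := eq_of_heq h
  refine heq_of_eq ?_
  change (𝟙 (H.map f) ▷ H.map g ≫ H.map f ◁ 𝟙 (H.map g) ≫ (H.mapComp f g).inv) ≫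
    H.map₂ (𝟙 (f ≫ g)) ≫ 𝟙 _ = _
  simp

end Rectified

end Rectified

/-! ### The universal property of the Gray tensor product -/

section Universal

variable {A : Type u} [Bicategory.{u, u} A] [Strict A] {B : Type u} [Bicategory.{u, u} B] [Strict B]
  {C : Type u} [Bicategory.{u, u} C] [Strict C]

section Existence

variable {H : (A × B) ⥤ᵖ C} (hH : IsCubical H)

/-- The action on 1-cells of the extension of a cubical functor: a generator is sent to its image
under `H`, and `H` provides the isomorphism with the image of the composite for each formal
composite of generators. -/
def cubLift₁ : Funny A B ⥤ Rectified H :=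
  Funny.liftFunctor (fun x => ⟨x⟩) (fun f b => Rectified.of (f ×ₘ 𝟙 b))
    (fun a _ _ g => Rectified.of (𝟙 a ×ₘ g))
    (fun a b => Rectified.of_id (a, b) (hH.mapId (a, b)))
    (fun f f' b => by
      have e : ((f ≫ f') ×ₘ 𝟙 b) = (f ×ₘ 𝟙 b) ≫ (f' ×ₘ 𝟙 b) :=
        Prod.ext rfl (Strict.id_comp _).symm
      rw [e]
      exact Rectified.of_comp _ _ (hH.mapComp_left f b _))
    (fun a b => Rectified.of_id (a, b) (hH.mapId (a, b)))
    (fun a _ _ _ g g' => by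
      have e : (𝟙 a ×ₘ (g ≫ g')) = (𝟙 a ×ₘ g) ≫ (𝟙 a ×ₘ g') :=
        Prod.ext (Strict.id_comp _).symm rfl
      rw [e]
      exact Rectified.of_comp _ _ (hH.mapComp_right a _ g'))

theorem cubLift₁_base {x y : Funny A B} (p : x ⟶ y) :
    Rectified.Hom.base ((cubLift₁ hH).map p) = (grayReal A B).map p := by
  have key {x y : A × B} (w : Word x y) : Rectified.Hom.base ((cubLift₁ hH).map
      (Funny.cls (x := ⟨x⟩) (y := ⟨y⟩) w)) = w.eval := by
    induction w with
    | id x => rfl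
    | comp p q hp hq => exact congrArg₂ (· ≫ ·) hp hq
    | left f b => rfl
    | right a g => rfl
  obtain ⟨w⟩ := p
  exact key w

theorem cubLift₁_cub {x y : A × B} (f : x ⟶ y) :
    (cubLift₁ hH).map ((cub A B).map f) = Rectified.of f := by
  have e : f = (f.1 ×ₘ 𝟙 x.2) ≫ (𝟙 y.1 ×ₘ f.2) :=
    Prod.ext (Strict.comp_id _).symm (Strict.id_comp _).symm
  refine Eq.trans ?_ (congrArg Rectified.of e.symm)
  exact (Rectified.of_comp _ _ (hH.mapComp_left f.1 x.2 (𝟙 y.1 ×ₘ f.2))).symm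

/-- The 2-functor to the 2-category of rectified 1-cells determined by a cubical functor. -/
def cubLift : StrictPseudofunctor (GrayTensor A B) (Full (Rectified.real H)) :=
  (Rectified.projLFF H).liftStrict (grayProj A B) (fun x => ⟨⟨x.as.as⟩⟩)
    (fun {x y} p => (cubLift₁ hH).map (X := x.as) (Y := y.as) p) (fun _ => rfl)
    (fun p => heq_of_eq (cubLift₁_base hH p)) (fun x => (cubLift₁ hH).map_id x.as)
    (fun {x y z} p q => (cubLift₁ hH).map_comp (X := x.as) (Y := y.as) (Z := z.as) p q)

theorem cubLift_proj : (cubLift hH).comp (Rectified.proj H) = grayProj A B :=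
  LFF.liftStrict_comp (Rectified.projLFF H) (grayProj A B) (fun x => ⟨⟨x.as.as⟩⟩)
    (fun {x y} p => (cubLift₁ hH).map (X := x.as) (Y := y.as) p) (fun _ => rfl)
    (fun p => heq_of_eq (cubLift₁_base hH p)) (fun x => (cubLift₁ hH).map_id x.as)
    (fun {x y z} p q => (cubLift₁ hH).map_comp (X := x.as) (Y := y.as) (Z := z.as) p q)

theorem cubLift_map₂_heq {x y : GrayTensor A B} {p q : x ⟶ y} (η : p ⟶ q) :
    HEq (Full.under ((cubLift hH).map₂ η)) ((grayProj A B).map₂ η) :=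
  pseudofunctor_map₂_congr (congr_toPs (cubLift_proj hH)) η

/-- The 2-functor out of the Gray tensor product determined by a cubical functor. -/
def cubExtend : StrictPseudofunctor (GrayTensor A B) C := (cubLift hH).comp (Rectified.eval H)

/-- The extension restricts to `H` along the universal cubical functor: on 1-cells since `H` is
strict on composites `(f, 1) ≫ (1, g)`, and on constraints since those of `cub A B` lie over
identities and are evaluated by means of the constraints of `H`. -/
theorem cub_comp_cubExtend : (cub A B).comp (cubExtend hH).toPseudofunctor = H := by
  have hmap {x y : A × B} (f : x ⟶ y) : (cubExtend hH).map ((cub A B).map f) = H.map f :=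
    congrArg Rectified.Hom.value (cubLift₁_cub hH f)
  refine pseudofunctor_hext (fun _ => rfl) (fun f => heq_of_eq (hmap f)) (fun {a b f g} η => ?_)
    (fun a => ?_) (fun {a b c} f g => ?_)
  · exact Rectified.evalMap₂_of (cubLift₁_cub hH f) (cubLift₁_cub hH g)
      ((cubLift_map₂_heq hH _).trans (pseudofunctor_map₂_congr (cub_proj A B) η))
  · obtain ⟨h, e⟩ := (cub_isCubical A B).mapId a
    obtain ⟨h', e'⟩ := hH.mapId a
    refine (comp_strict_mapId_heq _ _ a).trans ?_
    rw [e, e', eqToIso.inv, eqToIso.inv, PrelaxFunctor.map₂_eqToHom]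
    refine eqToHom_heq_eqToHom₂ rfl rfl _ _ (heq_of_eq ((cubExtend hH).map_id _))
  · refine (comp_strict_mapComp_heq _ _ f g).trans ?_
    refine Rectified.evalMap₂_mapComp (((cubLift₁ hH).map_comp _ _).trans
      (congrArg₂ _ (cubLift₁_cub hH f) (cubLift₁_cub hH g))) (cubLift₁_cub hH (f ≫ g))
      ((cubLift_map₂_heq hH _).trans ?_)
    refine (heq_of_eq (grayLFF.map_isoOfEq_inv _)).trans ((eqToHom₂_heq _).trans ?_)
    exact id₂_heq rfl rfl (heq_of_eq (((grayProj A B).map_comp _ _).trans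
      (congrArg₂ _ (grayProj_cub f) (grayProj_cub g))))

end Existence

section Uniqueness

theorem iso_inv_heq {S : Type*} [Bicategory S] {a b a' b' : S} (ha : a = a') (hb : b = b')
    {p q : a ⟶ b} {p' q' : a' ⟶ b'} (hp : HEq p p') (hq : HEq q q') {σ : p ≅ q} {τ : p' ≅ q'}
    (h : HEq σ.hom τ.hom) : HEq σ.inv τ.inv := by
  subst ha hb; cases hp; cases hq
  obtain rfl : σ = τ := Iso.ext (eq_of_heq h)
  rfl

theorem cub_left {a a' : A} (f : a ⟶ a') (b : B) :
    (cub A B).map (f ×ₘ 𝟙 b) = grayLeft f b := by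
  change grayLeft f b ≫ grayRight a' (𝟙 b) = grayLeft f b
  rw [grayRight_id, Strict.comp_id]

theorem cub_right (a : A) {b b' : B} (g : b ⟶ b') :
    (cub A B).map (𝟙 a ×ₘ g) = grayRight a g := by
  change grayLeft (𝟙 a) b ≫ grayRight a g = grayRight a g
  rw [grayLeft_id, Strict.id_comp]

/-- The normal form `(f ⊗ 1) ≫ (1 ⊗ g)` of a 1-cell of the Gray tensor product with projections
`f` and `g`. -/
def normal {x y : GrayTensor A B} (p : x ⟶ y) : x ⟶ y := (cub A B).map ((grayProj A B).map p)

/-- The 2-cell between normal forms with the same projections as a given 2-cell. -/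
def normal₂ {x y : GrayTensor A B} {p q : x ⟶ y} (η : p ⟶ q) : normal p ⟶ normal q :=
  (cub A B).map₂ ((grayProj A B).map₂ η)

/-- The comparison of a composite of normal forms with the normal form of the composite. -/
def normalComp {x y z : GrayTensor A B} (p : x ⟶ y) (q : y ⟶ z) :
    normal p ≫ normal q ⟶ normal (p ≫ q) :=
  ((cub A B).mapComp ((grayProj A B).map p) ((grayProj A B).map q)).inv ≫
    eqToHom (congrArg (cub A B).map ((grayProj A B).map_comp p q).symm)

theorem proj_normal {x y : GrayTensor A B} (p : x ⟶ y) :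
    (grayProj A B).map (normal p) = (grayProj A B).map p := grayProj_cub _

/-- The canonical isomorphism between a 1-cell of the Gray tensor product and its normal form. -/
def toNormal {x y : GrayTensor A B} (p : x ⟶ y) : p ≅ normal p :=
  grayLFF.isoOfEq (proj_normal p).symm

theorem proj_normalComp {x y z : GrayTensor A B} (p : x ⟶ y) (q : y ⟶ z) :
    (grayProj A B).map₂ (normalComp p q) = eqToHom (by
      rw [proj_normal, StrictPseudofunctor.map_comp, proj_normal, proj_normal,
        StrictPseudofunctor.map_comp]) :=
  (PrelaxFunctor.map₂_comp (grayProj A B).toPrelaxFunctor _ _).trans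
    ((congrArg₂ (· ≫ ·) (grayLFF.map_isoOfEq_inv _)
      (PrelaxFunctor.map₂_eqToHom (grayProj A B).toPrelaxFunctor _ _ _)).trans (eqToHom_trans _ _))

/-- The normal form of a composite is reached by normalizing both factors and applying a
constraint of the universal cubical functor. -/
theorem toNormal_comp {x y z : GrayTensor A B} (p : x ⟶ y) (q : y ⟶ z) :
    (toNormal (p ≫ q)).hom =
      (toNormal p).hom ▷ q ≫ normal p ◁ (toNormal q).hom ≫ normalComp p q := by
  refine grayLFF.ext ?_
  have e {x y : GrayTensor A B} (p : x ⟶ y) : (grayProj A B).map₂ (toNormal p).hom =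
    eqToHom (proj_normal p).symm := grayLFF.map_isoOfEq_hom _
  rw [PrelaxFunctor.map₂_comp, PrelaxFunctor.map₂_comp, strict_wl, strict_wr, proj_normalComp,
    e, e, e]
  simp only [whiskerLeft_eqToHom, eqToHom_whiskerRight, eqToHom_trans]

theorem eq_conj_toNormal {x y : GrayTensor A B} {p q : x ⟶ y} (η : p ⟶ q) :
    η = (toNormal p).hom ≫ normal₂ η ≫ (toNormal q).inv := by
  refine grayLFF.ext ?_
  have e₁ : (grayProj A B).map₂ (toNormal p).hom = eqToHom _ := grayLFF.map_isoOfEq_hom _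
  have e₂ : (grayProj A B).map₂ (toNormal q).inv = eqToHom _ := grayLFF.map_isoOfEq_inv _
  rw [PrelaxFunctor.map₂_comp, PrelaxFunctor.map₂_comp, e₁, e₂]
  exact eq_conj_of_heq _ _ (pseudofunctor_map₂_congr (cub_proj A B) _).symm

variable {C : Type*} [Bicategory C] {K K' : StrictPseudofunctor (GrayTensor A B) C}

/-- The 2-cells on which two 2-functors agree are closed under vertical composition. -/
theorem strict_comp_heq {D S : Type*} [Bicategory D] [Bicategory S] {K K' : StrictPseudofunctor D S}
    (ho : ∀ x, K.obj x = K'.obj x) (h₁ : ∀ {x y : D} (p : x ⟶ y), HEq (K.map p) (K'.map p))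
    {x y : D} {p q r : x ⟶ y} {η : p ⟶ q} {θ : q ⟶ r} (hη : HEq (K.map₂ η) (K'.map₂ η))
    (hθ : HEq (K.map₂ θ) (K'.map₂ θ)) : HEq (K.map₂ (η ≫ θ)) (K'.map₂ (η ≫ θ)) := by
  rw [PrelaxFunctor.map₂_comp, PrelaxFunctor.map₂_comp]
  exact comp₂_heq (ho _) (ho _) (h₁ _) (h₁ _) (h₁ _) hη hθ

theorem strict_wl_heq {D S : Type*} [Bicategory D] [Bicategory S] {K K' : StrictPseudofunctor D S}
    (ho : ∀ x, K.obj x = K'.obj x) (h₁ : ∀ {x y : D} (p : x ⟶ y), HEq (K.map p) (K'.map p))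
    {x y z : D} (f : x ⟶ y) {p q : y ⟶ z} {η : p ⟶ q} (hη : HEq (K.map₂ η) (K'.map₂ η)) :
    HEq (K.map₂ (f ◁ η)) (K'.map₂ (f ◁ η)) := by
  rw [strict_wl, strict_wl]
  exact (conj_heq _ _ _).trans ((wl_heq (ho _) (ho _) (ho _) (h₁ _) (h₁ _) (h₁ _) hη).trans
    (conj_heq _ _ _).symm)

theorem strict_wr_heq {D S : Type*} [Bicategory D] [Bicategory S] {K K' : StrictPseudofunctor D S}
    (ho : ∀ x, K.obj x = K'.obj x) (h₁ : ∀ {x y : D} (p : x ⟶ y), HEq (K.map p) (K'.map p))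
    {x y z : D} {p q : x ⟶ y} {η : p ⟶ q} (hη : HEq (K.map₂ η) (K'.map₂ η)) (f : y ⟶ z) :
    HEq (K.map₂ (η ▷ f)) (K'.map₂ (η ▷ f)) := by
  rw [strict_wr, strict_wr]
  exact (conj_heq _ _ _).trans ((wr_heq (ho _) (ho _) (ho _) (h₁ _) (h₁ _) (h₁ _) hη).trans
    (conj_heq _ _ _).symm)

theorem strict_eqToHom_heq {D S : Type*} [Bicategory D] [Bicategory S]
    {K K' : StrictPseudofunctor D S} (ho : ∀ x, K.obj x = K'.obj x)
    (h₁ : ∀ {x y : D} (p : x ⟶ y), HEq (K.map p) (K'.map p))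
    {x y : D} {p q : x ⟶ y} (h : p = q) : HEq (K.map₂ (eqToHom h)) (K'.map₂ (eqToHom h)) := by
  rw [PrelaxFunctor.map₂_eqToHom, PrelaxFunctor.map₂_eqToHom]
  exact eqToHom_heq_eqToHom₂ (ho _) (ho _) _ _ (h₁ _)

theorem strict_inv_heq {D S : Type*} [Bicategory D] [Bicategory S] {K K' : StrictPseudofunctor D S}
    (ho : ∀ x, K.obj x = K'.obj x) (h₁ : ∀ {x y : D} (p : x ⟶ y), HEq (K.map p) (K'.map p))
    {x y : D} {p q : x ⟶ y} {σ : p ≅ q} (h : HEq (K.map₂ σ.hom) (K'.map₂ σ.hom)) :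
    HEq (K.map₂ σ.inv) (K'.map₂ σ.inv) :=
  iso_inv_heq (σ := K.map₂Iso σ) (τ := K'.map₂Iso σ) (ho _) (ho _) (h₁ _) (h₁ _) h

/-- The canonical isomorphism with the normal form is composed of constraints of the universal
cubical functor, so that 2-functors agree on it as soon as they agree on the latter. -/
theorem map₂_toNormal_heq (h : (cub A B).comp K.toPseudofunctor = (cub A B).comp K'.toPseudofunctor)
    (ho : ∀ x, K.obj x = K'.obj x)
    (h₁ : ∀ {x y : GrayTensor A B} (p : x ⟶ y), HEq (K.map p) (K'.map p))
    {x y : GrayTensor A B} (p : x ⟶ y) :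
    HEq (K.map₂ (toNormal p).hom) (K'.map₂ (toNormal p).hom) := by
  have key {x y : A × B} (w : Word x y) :
      HEq (K.map₂ (toNormal (x := ⟨⟨x⟩⟩) (y := ⟨⟨y⟩⟩) (Funny.cls w)).hom)
        (K'.map₂ (toNormal (x := ⟨⟨x⟩⟩) (y := ⟨⟨y⟩⟩) (Funny.cls w)).hom) := by
    induction w with
    | id x =>
      have e := pseudofunctor_mapId_congr h x
      exact (comp_strict_mapId_heq _ K x).symm.trans (e.trans (comp_strict_mapId_heq _ K' x))
    | @comp x y z v w hv hw =>
      let p : (⟨⟨x⟩⟩ : GrayTensor A B) ⟶ ⟨⟨y⟩⟩ := Funny.cls (x := ⟨x⟩) (y := ⟨y⟩) v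
      let q : (⟨⟨y⟩⟩ : GrayTensor A B) ⟶ ⟨⟨z⟩⟩ := Funny.cls (x := ⟨y⟩) (y := ⟨z⟩) w
      change HEq (K.map₂ (toNormal (p ≫ q)).hom) (K'.map₂ (toNormal (p ≫ q)).hom)
      rw [toNormal_comp]
      refine strict_comp_heq ho h₁ (strict_wr_heq ho h₁ hv q) (strict_comp_heq ho h₁
        (strict_wl_heq ho h₁ _ hw) (strict_comp_heq ho h₁ ?_ (strict_eqToHom_heq ho h₁ _)))
      exact (comp_strict_mapComp_heq _ K _ _).symm.trans
        ((pseudofunctor_mapComp_congr h _ _).trans (comp_strict_mapComp_heq _ K' _ _))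
    | @left a a' f b =>
      have e : toNormal (grayLeft f b) = eqToIso (cub_left f b).symm := grayLFF.isoOfEq_eq _
      change HEq (K.map₂ (toNormal (grayLeft f b)).hom) (K'.map₂ (toNormal (grayLeft f b)).hom)
      rw [e]
      exact strict_eqToHom_heq ho h₁ (cub_left f b).symm
    | @right a b b' g =>
      have e : toNormal (grayRight a g) = eqToIso (cub_right a g).symm := grayLFF.isoOfEq_eq _
      change HEq (K.map₂ (toNormal (grayRight a g)).hom) (K'.map₂ (toNormal (grayRight a g)).hom)
      rw [e]
      exact strict_eqToHom_heq ho h₁ (cub_right a g).symm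
  obtain ⟨w⟩ := p
  exact key w

/-- A 2-functor out of the Gray tensor product is determined by its composite with the universal
cubical functor: every 2-cell is an image under the latter, conjugated by canonical isomorphisms
made of its constraints. -/
theorem cub_cancel {K K' : StrictPseudofunctor (GrayTensor A B) C}
    (h : (cub A B).comp K.toPseudofunctor = (cub A B).comp K'.toPseudofunctor) : K = K' := by
  have ho (x) : K.obj x = K'.obj x := pseudofunctor_obj_congr h x.as.as
  have h₁ {x y : GrayTensor A B} (p : x ⟶ y) : HEq (K.map p) (K'.map p) := by
    refine strict_gray_heq ho (fun f b => ?_) (fun a _ _ g => ?_) p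
    · rw [← cub_left]
      exact pseudofunctor_map_congr h _
    · rw [← cub_right]
      exact pseudofunctor_map_congr h _
  refine strict_hext ho h₁ (fun {x y p q} η => ?_)
  rw [eq_conj_toNormal η]
  exact strict_comp_heq ho h₁ (map₂_toNormal_heq h ho h₁ p) (strict_comp_heq ho h₁
    (pseudofunctor_map₂_congr h _) (strict_inv_heq ho h₁ (map₂_toNormal_heq h ho h₁ q)))

end Uniqueness

theorem cub_isUniversalCubical (A B : GrayCat.{u}) : IsUniversalCubical
    (T := grayMonoidal.tensor.obj (A, B)) (cubHom A B) where
  cubical := cub_isCubical A B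
  universal _ _ hH := ⟨cubExtend hH, cub_comp_cubExtend hH, fun _ h =>
    cub_cancel (h.trans (cub_comp_cubExtend hH).symm)⟩

end Universal

/-! ### 2-functors and icons out of a strictification -/

section Strictification

variable {B : Type u} [Bicategory.{w, v} B]

section Cancel

variable {S : Type*} [Bicategory S] {K K' : StrictPseudofunctor (St B) S}

theorem Str.appendIso_single_hom {a b c : B} (f : a ⟶ b) (p : Str b c) :
    (Str.appendIso (.cons f (.nil b)) p).hom = (Str.consIso f p).hom := by
  change (ρ_ f).inv ▷ Str.eval p ≫ (α_ f (𝟙 b) (Str.eval p)).hom ≫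
    f ◁ (λ_ (Str.eval p)).hom ≫ (Str.consIso f p).hom = _
  simp

/-- The canonical isomorphism between a string of 1-cells and the string of length one on its
composite. It is the identity in `B`. -/
def toSingle {x y : St B} (p : x ⟶ y) : p ≅ (stIncl B).map (Full.real p) where
  hom := 𝟙 (Full.real p)
  inv := 𝟙 (Full.real p)
  hom_inv_id := Category.id_comp (𝟙 (Full.real p))
  inv_hom_id := Category.id_comp (𝟙 (Full.real p))

/-- Composing a nonempty string in `B` amounts to composing its tail and applying a constraint of
`stIncl`. -/
theorem toSingle_cons {x y z : St B} (f : x.as.as ⟶ y.as.as) (p : y ⟶ z) :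
    (toSingle ((stIncl B).map f ≫ p)).hom = (stIncl B).map f ◁ (toSingle p).hom ≫
      ((stIncl B).mapComp f (Full.real p)).inv ≫ (stIncl B).map₂ (Str.consIso f p).hom := by
  change 𝟙 (Str.eval (Str.cons f p)) = ((Str.appendIso (.cons f (.nil _)) p).inv ≫
    f ◁ 𝟙 (Str.eval p) ≫ (Str.appendIso (.cons f (.nil _)) (.cons (Str.eval p) (.nil _))).hom) ≫
    𝟙 (f ≫ Str.eval p) ≫ (Str.consIso f p).hom
  have e : Str.appendIso (.cons f (.nil _)) p = Str.consIso f p :=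
    Iso.ext (Str.appendIso_single_hom f p)
  have key {X Y : x.as.as ⟶ z.as.as} (σ : X ≅ Y) : 𝟙 Y = (σ.inv ≫ 𝟙 X ≫ 𝟙 X) ≫ 𝟙 X ≫ σ.hom := by
    simp
  rw [appendIso_single, whiskerLeft_id]
  exact (key (Str.consIso f p)).trans (by rw [← e]; rfl)

theorem eq_conj_toSingle {x y : St B} {p q : x ⟶ y} (η : p ⟶ q) :
    η = (toSingle p).hom ≫ (stIncl B).map₂ (Full.under η) ≫ (toSingle q).inv :=
  ((Category.id_comp (Full.under η ≫ 𝟙 (Full.real q))).trans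
    (Category.comp_id (Full.under η))).symm

/-- The canonical isomorphism with a string of length one is composed of constraints of `stIncl`,
so that 2-functors agree on it as soon as they agree on the latter. -/
theorem map₂_toSingle_heq
    (h : (stIncl B).comp K.toPseudofunctor = (stIncl B).comp K'.toPseudofunctor)
    (ho : ∀ x, K.obj x = K'.obj x) (h₁ : ∀ {x y : St B} (p : x ⟶ y), HEq (K.map p) (K'.map p))
    {a b : B} (p : Str a b) : HEq (K.map₂ (toSingle (x := ⟨⟨a⟩⟩) (y := ⟨⟨b⟩⟩) p).hom)
      (K'.map₂ (toSingle (x := ⟨⟨a⟩⟩) (y := ⟨⟨b⟩⟩) p).hom) := by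
  induction p with
  | nil x =>
    exact (comp_strict_mapId_heq _ K x).symm.trans
      ((pseudofunctor_mapId_congr h x).trans (comp_strict_mapId_heq _ K' x))
  | @cons a b c f p hp =>
    have e := toSingle_cons (x := ⟨⟨a⟩⟩) (y := ⟨⟨b⟩⟩) (z := ⟨⟨c⟩⟩) f p
    refine (heq_of_eq (congrArg (fun t => K.map₂ t) e)).trans (HEq.trans ?_
      (heq_of_eq (congrArg (fun t => K'.map₂ t) e)).symm)
    refine strict_comp_heq ho h₁ (strict_wl_heq ho h₁ _ hp) (strict_comp_heq ho h₁ ?_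
      (pseudofunctor_map₂_congr h _))
    exact (comp_strict_mapComp_heq _ K _ _).symm.trans
        ((pseudofunctor_mapComp_congr h _ _).trans (comp_strict_mapComp_heq _ K' _ _))

/-- A 2-functor out of a strictification is determined by its composite with `stIncl`. -/
theorem stIncl_cancel
    (h : (stIncl B).comp K.toPseudofunctor = (stIncl B).comp K'.toPseudofunctor) : K = K' := by
  have ho (x) : K.obj x = K'.obj x := pseudofunctor_obj_congr h x.as.as
  have key {a b : B} (p : Str a b) : HEq (K.map (X := ⟨⟨a⟩⟩) (Y := ⟨⟨b⟩⟩) p)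
      (K'.map (X := ⟨⟨a⟩⟩) (Y := ⟨⟨b⟩⟩) p) := by
    induction p with
    | nil a =>
      exact (heq_of_eq (K.map_id ⟨⟨a⟩⟩)).trans ((id₁_heq (ho _)).trans
        (heq_of_eq (K'.map_id ⟨⟨a⟩⟩)).symm)
    | @cons a b c f p hp =>
      let q : (⟨⟨b⟩⟩ : St B) ⟶ ⟨⟨c⟩⟩ := p
      exact (heq_of_eq (K.map_comp ((stIncl B).map f) q)).trans ((comp₁_heq (ho _) (ho _) (ho _)
        (pseudofunctor_map_congr h f) hp).trans
        (heq_of_eq (K'.map_comp ((stIncl B).map f) q)).symm)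
  have h₁ {x y : St B} (p : x ⟶ y) : HEq (K.map p) (K'.map p) := key p
  refine strict_hext ho h₁ (fun {x y p q} η => ?_)
  rw [eq_conj_toSingle η]
  exact strict_comp_heq ho h₁ (map₂_toSingle_heq h ho h₁ p) (strict_comp_heq ho h₁
    (pseudofunctor_map₂_congr h _) (strict_inv_heq ho h₁ (map₂_toSingle_heq h ho h₁ q)))

theorem HCell.of_vcomp_cancel {C : Type*} [Bicategory C] {a b a' b' : C} {f g : a ⟶ b} {h : a' ⟶ b'}
    (σ : f ≅ g) {x y : HCell g h} (e : vcomp (of σ.hom) x = vcomp (of σ.hom) y) : x = y := by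
  have := congrArg (vcomp (of σ.inv)) e
  rwa [of_vcomp_of_vcomp, of_vcomp_of_vcomp, Iso.inv_hom_id, id_vcomp, id_vcomp] at this

/-- An icon between 2-functors out of a strictification is determined by its components at
strings of length one. -/
theorem stIncl_cancel_icon {F G : St B ⥤ᵖ S} {α β : Icon F G}
    (h : α.whiskerLeft (stIncl B) = β.whiskerLeft (stIncl B)) : α = β := by
  have key {a b : B} (p : Str a b) : α.app (a := ⟨⟨a⟩⟩) (b := ⟨⟨b⟩⟩) p =
      β.app (a := ⟨⟨a⟩⟩) (b := ⟨⟨b⟩⟩) p := by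
    induction p with
    | nil a =>
      exact HCell.of_vcomp_cancel (F.mapId ⟨⟨a⟩⟩).symm
        ((α.app_id ⟨⟨a⟩⟩).trans (β.app_id ⟨⟨a⟩⟩).symm)
    | @cons a b c f p hp =>
      let q : (⟨⟨b⟩⟩ : St B) ⟶ ⟨⟨c⟩⟩ := p
      refine HCell.of_vcomp_cancel (F.mapComp ((stIncl B).map f) q).symm
        ((α.app_comp ((stIncl B).map f) q).trans (Eq.trans ?_
          (β.app_comp ((stIncl B).map f) q).symm))
      have e : α.app ((stIncl B).map f) = β.app ((stIncl B).map f) :=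
        congrArg (fun γ : Icon _ _ => γ.app f) h
      exact congrArg₂ (fun t s => vcomp (hcomp t s) _) e hp
  refine Icon.ext ?_
  funext x y p
  exact key p

end Cancel

section Unit

variable {C : Type u'} [Bicategory.{w', v'} C]

theorem Str.evalMap_single (F : B ⥤ᵖ C) {a b : B} (f : a ⟶ b) :
    Str.evalMap F (.cons f (.nil b)) = Iso.refl _ := by
  refine Iso.ext ?_
  change (ρ_ (F.map f)).inv ≫ F.map f ◁ (F.mapId b).inv ≫ (F.mapComp f (𝟙 b)).inv ≫
    F.map₂ (ρ_ f).hom = 𝟙 (F.map f)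
  rw [F.map₂_right_unitor]
  simp

theorem Str.evalMap_pair (F : B ⥤ᵖ C) {a b c : B} (f : a ⟶ b) (g : b ⟶ c) :
    (Str.evalMap F (.cons f (.cons g (.nil c)))).hom = (F.mapComp f g).inv := by
  rw [Str.evalMap_cons, Str.evalMap_single]
  refine (Category.id_comp _).trans ((congrArg (· ≫ _) (whiskerLeft_id _ _)).trans
    ((Category.id_comp _).trans ?_))
  exact (congrArg (_ ≫ ·) (F.map₂_id (f ≫ g))).trans (Category.comp_id _)

theorem Str.map₂_single (F : B ⥤ᵖ C) {a b : B} {f g : a ⟶ b} (η : f ⟶ g) :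
    Str.map₂ F (p := .cons f (.nil b)) (q := .cons g (.nil b)) η = F.map₂ η := by
  change (Str.evalMap F (.cons f (.nil b))).hom ≫ F.map₂ η ≫
    (Str.evalMap F (.cons g (.nil b))).inv = F.map₂ η
  rw [Str.evalMap_single, Str.evalMap_single]
  exact (Category.id_comp _).trans (Category.comp_id _)

/-- Naturality of the unit in pseudofunctors, including their constraints. -/
theorem stIncl_natural (F : B ⥤ᵖ C) :
    F.comp (stIncl C) = (stIncl B).comp (stMap F).toPseudofunctor := by
  refine pseudofunctor_hext (fun _ => rfl) (fun _ => HEq.rfl)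
    (fun η => heq_of_eq (Str.map₂_single F η).symm) (fun a => ?_) (fun f g => ?_)
  · refine HEq.trans (heq_of_eq ?_) (comp_strict_mapId_heq (stIncl B) (stMap F) a).symm
    change 𝟙 (𝟙 (F.obj a)) ≫ (F.mapId a).inv =
      (F.mapId a).inv ≫ F.map₂ (𝟙 (𝟙 a)) ≫ (Str.evalMap F (.cons (𝟙 a) (.nil a))).inv
    rw [Str.evalMap_single, PrelaxFunctor.map₂_id]
    exact (Category.id_comp (F.mapId a).inv).trans ((congrArg ((F.mapId a).inv ≫ ·)
      (Category.id_comp (𝟙 (F.map (𝟙 a))))).trans (Category.comp_id (F.mapId a).inv)).symm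
  · refine HEq.trans (heq_of_eq ?_) (comp_strict_mapComp_heq (stIncl B) (stMap F) f g).symm
    change 𝟙 (F.map f ≫ F.map g) ≫ (F.mapComp f g).inv =
      (Str.evalMap F (.cons f (.cons g (.nil _)))).hom ≫ F.map₂ (𝟙 (f ≫ g)) ≫
      (Str.evalMap F (.cons (f ≫ g) (.nil _))).inv
    rw [Str.evalMap_single, Str.evalMap_pair]
    refine (Category.id_comp _).trans (Eq.trans ?_ (congrArg (fun t => (F.mapComp f g).inv ≫ t)
      ((congrArg (fun t => t ≫ 𝟙 (F.map (f ≫ g))) (F.map₂_id (f ≫ g))).trans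
        (Category.id_comp _))).symm)
    exact (Category.comp_id _).symm

theorem HCell.map_stIncl {a b a' b' : B} {f : a ⟶ b} {g : a' ⟶ b'} (c : HCell f g) :
    HCell.map (stIncl B) c = Full.hcell (p := (stIncl B).map f) (p' := (stIncl B).map g)
      (congrArg (fun c => (⟨⟨c⟩⟩ : St B)) c.src) (congrArg (fun c => (⟨⟨c⟩⟩ : St B)) c.tgt) c := by
  obtain rfl := c.src; obtain rfl := c.tgt
  obtain ⟨η, rfl⟩ := exists_of c
  rfl

theorem stIncl_natural₂ {F G : B ⥤ᵖ C} (α : Icon F G) :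
    HEq (α.whiskerRight (stIncl C)) ((stIcon α).whiskerLeft (stIncl B)) :=
  icon_heq (stIncl_natural F) (stIncl_natural G) fun f => heq_of_eq (HCell.map_stIncl (α.app f))

theorem stIncl_stEval (A : Type u) [Bicategory.{w, v} A] [Strict A] :
    (stIncl A).comp (stEval A).toPseudofunctor = Pseudofunctor.id A :=
  pseudofunctor_hext (fun _ => rfl) (fun _ => HEq.rfl) (fun _ => HEq.rfl)
    (fun a => comp_strict_mapId_heq (stIncl A) (stEval A) a)
    (fun f g => comp_strict_mapComp_heq (stIncl A) (stEval A) f g)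

end Unit

end Strictification

/-! ### 2-adjunctions from universal arrows -/

section Doctrinal

variable {A : Type u} [Bicategory.{w, v} A] [Strict A] {B : Type u'} [Bicategory.{w', v'} B]
  [Strict B]

section Strict

variable {S : Type*} [Bicategory S] [Strict S]

theorem id_wl_heq {a b : S} {f g : a ⟶ b} (η : f ⟶ g) : HEq (𝟙 a ◁ η) η := by
  rw [id_whiskerLeft, Strict.leftUnitor_eqToIso, Strict.leftUnitor_eqToIso, eqToIso.hom,
    eqToIso.inv]
  exact conj_heq _ _ _

theorem wr_id_heq {a b : S} {f g : a ⟶ b} (η : f ⟶ g) : HEq (η ▷ 𝟙 b) η := by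
  rw [whiskerRight_id, Strict.rightUnitor_eqToIso, Strict.rightUnitor_eqToIso, eqToIso.hom,
    eqToIso.inv]
  exact conj_heq _ _ _

theorem comp_wl_heq {a b c d : S} (f : a ⟶ b) (g : b ⟶ c) {h k : c ⟶ d} (η : h ⟶ k) :
    HEq ((f ≫ g) ◁ η) (f ◁ g ◁ η) := by
  rw [comp_whiskerLeft, Strict.associator_eqToIso, Strict.associator_eqToIso, eqToIso.hom,
    eqToIso.inv]
  exact conj_heq _ _ _

theorem wr_comp_heq {a b c d : S} {f g : a ⟶ b} (η : f ⟶ g) (h : b ⟶ c) (k : c ⟶ d) :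
    HEq (η ▷ (h ≫ k)) ((η ▷ h) ▷ k) := by
  rw [Bicategory.whiskerRight_comp, Strict.associator_eqToIso, Strict.associator_eqToIso,
    eqToIso.hom, eqToIso.inv]
  exact conj_heq _ _ _

theorem wl_wr_heq {a b c d : S} (f : a ⟶ b) {g h : b ⟶ c} (η : g ⟶ h) (k : c ⟶ d) :
    HEq ((f ◁ η) ▷ k) (f ◁ η ▷ k) := by
  rw [whisker_assoc, Strict.associator_eqToIso, Strict.associator_eqToIso, eqToIso.hom,
    eqToIso.inv]
  exact conj_heq _ _ _

theorem wl_heq' {a b c : S} {f f' : a ⟶ b} {p q p' q' : b ⟶ c} (hf : f = f') (hp : p = p')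
    (hq : q = q') {η : p ⟶ q} {η' : p' ⟶ q'} (hη : HEq η η') : HEq (f ◁ η) (f' ◁ η') :=
  wl_heq rfl rfl rfl (heq_of_eq hf) (heq_of_eq hp) (heq_of_eq hq) hη

theorem wr_heq' {a b c : S} {f f' : b ⟶ c} {p q p' q' : a ⟶ b} (hf : f = f') (hp : p = p')
    (hq : q = q') {η : p ⟶ q} {η' : p' ⟶ q'} (hη : HEq η η') : HEq (η ▷ f) (η' ▷ f') :=
  wr_heq rfl rfl rfl (heq_of_eq hf) (heq_of_eq hp) (heq_of_eq hq) hη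

end Strict

variable {F : PrelaxFunctorStruct A B} {U : PrelaxFunctorStruct B A}
  {η : ∀ x : A, x ⟶ U.obj (F.obj x)}
  {θ : ∀ y : B, F.obj (U.obj y) ⟶ y}

theorem IsTwoFunctor.map₂_id (h : IsTwoFunctor U) {a b : B} (f : a ⟶ b) :
    U.map₂ (𝟙 f) = 𝟙 (U.map f) := by
  obtain ⟨P, rfl⟩ := h
  exact P.map₂_id f

theorem IsTwoFunctor.map₂_comp (h : IsTwoFunctor U) {a b : B} {f g k : a ⟶ b} (α : f ⟶ g)
    (β : g ⟶ k) : U.map₂ (α ≫ β) = U.map₂ α ≫ U.map₂ β := by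
  obtain ⟨P, rfl⟩ := h
  exact P.map₂_comp α β

variable (F U η) in
/-- Composition with the 1-cells `η x : x ⟶ U (F x)` is injective on 1-cells and 2-cells: this is
the uniqueness half of the two-dimensional universal property of `η x` as an arrow from `x`
to `U`. -/
structure UnitDetermines : Prop where
  hom {x : A} {y : B} {f g : F.obj x ⟶ y} (h : η x ≫ U.map f = η x ≫ U.map g) : f = g
  hom₂ {x : A} {y : B} {f g : F.obj x ⟶ y} {α β : f ⟶ g}
    (h : η x ◁ U.map₂ α = η x ◁ U.map₂ β) : α = β

theorem UnitDetermines.heq (D : UnitDetermines F U η) {x : A} {y : B} {f g f' g' : F.obj x ⟶ y}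
    (hf : f = f') (hg : g = g') {α : f ⟶ g} {β : f' ⟶ g'}
    (h : HEq (η x ◁ U.map₂ α) (η x ◁ U.map₂ β)) : HEq α β := by
  subst hf hg
  exact heq_of_eq (D.hom₂ (eq_of_heq h))

/-- A 2-functor `U` with a 2-natural family of arrows `η` which determine the cells out of their
targets is a right 2-adjoint as soon as `θ` satisfies one of the triangle identities. -/
theorem UnitDetermines.isTwoAdjunction (D : UnitDetermines F U η) (hU : IsTwoFunctor U)
    (hη : IsTwoNatural (.id A) (F.comp U) η) (tri : ∀ y, η (U.obj y) ≫ U.map (θ y) = 𝟙 (U.obj y)) :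
    IsTwoAdjunction F U η θ := by
  have nat {a b : A} (f : a ⟶ b) : η a ≫ U.map (F.map f) = f ≫ η b := (hη.naturality f).symm
  have nat₂ {a b : A} {f g : a ⟶ b} (α : f ⟶ g) : HEq (η a ◁ U.map₂ (F.map₂ α)) (α ▷ η b) :=
    (hη.heq α).symm
  have map_id (a : A) : F.map (𝟙 a) = 𝟙 (F.obj a) := D.hom (by
    rw [nat, hU.map_id, Strict.id_comp, Strict.comp_id])
  have map_comp {a b c : A} (f : a ⟶ b) (g : b ⟶ c) : F.map (f ≫ g) = F.map f ≫ F.map g :=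
    D.hom (by
      rw [nat, hU.map_comp, ← Strict.assoc, nat, Strict.assoc, Strict.assoc, nat])
  have counit {y z : B} (f : y ⟶ z) : F.map (U.map f) ≫ θ z = θ y ≫ f := D.hom (by
    rw [hU.map_comp, hU.map_comp, ← Strict.assoc, nat, Strict.assoc, tri, ← Strict.assoc, tri,
      Strict.comp_id, Strict.id_comp])
  refine ⟨.of_heq F map_id map_comp (fun f => ?_) (fun α β => ?_) (fun f _ _ α => ?_)
    (fun α f => ?_), hU, hη, .of_heq counit (fun {y z f g} α => ?_), fun x => ?_, tri⟩
  · refine D.hom₂ (eq_of_heq ((nat₂ _).trans ?_))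
    rw [hU.map₂_id, id_whiskerRight, whiskerLeft_id, nat]
  · refine D.hom₂ (eq_of_heq ((nat₂ _).trans ?_))
    rw [hU.map₂_comp, comp_whiskerRight, whiskerLeft_comp]
    exact comp₂_heq rfl rfl (heq_of_eq (nat _).symm) (heq_of_eq (nat _).symm)
      (heq_of_eq (nat _).symm) (nat₂ α).symm (nat₂ β).symm
  · refine D.heq (map_comp _ _) (map_comp _ _) ((nat₂ _).trans ((wl_wr_heq f α _).trans ?_))
    refine HEq.trans ?_ (wl_heq' rfl (hU.map_comp _ _) (hU.map_comp _ _) 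
      (hU.wl_heq (F.map f) (F.map₂ α))).symm
    refine HEq.trans ?_ ((wl_heq' (nat f) rfl rfl HEq.rfl).symm.trans (comp_wl_heq _ _ _))
    refine HEq.trans ?_ (comp_wl_heq _ _ _).symm
    exact wl_heq' rfl (nat _).symm (nat _).symm (nat₂ α).symm
  · refine D.heq (map_comp _ _) (map_comp _ _) ((nat₂ _).trans ?_)
    refine HEq.trans ?_ (wl_heq' rfl (hU.map_comp _ _) (hU.map_comp _ _) 
      (hU.wr_heq (F.map₂ α) (F.map f))).symm
    refine HEq.trans ?_ (wl_wr_heq _ _ _)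
    refine HEq.trans ?_ (wr_heq' rfl (nat _) (nat _) (nat₂ α)).symm
    refine HEq.trans ?_ (wr_comp_heq _ _ _)
    refine HEq.trans ?_ (wr_heq' (nat f) rfl rfl HEq.rfl).symm
    exact (wr_comp_heq _ _ _).symm
  · refine D.heq (counit f) (counit g) ?_
    change HEq (η (U.obj y) ◁ U.map₂ (F.map₂ (U.map₂ α) ▷ θ z)) (η (U.obj y) ◁ U.map₂ (θ y ◁ α))
    refine (wl_heq' rfl (hU.map_comp _ _) (hU.map_comp _ _) (hU.wr_heq _ _)).trans ?_
    refine HEq.trans ?_ (wl_heq' rfl (hU.map_comp _ _) (hU.map_comp _ _) (hU.wl_heq _ _)).symm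
    refine (wl_wr_heq _ _ _).symm.trans ((wr_heq' rfl (nat _) (nat _) (nat₂ _)).trans ?_)
    refine (wr_comp_heq _ _ _).symm.trans ((wr_heq' (tri z) rfl rfl HEq.rfl).trans ?_)
    refine (wr_id_heq _).trans (HEq.trans ?_ (comp_wl_heq _ _ _))
    exact (id_wl_heq _).symm.trans (wl_heq' (tri y).symm rfl rfl HEq.rfl)
  · refine D.hom ?_
    rw [hU.map_comp, ← Strict.assoc, nat, Strict.assoc, tri, hU.map_id]

/-! ### The oplax structure on a left adjoint of a lax monoidal 2-functor -/

section Mates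

variable {M : MonoidalData A} {N : MonoidalData B}

theorem IsStronglyMonoidal.hom_comp (hM : IsStronglyMonoidal M) {a a' a'' b b' b'' : A} (f : a ⟶ a')
    (f' : a' ⟶ a'') (g : b ⟶ b') (g' : b' ⟶ b'') :
    M.hom (f ≫ f') (g ≫ g') = M.hom f g ≫ M.hom f' g' :=
  hM.tensor_functor.map_comp (f ×ₘ g) (f' ×ₘ g')

variable {φ : ∀ x y : B, M.tensor.obj (U.obj x, U.obj y) ⟶ U.obj (N.tensor.obj (x, y))}
  {φ₀ : M.unit ⟶ U.obj N.unit}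

theorem IsTwoAdjunction.nat (h : IsTwoAdjunction F U η θ) {a b : A} (f : a ⟶ b) :
    η a ≫ U.map (F.map f) = f ≫ η b :=
  (h.unit_natural.naturality f).symm

/-- Transposing a 1-cell to the left adjoint and back gives the original 1-cell. -/
theorem IsTwoAdjunction.unit_transpose (h : IsTwoAdjunction F U η θ) {x : A} {y : B}
    (f : x ⟶ U.obj y) : η x ≫ U.map (F.map f ≫ θ y) = f := by
  rw [h.right_functor.map_comp, ← Strict.assoc, h.nat, Strict.assoc, h.right_triangle,
    Strict.comp_id]

/-- The characterization of the mate by which all oplax axioms are verified. -/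
theorem IsTwoAdjunction.unit_mateTensor (h : IsTwoAdjunction F U η θ) (x y : A) :
    η (M.tensor.obj (x, y)) ≫ U.map (mateTensor M N F U η θ φ x y) =
      M.hom (η x) (η y) ≫ φ (F.obj x) (F.obj y) := by
  rw [mateTensor, ← Strict.assoc, ← h.left_functor.map_comp, h.unit_transpose]

theorem IsTwoAdjunction.unit_mateUnit (h : IsTwoAdjunction F U η θ) :
    η M.unit ≫ U.map (mateUnit M N F U θ φ₀) = φ₀ :=
  h.unit_transpose φ₀

theorem map₂_prod_heq {X Y Z : Type*} [Bicategory X] [Bicategory Y] [Bicategory Z]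
    (P : PrelaxFunctorStruct (X × Y) Z) {x x' : X} {y y' : Y} {f g f' g' : x ⟶ x'}
    {k l k' l' : y ⟶ y'} (hf : f = f') (hg : g = g') (hk : k = k') (hl : l = l') {α : f ⟶ g}
    {α' : f' ⟶ g'} {β : k ⟶ l} {β' : k' ⟶ l'} (hα : HEq α α') (hβ : HEq β β') :
    HEq (P.map₂ (f := f ×ₘ k) (g := g ×ₘ l) (α ×ₘ β))
      (P.map₂ (f := f' ×ₘ k') (g := g' ×ₘ l') (α' ×ₘ β')) := by
  subst hf hg hk hl; cases hα; cases hβ; rfl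

/-- The left 2-adjoint of a **Cat**-lax monoidal functor is **Cat**-oplax monoidal, with the mates
as structure 1-cells. Each axiom is transported, along the unit, to the corresponding lax axiom. -/
theorem IsTwoAdjunction.isCatOplaxMonoidal (h : IsTwoAdjunction F U η θ)
    (D : UnitDetermines F U η) (L : IsCatLaxMonoidal N M U φ φ₀) :
    IsCatOplaxMonoidal M N F (mateTensor M N F U η θ φ) (mateUnit M N F U θ φ₀) := by
  have hU := h.right_functor
  have hM := L.target
  have nat₁ {x x' y y' : B} (f : x ⟶ x') (g : y ⟶ y') : M.hom (U.map f) (U.map g) ≫ φ x' y' =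
    φ x y ≫ U.map (N.hom f g) := L.natural.naturality (a := (x, y)) (b := (x', y')) (f ×ₘ g)
  have nat₂ {x x' y y' : B} {f g : x ⟶ x'} {k l : y ⟶ y'} (α : f ⟶ g) (β : k ⟶ l) :
      HEq (M.tensor.map₂ (f := U.map f ×ₘ U.map k) (g := U.map g ×ₘ U.map l)
          (U.map₂ α ×ₘ U.map₂ β) ▷ φ x' y')
        (φ x y ◁ U.map₂ (N.tensor.map₂ (f := f ×ₘ k) (g := g ×ₘ l) (α ×ₘ β))) :=
    L.natural.heq (a := (x, y)) (b := (x', y')) (f := f ×ₘ k) (g := g ×ₘ l)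
      (Prod.mkHom (X₁ := f) (X₂ := g) (Y₁ := k) (Y₂ := l) α β)
  -- The transpose of a composite with a mate only involves the lax structure.
  have mate {x y : A} {z : B} (k : N.tensor.obj (F.obj x, F.obj y) ⟶ z) :
      η _ ≫ U.map (mateTensor M N F U η θ φ x y ≫ k) =
        M.hom (η x) (η y) ≫ φ (F.obj x) (F.obj y) ≫ U.map k := by
    rw [hU.map_comp, ← Strict.assoc, h.unit_mateTensor, Strict.assoc]
  -- By naturality of `φ`, 1-cells of the form `F x ⟶ x'` move past `φ` and meet the unit.
  have slide {x y : A} {x' y' : B} (f : F.obj x ⟶ x') (g : F.obj y ⟶ y') :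
      M.hom (η x) (η y) ≫ φ (F.obj x) (F.obj y) ≫ U.map (N.hom f g) =
        M.hom (η x ≫ U.map f) (η y ≫ U.map g) ≫ φ x' y' := by
    rw [← nat₁, ← Strict.assoc, hM.hom_comp]
  have slide_comp {x y : A} {x' y' : B} {z : B} (f : F.obj x ⟶ x') (g : F.obj y ⟶ y')
      (k : N.tensor.obj (x', y') ⟶ z) :
      M.hom (η x) (η y) ≫ φ (F.obj x) (F.obj y) ≫ U.map (N.hom f g ≫ k) =
        M.hom (η x ≫ U.map f) (η y ≫ U.map g) ≫ φ x' y' ≫ U.map k := by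
    rw [hU.map_comp, ← Strict.assoc (M.hom (η x ≫ U.map f) _), ← slide]
    simp only [Strict.assoc]
  have unit_id (x : A) : η x ≫ U.map (𝟙 (F.obj x)) = η x := by rw [hU.map_id, Strict.comp_id]
  have natural {x x' y y' : A} (f : x ⟶ x') (g : y ⟶ y') :
      F.map (M.hom f g) ≫ mateTensor M N F U η θ φ x' y' =
        mateTensor M N F U η θ φ x y ≫ N.hom (F.map f) (F.map g) := D.hom (by
    rw [mate, slide, h.nat, h.nat, hM.hom_comp, hU.map_comp, ← Strict.assoc, h.nat, Strict.assoc,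
      h.unit_mateTensor, Strict.assoc])
  have assoc_nat {x x' y y' z z' : A} (f : x ⟶ x') (g : y ⟶ y') (k : z ⟶ z') :
      M.hom (M.hom f g) k ≫ M.assoc x' y' z' = M.assoc x y z ≫ M.hom f (M.hom g k) :=
    hM.assoc_natural.naturality (a := ((x, y), z)) (b := ((x', y'), z')) ((f ×ₘ g) ×ₘ k)
  refine ⟨hM, L.source, h.left_functor,
    .of_heq (fun f => natural f.1 f.2) (fun {a b f g} α => ?_), fun x y z => D.hom ?_,
    fun x => D.hom ?_, fun x => D.hom ?_⟩
  · refine D.heq (natural f.1 f.2) (natural g.1 g.2) ?_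
    change HEq (η _ ◁ U.map₂ (F.map₂ (M.tensor.map₂ α) ▷ mateTensor M N F U η θ φ b.1 b.2))
      (η _ ◁ U.map₂ (mateTensor M N F U η θ φ a.1 a.2 ◁
        N.tensor.map₂ (f := F.map f.1 ×ₘ F.map f.2) (g := F.map g.1 ×ₘ F.map g.2)
          (F.map₂ α.1 ×ₘ F.map₂ α.2)))
    refine (wl_heq' rfl (hU.map_comp _ _) (hU.map_comp _ _) (hU.wr_heq _ _)).trans ?_
    refine HEq.trans ?_ (wl_heq' rfl (hU.map_comp _ _) (hU.map_comp _ _) (hU.wl_heq _ _)).symm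
    refine (wl_wr_heq _ _ _).symm.trans ((wr_heq' rfl (h.nat _) (h.nat _)
      (h.unit_natural.heq _).symm).trans ?_)
    refine HEq.trans ?_ (comp_wl_heq _ _ _)
    refine (wr_comp_heq _ _ _).symm.trans ((wr_heq' (h.unit_mateTensor _ _) rfl rfl
      HEq.rfl).trans ?_)
    refine HEq.trans ?_ (wl_heq' (h.unit_mateTensor _ _) rfl rfl HEq.rfl).symm
    refine (wr_comp_heq _ _ _).trans (HEq.trans ?_ (comp_wl_heq _ _ _).symm)
    refine HEq.trans ?_ (wl_heq' rfl (nat₁ _ _) (nat₁ _ _) (nat₂ (F.map₂ α.1) (F.map₂ α.2)))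
    refine HEq.trans ?_ (wl_wr_heq _ _ _)
    -- After cancelling `φ`, both sides are the image under the tensor product of the naturality
    -- square of the unit.
    have sq {x x' y y' : A} (f : x ⟶ x') (g : y ⟶ y') :
        M.hom f g ≫ M.hom (η x') (η y') =
          M.hom (η x) (η y) ≫ M.hom (U.map (F.map f)) (U.map (F.map g)) := by
      rw [← hM.hom_comp, ← hM.hom_comp, h.nat, h.nat]
    refine wr_heq' rfl (sq f.1 f.2) (sq g.1 g.2) ?_
    refine (hM.tensor_functor.wr_heq α (η b.1 ×ₘ η b.2)).symm.trans (HEq.trans ?_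
      (hM.tensor_functor.wl_heq (η a.1 ×ₘ η a.2) (g := U.map (F.map f.1) ×ₘ U.map (F.map f.2))
        (k := U.map (F.map g.1) ×ₘ U.map (F.map g.2)) (U.map₂ (F.map₂ α.1) ×ₘ U.map₂ (F.map₂ α.2))))
    exact map₂_prod_heq M.tensor (h.nat _).symm (h.nat _).symm (h.nat _).symm (h.nat _).symm
      (h.unit_natural.heq α.1) (h.unit_natural.heq α.2)
  · have e : M.hom (η x) (M.hom (η y) (η z) ≫ φ (F.obj y) (F.obj z)) =
        M.hom (η x) (M.hom (η y) (η z)) ≫ M.hom (𝟙 _) (φ (F.obj y) (F.obj z)) := by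
      rw [← hM.hom_comp, Strict.comp_id]
    have e' : M.hom (M.hom (η x) (η y) ≫ φ (F.obj x) (F.obj y)) (η z) =
        M.hom (M.hom (η x) (η y)) (η z) ≫ M.hom (φ (F.obj x) (F.obj y)) (𝟙 _) := by
      rw [← hM.hom_comp, Strict.comp_id]
    rw [hU.map_comp, ← Strict.assoc, h.nat, Strict.assoc, mate, slide, mate, slide_comp,
      unit_id, unit_id, h.unit_mateTensor, h.unit_mateTensor, e, e', Strict.assoc, Strict.assoc,
      L.associativity, ← Strict.assoc, ← assoc_nat, Strict.assoc]
  · have e : M.hom φ₀ (η x) = M.hom (𝟙 M.unit) (η x) ≫ M.hom φ₀ (𝟙 _) := by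
      rw [← hM.hom_comp, Strict.comp_id, Strict.id_comp]
    rw [mate, slide_comp, unit_id, h.unit_mateUnit, e, Strict.assoc, L.left_unitality, h.nat]
    exact hM.leftUnitor_natural.naturality (η x)
  · have e : M.hom (η x) φ₀ = M.hom (η x) (𝟙 M.unit) ≫ M.hom (𝟙 _) φ₀ := by
      rw [← hM.hom_comp, Strict.comp_id, Strict.id_comp]
    rw [mate, slide_comp, unit_id, h.unit_mateUnit, e, Strict.assoc, L.right_unitality, h.nat]
    exact hM.rightUnitor_natural.naturality (η x)

end Mates

end Doctrinal

/-! ### Strictification is an oplax monoidal left 2-adjoint -/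

theorem stUnit_determines : UnitDetermines st.{u} incl.{u} stUnit where
  hom h := stIncl_cancel h
  hom₂ h := stIncl_cancel_icon h

theorem st_isTwoAdjunction : IsTwoAdjunction st.{u} incl.{u} stUnit stCounit :=
  stUnit_determines.isTwoAdjunction incl_isTwoFunctor
    (.of_heq (fun F => stIncl_natural F) (fun α => stIncl_natural₂ α))
    (fun A => stIncl_stEval A)

end IconGray

theorem corollary5p5 :
    IconGray.IsTwoAdjunction IconGray.st.{u} IconGray.incl.{u} IconGray.stUnit IconGray.stCounit ∧
    (∀ A B : IconGray.GrayCat.{u}, IconGray.IsUniversalCubical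
      (T := IconGray.grayMonoidal.tensor.obj (A, B)) (IconGray.cubHom A B)) ∧
    IconGray.IsCatLaxMonoidal IconGray.grayMonoidal.{u} IconGray.iconMonoidal.{u} IconGray.incl
      IconGray.cubHom (𝟙 IconGray.iconMonoidal.unit) ∧
    IconGray.IsCatOplaxMonoidal IconGray.iconMonoidal.{u} IconGray.grayMonoidal.{u} IconGray.st
      (IconGray.mateTensor IconGray.iconMonoidal IconGray.grayMonoidal IconGray.st IconGray.incl
        IconGray.stUnit IconGray.stCounit IconGray.cubHom)
      (IconGray.mateUnit IconGray.iconMonoidal IconGray.grayMonoidal IconGray.st IconGray.incl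
        IconGray.stCounit (𝟙 IconGray.iconMonoidal.unit)) :=
  ⟨IconGray.st_isTwoAdjunction, IconGray.cub_isUniversalCubical, IconGray.incl_isCatLaxMonoidal,
    IconGray.st_isTwoAdjunction.isCatOplaxMonoidal IconGray.stUnit_determines
      IconGray.incl_isCatLaxMonoidal⟩
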